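/- Let $p$ be a prime. For $h\ge 0$ let $\Sigma_h$ be the set of all unions of balls $a+p^h\mathbb Z_p\subset\mathbb Q_p$, and let $\Sigma_{\rm unif}=\bigcup_h\Sigma_h$. For $k=\mathbb Z_p$ ($p$-adic topology) or $k=\mathbb F_p$ (discrete topology) let $\mathscr D_{\rm unif}(\mathbb Q_p,k)$ be the set of maps $\mu:\Sigma_{\rm unif}\to k$ such that, for every $h$ and every disjoint family $(U_\alpha)$ in $\Sigma_h$, the series $\sum_\alpha\mu(U_\alpha)$ converges unconditionally to $\mu(\bigcup_\alpha U_\alpha)$. It is a commutative ring under convolution, with unit the Dirac mass at $0$; its natural topology is that of uniform convergence on each $\Sigma_h$. Let $\Delta_a$ (resp. $\delta_a$) be the $\mathbb Z_p$-valued (resp. $\mathbb F_p$-valued) Dirac mass at $a\in\mathbb Q_p$; put $t_n=\delta_{1/p^n}-\delta_0$, $t=t_0$, $T_n=\Delta_{1/p^n}-\Delta_0$, $T=T_0$. For a ring $R$, let $R[X^{1/p^\infty}]$ be the ring with $R$-basis the monomials $X^q$, $q\in\mathbb Z[1/p]$, $q\ge0$. "Completion" means separated completion as a topological ring. 1. The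 natural topology of $\mathscr D_{\rm unif}(\mathbb Q_p,\mathbb F_p)$ is the $t$-adic one. The group algebra $\mathbb F_p[\mathbb Q_p]$ embeds in $\mathscr D_{\rm unif}(\mathbb Q_p,\mathbb F_p)$ via Dirac masses, and $\mathscr D_{\rm unif}(\mathbb Q_p,\mathbb F_p)$ is its completion for the topology induced by the $t$-adic topology of $\mathscr D_{\rm unif}(\mathbb Q_p,\mathbb F_p)$. Moreover $\mathscr D_{\rm unif}(\mathbb Q_p,\mathbb F_p)$ is the completion of the group algebra $\mathbb F_p[\mathbb Z[1/p]]$ in its own $(\delta_1-\delta_0)$-adic topology, and the completion of $\mathbb F_p[t^{1/p^\infty}]$ (embedded by $t^{1/p^n}\mapsto t_n$) in its own $t$-adic topology. In particular it is a perfect ring of characteristic $p$. 2. $\mathscr D_{\rm unif}(\mathbb Q_p,\mathbb Z_p)$ is $p$-adically separated and complete, and reduction modulo $p$ of measures induces an isomorphism $\mathscr D_{\rm unif}(\mathbb Q_p,\mathbb Z_p)/p\cong\mathscr D_{\rm unif}(\mathbb Q_p,\mathbb F_p)$. So $\mathscr D_{\rm unif}(\mathbb Q_p,\mathbb Z_p)$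 is a strict $p$-ring, and there is a unique ring isomorphism $e:\mathscr D_{\rm unif}(\mathbb Q_p,\mathbb Z_p)\to W(\mathscr D_{\rm unif}(\mathbb Q_p,\mathbb F_p))$ whose $0$-th Witt component is reduction modulo $p$. By 1, this ring is identified with $\mathbf A_{\inf}$, the ring of Witt vectors of the $t$-adic completion of $\mathbb F_p[t^{1/p^\infty}]$. 3. The natural topology of $\mathscr D_{\rm unif}(\mathbb Q_p,\mathbb Z_p)$ is the $(p,T)$-adic one. The group algebra $\mathbb Z[\mathbb Q_p]$ embeds in $\mathscr D_{\rm unif}(\mathbb Q_p,\mathbb Z_p)$ via Dirac masses, and $\mathscr D_{\rm unif}(\mathbb Q_p,\mathbb Z_p)$ is its completion for the topology induced by the $(p,T)$-adic topology of $\mathscr D_{\rm unif}(\mathbb Q_p,\mathbb Z_p)$. Moreover $\mathscr D_{\rm unif}(\mathbb Q_p,\mathbb Z_p)$ is the completion of the group algebra $\mathbb Z[\mathbb Z[1/p]]$ in its own $(p,\Delta_1-\Delta_0)$-adic topology. 4. For every $n\ge0$ the sequence $T_{n+m}^{p^m}$ converges $p$-adically, as $m\to\infty$, to $\widetilde T_n=e^{-1}([t_n])$,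 where $[\,\cdot\,]$ is the Teichmüller lift, and $t_n^{p^n}=t$, i.e. $t_n=t^{1/p^n}$. Put $\widetilde T=\widetilde T_0$. For $n\ge1$, $\widetilde T_n$ is the only $p^n$-th root of $\widetilde T$ in $\mathscr D_{\rm unif}(\mathbb Q_p,\mathbb Z_p)$ if $p$ is odd, and the $2^n$-th roots of $\widetilde T$ are exactly $\pm\widetilde T_n$ if $p=2$. The map $X^{1/p^n}\mapsto\widetilde T_n$ embeds $\mathbb Z[X^{1/p^\infty}]$ in $\mathscr D_{\rm unif}(\mathbb Q_p,\mathbb Z_p)$ as a subring $\mathbb Z[\widetilde T^{1/p^\infty}]$, and $\mathscr D_{\rm unif}(\mathbb Q_p,\mathbb Z_p)$ with its natural topology, which is the $(p,\widetilde T)$-adic one, is the completion of this subring in its own $(p,\widetilde T)$-adic topology. 5. The isomorphism $e$ is a homeomorphism (a) for the $p$-adic topologies on both sides (on the Witt vectors this is also the product topology of the discrete topologies), and (b) for the natural topology of $\mathscr D_{\rm unif}(\mathbb Q_p,\mathbb Z_p)$ and the product topology on the Witt vectors coming from the natural topology of $\mathscr D_{\rm unif}(\mathbb Q_p,\mathbb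 F_p)$. -/

import Mathlib

open Filter Topology

set_option linter.unusedSectionVars false

namespace DiscreteMeasure

variable {G H k : Type} [CommRing k] [UniformSpace k]

/-- A `k`-valued measure on the discrete set `G`: for every disjoint family of subsets the series
of the values converges unconditionally to the value on the union. -/
def IsMeas (m : Set G → k) : Prop :=
  ∀ (A : Type) (V : A → Set G), Pairwise (fun a b => Disjoint (V a) (V b)) →
    HasSum (fun a => m (V a)) (m (⋃ a, V a))

/-- The integral of an arbitrary function on a discrete set. -/
noncomputable def integral (m : Set G → k) (F : G → k) : k := ∑' d, m {d} * F d

/-- The convolution of two measures on a discrete abelian group: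
`V ↦ ∫ n (V - x) dm(x)`, i.e. the push-forward of the product measure under addition. -/
noncomputable def conv [AddCommGroup G] (m n : Set G → k) (V : Set G) : k :=
  integral m fun d => n {e | d + e ∈ V}

variable [IsUniformAddGroup k] [IsTopologicalRing k] [IsLinearTopology k k]
  [CompleteSpace k] [T2Space k]

theorem nonarch : NonarchimedeanAddGroup k where
  is_nonarchimedean U hU := by
    obtain ⟨I, hI, hIU⟩ := (IsLinearTopology.hasBasis_open_ideal (R := k)).mem_iff.1 hU
    exact ⟨⟨I.toAddSubgroup, hI⟩, hIU⟩

theorem summable_of_ideals {A : Type} (f : A → k)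
    (h : ∀ I : Ideal k, IsOpen (I : Set k) → {a | f a ∉ I}.Finite) : Summable f := by
  have := nonarch (k := k)
  apply NonarchimedeanAddGroup.summable_of_tendsto_cofinite_zero
  rw [(IsLinearTopology.hasBasis_open_ideal (R := k)).tendsto_right_iff]
  intro I hI
  simpa [Filter.eventually_cofinite] using h I hI

theorem finite_of_hasSum {A : Type} {f : A → k} {s : k} (h : HasSum f s)
    (I : Ideal k) (hI : IsOpen (I : Set k)) : {a | f a ∉ I}.Finite := by
  have := h.summable.tendsto_cofinite_zero (hI.mem_nhds (by simp))
  exact this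

theorem IsMeas.finite {m : Set G → k} (hm : IsMeas m) (I : Ideal k) (hI : IsOpen (I : Set k)) :
    {d | m {d} ∉ I}.Finite :=
  finite_of_hasSum (hm G (fun d => {d}) (fun a b hab => by simpa using hab)) I hI

theorem IsMeas.summable {m : Set G → k} (hm : IsMeas m) (F : G → k) :
    Summable fun d => m {d} * F d :=
  summable_of_ideals _ fun I hI => (hm.finite I hI).subset fun _ hd h =>
    hd (I.mul_mem_right _ h)

theorem IsMeas.summable_prod {A : Type} {m : Set G → k} (hm : IsMeas m) (F : G → A → k)
    (hF : ∀ d, Summable (F d)) : Summable fun x : G × A => m {x.1} * F x.1 x.2 := by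
  apply summable_of_ideals
  intro I hI
  have hf := hm.finite I hI
  refine Set.Finite.subset (hf.biUnion (t := fun d => (fun a => (d, a)) '' {a | F d a ∉ I})
    fun d _ => (finite_of_hasSum (hF d).hasSum I hI).image _) ?_
  rintro ⟨d, a⟩ h
  simp only [Set.mem_ofPred_eq] at h
  simp only [Set.mem_iUnion, Set.mem_ofPred_eq, Set.mem_image, Prod.mk.injEq]
  exact ⟨d, fun h' => h (I.mul_mem_right _ h'), a, fun h' => h (I.mul_mem_left _ h'), rfl, rfl⟩

theorem integral_integral {m : Set G → k} {n : Set H → k} (hm : IsMeas m) (hn : IsMeas n)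
    (F : G → H → k) :
    integral m (fun d => integral n (F d)) = ∑' x : G × H, m {x.1} * (n {x.2} * F x.1 x.2) := by
  have hs := hm.summable_prod (fun d e => n {e} * F d e) (fun d => hn.summable (F d))
  rw [hs.tsum_prod]
  refine tsum_congr fun d => ?_
  exact ((hn.summable (F d)).tsum_mul_left _).symm

theorem integral_comm {m : Set G → k} {n : Set H → k} (hm : IsMeas m) (hn : IsMeas n)
    (F : G → H → k) :
    integral m (fun d => integral n (F d)) = integral n (fun e => integral m (fun d => F d e)) := by
  rw [integral_integral hm hn, integral_integral hn hm, ← (Equiv.prodComm H G).tsum_eq]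
  refine tsum_congr fun x => ?_
  simp only [Equiv.prodComm_apply, Prod.fst_swap, Prod.snd_swap]
  ring

open Classical in
theorem IsMeas.eq_integral {m : Set G → k} (hm : IsMeas m) (V : Set G) :
    m V = integral m (fun d => if d ∈ V then 1 else 0) := by
  have h := hm V (fun d => {d.1}) (fun a b hab => by simpa [Subtype.ext_iff] using hab)
  have hV : (⋃ a : V, ({a.1} : Set G)) = V := by ext; simp
  rw [hV] at h
  rw [← h.tsum_eq, integral, tsum_subtype V (fun d => m {d})]
  refine tsum_congr fun d => ?_
  by_cases hd : d ∈ V <;> simp [hd]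

theorem integral_add_left {m n : Set G → k} (hm : IsMeas m) (hn : IsMeas n) (F : G → k) :
    integral (m + n) F = integral m F + integral n F := by
  simp only [integral, Pi.add_apply, add_mul]
  exact (hm.summable F).tsum_add (hn.summable F)

/-- Integration against a push-forward. -/
theorem integral_map {m : Set G → k} (hm : IsMeas m) (f : G → H) (F : H → k) :
    integral (fun V => m (f ⁻¹' V)) F = integral m (F ∘ f) := by
  have hs := (hm.summable (F ∘ f))
  rw [integral, integral, ← (Equiv.sigmaFiberEquiv f).tsum_eq (fun d => m {d} * (F ∘ f) d)]
  have hs' := (Equiv.sigmaFiberEquiv f).summable_iff.2 hs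
  refine Eq.trans ?_ hs'.tsum_sigma.symm
  refine tsum_congr fun x => ?_
  have h := hm {y // f y = x} (fun d => {d.1})
    (fun a b hab => by simpa [Subtype.ext_iff] using hab)
  have hV : (⋃ a : {y // f y = x}, ({a.1} : Set G)) = f ⁻¹' {x} := by ext; simp
  rw [hV] at h
  rw [← h.tsum_eq, ← h.summable.tsum_mul_right]
  refine tsum_congr fun y => ?_
  simp [Equiv.sigmaFiberEquiv, y.2]

section group
variable [AddCommGroup G] [AddCommGroup H]

theorem IsMeas.conv {m n : Set G → k} (hm : IsMeas m) (hn : IsMeas n) : IsMeas (conv m n) := by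
  intro A V hV
  have h1 : ∀ d, HasSum (fun a => n {e | d + e ∈ V a}) (n {e | d + e ∈ ⋃ a, V a}) := by
    intro d
    have := hn A (fun a => {e | d + e ∈ V a}) (fun a b hab => (hV hab).preimage (fun e => d + e))
    convert this using 2
    ext e; simp
  have hs := hm.summable_prod (fun d a => n {e | d + e ∈ V a}) (fun d => (h1 d).summable)
  have hs' := (Equiv.prodComm A G).summable_iff.2 hs
  have key := hs'.hasSum.prod_fiberwise (fun a => by
    have := (hm.summable fun d => n {e | d + e ∈ V a}).hasSum
    exact this)
  refine (congrArg (HasSum _) ?_).mpr key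
  show _ = ∑' b : A × G, (fun x : G × A => m {x.1} * n {e | x.1 + e ∈ V x.2}) (Equiv.prodComm A G b)
  rw [(Equiv.prodComm A G).tsum_eq (fun x : G × A => m {x.1} * n {e | x.1 + e ∈ V x.2}),
    hs.tsum_prod]
  refine tsum_congr fun d => ?_
  beta_reduce
  rw [← (h1 d).tsum_eq, ← (h1 d).summable.tsum_mul_left]

theorem conv_comm {m n : Set G → k} (hm : IsMeas m) (hn : IsMeas n) (V : Set G) :
    conv m n V = conv n m V := by
  classical
  simp only [DiscreteMeasure.conv, hn.eq_integral, hm.eq_integral]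
  refine (integral_comm hm hn (fun d e => if d + e ∈ V then (1 : k) else 0)).trans ?_
  refine congrArg _ (funext fun e => congrArg _ (funext fun d => ?_))
  simp [add_comm]

theorem integral_conv {m n : Set G → k} (hm : IsMeas m) (hn : IsMeas n) (F : G → k) :
    integral (conv m n) F = integral m (fun d => integral n (fun e => F (d + e))) := by
  have h1 : ∀ f, conv m n {f} * F f = integral m (fun d => n {f - d} * F f) := by
    intro f
    have : ∀ d, {e | d + e ∈ ({f} : Set G)} = {f - d} := by
      intro d; ext e; simp [eq_sub_iff_add_eq, add_comm]
    simp only [DiscreteMeasure.conv, this]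
    rw [integral, ← (hm.summable _).tsum_mul_right]
    exact tsum_congr fun d => by ring
  have hs : ∀ d, Summable fun f => n {f - d} * F f := by
    intro d
    have := (Equiv.subRight d).summable_iff.2 (hn.summable fun e => F (e + d))
    simpa [Function.comp_def] using this
  have hs2 := hm.summable_prod (fun d f => n {f - d} * F f) hs
  have hs3 := (Equiv.prodComm G G).summable_iff.2 hs2
  have e1 : integral (conv m n) F =
      ∑' x : G × G, m {x.1} * (n {x.2 - x.1} * F x.2) := by
    rw [← (Equiv.prodComm G G).tsum_eq
      (fun x : G × G => m {x.1} * (n {x.2 - x.1} * F x.2))]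
    refine Eq.trans ?_ hs3.tsum_prod.symm
    exact tsum_congr fun f => h1 f
  rw [e1, hs2.tsum_prod]
  refine tsum_congr fun d => ?_
  refine ((hs d).tsum_mul_left (m {d})).trans (congrArg (m {d} * ·) ?_)
  refine Eq.trans ?_ ((Equiv.subRight d).tsum_eq fun e => n {e} * F (d + e))
  simp

theorem conv_assoc {m n q : Set G → k} (hm : IsMeas m) (hn : IsMeas n) (V : Set G) :
    conv (conv m n) q V = conv m (conv n q) V := by
  rw [DiscreteMeasure.conv, integral_conv hm hn]
  simp only [DiscreteMeasure.conv, Set.mem_ofPred_eq, add_assoc]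

/-- Push-forward along a homomorphism is multiplicative. -/
theorem conv_map {m n : Set G → k} (hm : IsMeas m) (f : G →+ H) (V : Set H) :
    conv (fun W => m (f ⁻¹' W)) (fun W => n (f ⁻¹' W)) V = conv m n (f ⁻¹' V) := by
  rw [DiscreteMeasure.conv, integral_map hm]
  simp only [DiscreteMeasure.conv, Function.comp_def, Set.preimage, Set.mem_ofPred_eq, map_add]

theorem conv_add_left {m m' n : Set G → k} (hm : IsMeas m) (hm' : IsMeas m') :
    conv (m + m') n = conv m n + conv m' n :=
  funext fun _ => integral_add_left hm hm' _

end group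
end DiscreteMeasure

/-- The compact open subgroup `p ^ h ℤ_p` of `ℚ_p`. -/
def ballSubgroup (p : ℕ) [Fact p.Prime] (h : ℕ) : AddSubgroup ℚ_[p] where
  carrier := {x | ‖x‖ ≤ (p : ℝ) ^ (-(h : ℤ))}
  zero_mem' := by
    simp
  add_mem' {a b} ha hb := (Padic.nonarchimedean a b).trans (max_le ha hb)
  neg_mem' {a} ha := by simpa using ha

/-- `Σ_h`: the uniformly measurable subsets of `ℚ_p` of radius `h`, i.e. the unions of balls
`a + p ^ h ℤ_p`. -/
def unifMeasurableOfRadius (p : ℕ) [Fact p.Prime] (h : ℕ) : Set (Set ℚ_[p]) :=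
  Set.range fun V : Set (ℚ_[p] ⧸ ballSubgroup p h) =>
    (QuotientAddGroup.mk : ℚ_[p] → ℚ_[p] ⧸ ballSubgroup p h) ⁻¹' V

/-- `Σ_unif`: the uniformly measurable subsets of `ℚ_p`. -/
def unifMeasurable (p : ℕ) [Fact p.Prime] : Set (Set ℚ_[p]) :=
  {U | ∃ h, U ∈ unifMeasurableOfRadius p h}

theorem iUnion_mem_unifMeasurable {p : ℕ} [Fact p.Prime] {h : ℕ} {A : Type}
    {U : A → Set ℚ_[p]} (hU : ∀ a, U a ∈ unifMeasurableOfRadius p h) :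
    (⋃ a, U a) ∈ unifMeasurable p := by
  choose V hV using hU
  exact ⟨h, ⋃ a, V a, by simp only [Set.preimage_iUnion, hV]⟩

/-- A uniform `k`-valued measure on `ℚ_p`: a map `Σ_unif → k` such that, for every disjoint family
of uniformly measurable sets of one same radius, the series of the values converges
unconditionally to the value on the union. -/
@[ext]
structure UnifMeasure (p : ℕ) [Fact p.Prime] (k : Type) [CommRing k] [UniformSpace k] where
  toFun : unifMeasurable p → k
  hasSum_iUnion : ∀ (h : ℕ) (A : Type) (U : A → Set ℚ_[p])
    (hU : ∀ a, U a ∈ unifMeasurableOfRadius p h), Pairwise (fun a b => Disjoint (U a) (U b)) →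
      HasSum (fun a => toFun ⟨U a, h, hU a⟩) (toFun ⟨⋃ a, U a, iUnion_mem_unifMeasurable hU⟩)

namespace UnifMeasure

open DiscreteMeasure

section basic
variable {p : ℕ} [Fact p.Prime] {k : Type} [CommRing k] [UniformSpace k]

theorem toFun_injective : Function.Injective (toFun : UnifMeasure p k → unifMeasurable p → k) :=
  fun _ _ h => UnifMeasure.ext h

/-- The push-forward of a set function on `Σ_unif` to the discrete quotient `ℚ_p / p ^ h ℤ_p`. -/
def push (f : unifMeasurable p → k) (h : ℕ) (V : Set (ℚ_[p] ⧸ ballSubgroup p h)) : k :=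
  f ⟨QuotientAddGroup.mk ⁻¹' V, h, V, rfl⟩

theorem isMeas_push (μ : UnifMeasure p k) (h : ℕ) : IsMeas (push μ.toFun h) := by
  intro A V hV
  have := μ.hasSum_iUnion h A (fun a => QuotientAddGroup.mk ⁻¹' V a) (fun a => ⟨V a, rfl⟩)
    (fun a b hab => (hV hab).preimage _)
  simp only [push, Set.preimage_iUnion]
  exact this

theorem ext_push {f g : unifMeasurable p → k} (H : ∀ h V, push f h V = push g h V) : f = g := by
  funext ⟨U, h, V, hV⟩
  subst hV
  exact H h V

theorem ballSubgroup_anti {h h' : ℕ} (hh : h ≤ h') : ballSubgroup p h' ≤ ballSubgroup p h := by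
  intro x hx
  have hp : (1 : ℝ) ≤ p := by exact_mod_cast (Fact.out : p.Prime).one_lt.le
  exact le_trans (show ‖x‖ ≤ _ from hx) (zpow_le_zpow_right₀ hp (by omega))

/-- The transition map `ℚ_p / p ^ h' ℤ_p → ℚ_p / p ^ h ℤ_p` for `h ≤ h'`. -/
noncomputable def transition {h h' : ℕ} (hh : h ≤ h') :
    (ℚ_[p] ⧸ ballSubgroup p h') →+ (ℚ_[p] ⧸ ballSubgroup p h) :=
  QuotientAddGroup.map _ _ (AddMonoidHom.id _) (ballSubgroup_anti hh)

theorem mk_preimage_transition {h h' : ℕ} (hh : h ≤ h') (V : Set (ℚ_[p] ⧸ ballSubgroup p h)) :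
    (QuotientAddGroup.mk : ℚ_[p] → ℚ_[p] ⧸ ballSubgroup p h') ⁻¹' (transition hh ⁻¹' V) =
      (QuotientAddGroup.mk : ℚ_[p] → ℚ_[p] ⧸ ballSubgroup p h) ⁻¹' V := by
  ext x; rfl

theorem push_transition (f : unifMeasurable p → k) {h h' : ℕ} (hh : h ≤ h')
    (V : Set (ℚ_[p] ⧸ ballSubgroup p h)) : push f h V = push f h' (transition hh ⁻¹' V) := rfl

theorem exists_ofLevels (m : ∀ h, Set (ℚ_[p] ⧸ ballSubgroup p h) → k) (U : unifMeasurable p) :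
    ∃ c : k, ∃ h V, U.1 = QuotientAddGroup.mk ⁻¹' V ∧ c = m h V := by
  obtain ⟨U, h, V, hV⟩ := U
  exact ⟨m h V, h, V, hV.symm, rfl⟩

/-- The set function with given push-forwards `m h` to `ℚ_p / p ^ h ℤ_p`, for a compatible
system. -/
noncomputable def ofLevelsFun (m : ∀ h, Set (ℚ_[p] ⧸ ballSubgroup p h) → k)
    (U : unifMeasurable p) : k :=
  (exists_ofLevels m U).choose

theorem push_ofLevelsFun (m : ∀ h, Set (ℚ_[p] ⧸ ballSubgroup p h) → k)
    (hc : ∀ h h' (hh : h ≤ h') V, m h V = m h' (transition hh ⁻¹' V)) (h : ℕ) :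
    push (ofLevelsFun m) h = m h := by
  funext V
  obtain ⟨h', V', h1, h2⟩ :=
    (exists_ofLevels m ⟨QuotientAddGroup.mk ⁻¹' V, h, V, rfl⟩).choose_spec
  refine Eq.trans h2 ?_
  rw [hc h (max h h') (le_max_left _ _), hc h' (max h h') (le_max_right _ _)]
  congr 1
  apply Set.preimage_injective.2 (QuotientAddGroup.mk_surjective (s := ballSubgroup p (max h h')))
  simpa only [mk_preimage_transition] using h1.symm

/-- A set function all of whose push-forwards are measures is a uniform measure. -/
def ofPush (f : unifMeasurable p → k) (hf : ∀ h, IsMeas (push f h)) : UnifMeasure p k where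
  toFun := f
  hasSum_iUnion := by
    intro h A U hU hd
    choose V hV using id hU
    obtain rfl : (fun a => QuotientAddGroup.mk ⁻¹' V a) = U := funext hV
    have hd' : Pairwise (fun a b => Disjoint (V a) (V b)) := fun a b hab =>
      Set.disjoint_left.2 fun x hx hx' => by
        obtain ⟨y, rfl⟩ := QuotientAddGroup.mk_surjective x
        exact Set.disjoint_left.1 (hd hab) hx hx'
    have := hf h A V hd'
    simp only [push, Set.preimage_iUnion] at this
    exact this

open Classical in
/-- The Dirac mass concentrated in `a`. -/
noncomputable def dirac (k : Type) [CommRing k] [UniformSpace k] (a : ℚ_[p]) :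
    UnifMeasure p k where
  toFun U := if a ∈ U.1 then 1 else 0
  hasSum_iUnion := by
    intro h A U _ hd
    by_cases ha : ∃ i, a ∈ U i
    · obtain ⟨i, hi⟩ := ha
      have h1 : ∀ j, j ≠ i → (if a ∈ U j then (1 : k) else 0) = 0 := fun j hj =>
        if_neg fun hj' => Set.disjoint_left.1 (hd hj) hj' hi
      have := hasSum_single i h1
      simpa only [hi, Set.mem_iUnion, show (∃ i, a ∈ U i) from ⟨i, hi⟩, if_true] using this
    · have h1 : ∀ i, a ∉ U i := fun i hi => ha ⟨i, hi⟩
      simp only [h1, Set.mem_iUnion, exists_false, if_false]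
      exact hasSum_zero

end basic

section ring
variable {p : ℕ} [Fact p.Prime] {k : Type} [CommRing k] [UniformSpace k]
  [IsUniformAddGroup k] [IsTopologicalRing k]

instance : Zero (UnifMeasure p k) := ⟨⟨0, fun _ _ _ _ _ => hasSum_zero⟩⟩

instance : Add (UnifMeasure p k) := ⟨fun μ ν => ⟨μ.toFun + ν.toFun, fun h A U hU hd =>
  (μ.hasSum_iUnion h A U hU hd).add (ν.hasSum_iUnion h A U hU hd)⟩⟩

instance : Neg (UnifMeasure p k) := ⟨fun μ => ⟨-μ.toFun, fun h A U hU hd =>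
  (μ.hasSum_iUnion h A U hU hd).neg⟩⟩

instance : Sub (UnifMeasure p k) := ⟨fun μ ν => ⟨μ.toFun - ν.toFun, fun h A U hU hd =>
  (μ.hasSum_iUnion h A U hU hd).sub (ν.hasSum_iUnion h A U hU hd)⟩⟩

instance : SMul k (UnifMeasure p k) := ⟨fun c μ => ⟨c • μ.toFun, fun h A U hU hd =>
  (μ.hasSum_iUnion h A U hU hd).mul_left c⟩⟩

instance : SMul ℕ (UnifMeasure p k) := ⟨fun c μ => ⟨c • μ.toFun, fun h A U hU hd =>
  (μ.hasSum_iUnion h A U hU hd).const_smul c⟩⟩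

instance : SMul ℤ (UnifMeasure p k) := ⟨fun c μ => ⟨c • μ.toFun, fun h A U hU hd =>
  (μ.hasSum_iUnion h A U hU hd).const_smul c⟩⟩

instance : AddCommGroup (UnifMeasure p k) :=
  toFun_injective.addCommGroup _ rfl (fun _ _ => rfl) (fun _ => rfl) (fun _ _ => rfl)
    (fun _ _ => rfl) (fun _ _ => rfl)

instance : Module k (UnifMeasure p k) :=
  toFun_injective.module k ⟨⟨toFun, rfl⟩, fun _ _ => rfl⟩ fun _ _ => rfl

/-- The family of the sets `Σ_h`, for all radii `h`, as subsets of `Σ_unif`. -/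
def radii (p : ℕ) [Fact p.Prime] : Set (Set (unifMeasurable p)) :=
  Set.range fun h : ℕ => {U : unifMeasurable p | U.1 ∈ unifMeasurableOfRadius p h}

/-- A uniform measure as an element of the space of set functions with the uniformity of uniform
convergence on every `Σ_h`. -/
def toUniformOnFun : UnifMeasure p k →+ UniformOnFun (unifMeasurable p) k (radii p) where
  toFun μ := UniformOnFun.ofFun (radii p) μ.toFun
  map_zero' := rfl
  map_add' _ _ := rfl

/-- The natural topology (and uniformity) of the space of uniform measures: uniform convergence on
the uniformly measurable sets of the same radius, for every radius. -/
instance : UniformSpace (UnifMeasure p k) := UniformSpace.comap toUniformOnFun inferInstance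

instance : IsUniformAddGroup (UnifMeasure p k) := IsUniformAddGroup.comap toUniformOnFun

variable [IsLinearTopology k k] [CompleteSpace k] [T2Space k]

/-- Convolution, `(μ * ν)(U) = (μ × ν) {(x, y) | x + y ∈ U}`: at every level `h`, the push-forward to the discrete group `ℚ_p / p ^ h ℤ_p` of
the product is the convolution of the push-forwards. -/
noncomputable instance : Mul (UnifMeasure p k) := ⟨fun μ ν =>
  ofPush (ofLevelsFun fun h => conv (push μ.toFun h) (push ν.toFun h)) fun h => by
    rw [push_ofLevelsFun _ fun _ h' hh V =>
      conv_map (n := push ν.toFun h') (isMeas_push μ h') (transition hh) V]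
    exact (isMeas_push μ h).conv (isMeas_push ν h)⟩

theorem push_mul (μ ν : UnifMeasure p k) (h : ℕ) (V : Set (ℚ_[p] ⧸ ballSubgroup p h)) :
    push (μ * ν).toFun h V = conv (push μ.toFun h) (push ν.toFun h) V :=
  congrFun (push_ofLevelsFun _ (fun _ h' hh V =>
    conv_map (n := push ν.toFun h') (isMeas_push μ h') (transition hh) V) h) V

noncomputable instance : One (UnifMeasure p k) := ⟨dirac k 0⟩

theorem dirac_mul_push (a : ℚ_[p]) (m : UnifMeasure p k) (h : ℕ)
    (V : Set (ℚ_[p] ⧸ ballSubgroup p h)) :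
    push (dirac k a * m).toFun h V = push m.toFun h {e | (a : ℚ_[p] ⧸ ballSubgroup p h) + e ∈ V} := by
  classical
  rw [push_mul, conv, integral, tsum_eq_single (a : ℚ_[p] ⧸ ballSubgroup p h)]
  · simp [push, dirac]
  · intro b hb
    have : push (dirac k a).toFun h {b} = 0 := if_neg fun hab => hb (Eq.symm hab)
    rw [this, zero_mul]

theorem mul_comm' (μ ν : UnifMeasure p k) : μ * ν = ν * μ :=
  toFun_injective <| ext_push fun h V => by
    rw [push_mul, push_mul, conv_comm (isMeas_push μ h) (isMeas_push ν h)]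

theorem one_mul' (μ : UnifMeasure p k) : 1 * μ = μ :=
  toFun_injective <| ext_push fun h V => by
    refine (dirac_mul_push 0 μ h V).trans ?_
    simp

theorem add_mul' (μ ν ρ : UnifMeasure p k) : (μ + ν) * ρ = μ * ρ + ν * ρ :=
  toFun_injective <| ext_push fun h V => by
    refine (push_mul _ _ h V).trans ?_
    refine (congrFun (conv_add_left (isMeas_push μ h) (isMeas_push ν h)) V).trans ?_
    exact (congrArg₂ (· + ·) (push_mul μ ρ h V) (push_mul ν ρ h V)).symm

theorem mul_assoc' (μ ν ρ : UnifMeasure p k) : μ * ν * ρ = μ * (ν * ρ) :=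
  toFun_injective <| ext_push fun h V => by
    rw [push_mul, push_mul, funext (push_mul μ ν h), funext (push_mul ν ρ h)]
    exact conv_assoc (isMeas_push μ h) (isMeas_push ν h) V

theorem zero_mul' (μ : UnifMeasure p k) : 0 * μ = 0 := by
  have := add_mul' 0 0 μ
  rw [add_zero] at this
  simpa using this

noncomputable instance : CommRing (UnifMeasure p k) :=
  { (inferInstance : AddCommGroup (UnifMeasure p k)) with
    mul_assoc := mul_assoc'
    mul_comm := mul_comm'
    one_mul := one_mul'
    mul_one := fun μ => by rw [mul_comm', one_mul']
    left_distrib := fun μ ν ρ => by rw [mul_comm', add_mul', mul_comm' ν, mul_comm' ρ]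
    right_distrib := add_mul'
    zero_mul := zero_mul'
    mul_zero := fun μ => by rw [mul_comm', zero_mul'] }

theorem smul_mul' (c : k) (μ ν : UnifMeasure p k) : c • μ * ν = c • (μ * ν) :=
  toFun_injective <| ext_push fun h V => by
    refine (push_mul _ _ h V).trans ?_
    refine Eq.trans ?_ (congrArg (c * ·) (push_mul μ ν h V)).symm
    refine Eq.trans ?_ (((isMeas_push μ h).summable _).tsum_mul_left c)
    exact tsum_congr fun d => mul_assoc _ _ _

noncomputable instance : Algebra k (UnifMeasure p k) :=
  Algebra.ofModule smul_mul' fun c μ ν => by rw [mul_comm, smul_mul', mul_comm]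

/-- The character `a ↦ δ_a` of `ℚ_p`. -/
noncomputable def diracHom (p : ℕ) [Fact p.Prime] (k : Type) [CommRing k] [UniformSpace k]
    [IsUniformAddGroup k] [IsTopologicalRing k] [IsLinearTopology k k] [CompleteSpace k]
    [T2Space k] : Multiplicative ℚ_[p] →* UnifMeasure p k where
  toFun a := dirac k a.toAdd
  map_one' := rfl
  map_mul' a b := toFun_injective <| ext_push fun h V => by
    refine Eq.trans ?_ (dirac_mul_push _ _ h V).symm
    rfl

/-- `δ_{1/p^n} - δ_0`. -/
noncomputable def diracSub (p : ℕ) [Fact p.Prime] (k : Type) [CommRing k] [UniformSpace k]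
    [IsUniformAddGroup k] [IsTopologicalRing k] (n : ℕ) : UnifMeasure p k :=
  dirac k (1 / (p : ℚ_[p]) ^ n) - dirac k 0

/-- The map on measures induced by a continuous ring homomorphism of the coefficients. -/
noncomputable def map {k' : Type} [CommRing k'] [UniformSpace k'] [IsUniformAddGroup k']
    [IsTopologicalRing k'] [IsLinearTopology k' k'] [CompleteSpace k'] [T2Space k']
    (φ : k →+* k') (hφ : Continuous φ) : UnifMeasure p k →+* UnifMeasure p k' where
  toFun μ := ⟨fun U => φ (μ.toFun U), fun h A U hU hd =>
    (μ.hasSum_iUnion h A U hU hd).map φ hφ⟩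
  map_zero' := toFun_injective <| funext fun _ => map_zero φ
  map_add' μ ν := toFun_injective <| funext fun _ => map_add φ _ _
  map_one' := toFun_injective <| funext fun U => by
    classical
    show φ (if (0 : ℚ_[p]) ∈ U.1 then 1 else 0) = if (0 : ℚ_[p]) ∈ U.1 then 1 else 0
    split_ifs <;> simp
  map_mul' μ ν := toFun_injective <| ext_push fun h V => by
    refine Eq.trans ?_ (push_mul _ _ h V).symm
    refine (congrArg φ (push_mul μ ν h V)).trans ?_
    refine (((isMeas_push μ h).summable _).map_tsum φ hφ).trans ?_
    exact tsum_congr fun d => map_mul φ _ _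

end ring

end UnifMeasure

/-- The discrete uniformity of `ℤ / n`. -/
instance (n : ℕ) : UniformSpace (ZMod n) := (⊥ : UniformSpace (ZMod n)).replaceTopology rfl

instance (p : ℕ) [Fact p.Prime] : IsLinearTopology ℤ_[p] ℤ_[p] := by
  refine IsLinearTopology.mk_of_hasBasis' (R := ℤ_[p]) (p := fun _ : ℕ => True)
    (s := fun n => (Ideal.span {(p : ℤ_[p]) ^ n})) ?_ (fun I r x hx => I.smul_mem r hx)
  have hp : (1 : ℝ) < p := by exact_mod_cast (Fact.out : p.Prime).one_lt
  have hp0 : (0 : ℝ) < p := by linarith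
  have := Metric.nhds_basis_closedBall_pow (x := (0 : ℤ_[p])) (inv_pos.2 hp0) (inv_lt_one_of_one_lt₀ hp)
  convert this using 2 with n
  ext x
  simp [← PadicInt.norm_le_pow_iff_mem_span_pow]

theorem continuous_toZMod (p : ℕ) [Fact p.Prime] :
    Continuous (PadicInt.toZMod : ℤ_[p] →+* ZMod p) := by
  apply continuous_of_continuousAt_zero
  rw [ContinuousAt, map_zero, nhds_discrete (ZMod p), tendsto_pure]
  filter_upwards [Metric.ball_mem_nhds (0 : ℤ_[p]) one_pos] with x hx
  rw [← RingHom.mem_ker, PadicInt.ker_toZMod, IsLocalRing.mem_maximalIdeal, PadicInt.mem_nonunits]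
  simpa using hx

namespace UnifMeasure

/-- Reduction modulo `p` of uniform measures. -/
noncomputable def reduction (p : ℕ) [Fact p.Prime] :
    UnifMeasure p ℤ_[p] →+* UnifMeasure p (ZMod p) :=
  map PadicInt.toZMod (continuous_toZMod p)

variable (p : ℕ) [Fact p.Prime] (R k : Type) [CommRing R] [CommRing k] [UniformSpace k]
  [IsUniformAddGroup k] [IsTopologicalRing k] [IsLinearTopology k k] [CompleteSpace k] [T2Space k]
  [Algebra R (UnifMeasure p k)]

/-- The map `R[ℚ_p] → D_unif(ℚ_p, k)` sending the basis element of `a` to `δ_a`. -/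
noncomputable def ofGroupAlgebra : AddMonoidAlgebra R ℚ_[p] →+* UnifMeasure p k :=
  (AddMonoidAlgebra.lift R (UnifMeasure p k) ℚ_[p] (diracHom p k)).toRingHom

/-- The subgroup `ℤ[1/p]` of `ℚ_p`. -/
def zInv : AddSubgroup ℚ_[p] where
  carrier := {x | ∃ (n : ℕ) (m : ℤ), x * (p : ℚ_[p]) ^ n = m}
  zero_mem' := ⟨0, 0, by simp⟩
  add_mem' := by
    rintro a b ⟨n, m, h⟩ ⟨n', m', h'⟩
    refine ⟨n + n', m * p ^ n' + m' * p ^ n, ?_⟩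
    push_cast
    rw [← h, ← h']
    ring
  neg_mem' := by
    rintro a ⟨n, m, h⟩
    exact ⟨n, -m, by push_cast; rw [← h]; ring⟩

/-- The element `1` of `ℤ[1/p]`. -/
noncomputable def zInvOne : zInv p := ⟨1, 0, 1, by simp⟩

/-- The map `R[ℤ[1/p]] → D_unif(ℚ_p, k)` sending the basis element of `a` to `δ_a`. -/
noncomputable def ofGroupAlgebraZInv : AddMonoidAlgebra R (zInv p) →+* UnifMeasure p k :=
  (AddMonoidAlgebra.lift R (UnifMeasure p k) (zInv p)
    ((diracHom p k).comp (AddMonoidHom.toMultiplicative (zInv p).subtype))).toRingHom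

end UnifMeasure

/-- The monoid `S = ℤ[1/p] ∩ ℝ_{≥ 0}`. -/
def zInvNonneg (p : ℕ) : AddSubmonoid ℚ where
  carrier := {x | 0 ≤ x ∧ ∃ (n : ℕ) (m : ℤ), x * (p : ℚ) ^ n = m}
  zero_mem' := ⟨le_rfl, 0, 0, by simp⟩
  add_mem' := by
    rintro a b ⟨ha, n, m, h⟩ ⟨hb, n', m', h'⟩
    refine ⟨add_nonneg ha hb, n + n', m * p ^ n' + m' * p ^ n, ?_⟩
    push_cast
    rw [← h, ← h']
    ring

/-- The ring `R[X^{1/p^∞}]`, with `R`-basis the monomials `X ^ q` for `q ∈ ℤ[1/p]`, `q ≥ 0`. -/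
abbrev PerfPoly (R : Type) [CommRing R] (p : ℕ) : Type := AddMonoidAlgebra R (zInvNonneg p)

/-- The element `X^{1/p^n}` of `R[X^{1/p^∞}]`. -/
noncomputable def PerfPoly.root (R : Type) [CommRing R] (p : ℕ) [Fact p.Prime] (n : ℕ) :
    PerfPoly R p :=
  AddMonoidAlgebra.single ⟨1 / (p : ℚ) ^ n, by positivity, n, 1, by
    have : (p : ℚ) ≠ 0 := by exact_mod_cast (Fact.out : p.Prime).ne_zero
    simp [this]⟩ 1

/-- The `t`-adic completion of `𝔽_p[t^{1/p^∞}]`. -/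
abbrev PerfPoly.Completion (p : ℕ) [Fact p.Prime] : Type :=
  AdicCompletion (Ideal.span {PerfPoly.root (ZMod p) p 0}) (PerfPoly (ZMod p) p)

/-- The ring `A_inf`: the Witt vectors of the `t`-adic completion of `𝔽_p[t^{1/p^∞}]`. -/
abbrev Ainf (p : ℕ) [Fact p.Prime] : Type := WittVector p (PerfPoly.Completion p)

/-- The topological ring `B` is, via `f`, the (separated) completion of the ring `A` endowed with
the topology `τ`. -/
structure IsRingCompletion {A B : Type} [CommRing A] [CommRing B] [UniformSpace B]
    [IsUniformAddGroup B] (τ : TopologicalSpace A) (f : A →+* B) : Prop where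
  isTopologicalRing : IsTopologicalRing B
  complete : CompleteSpace B
  separated : T2Space B
  inducing : τ = TopologicalSpace.induced f inferInstance
  dense : DenseRange f

/-- A strict `p`-ring: `p` is not a zero divisor, the ring is separated and complete for the
`p`-adic topology, and the residue ring is perfect of characteristic `p`. -/
structure IsStrictPRing (p : ℕ) (A : Type) [CommRing A] : Prop where
  mem_nonZeroDivisors : (p : A) ∈ nonZeroDivisors A
  isAdicComplete : IsAdicComplete (Ideal.span {(p : A)}) A
  charP : CharP (A ⧸ Ideal.span {(p : A)}) p
  perfectRing : PerfectRing (A ⧸ Ideal.span {(p : A)}) p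

/-- The product topology on the Witt vectors of a topological ring. -/
@[reducible] def wittProductTopology (p : ℕ) {R : Type} (τ : TopologicalSpace R) :
    TopologicalSpace (WittVector p R) :=
  TopologicalSpace.induced (fun x (i : ℕ) => x.coeff i) (@Pi.topologicalSpace ℕ (fun _ => R) fun _ => τ)

/-- The `p`-adic topology of a ring. -/
@[reducible] def pAdicTopology (p : ℕ) (A : Type) [CommRing A] : TopologicalSpace A :=
  (Ideal.span {(p : A)}).adicTopology

/-! A uniform measure is a compatible system of measures on the discrete groups `ℚ_p / p ^ h ℤ_p`.
When the values are in `𝔽_p`, summability means finite support, so level `h` is the group algebra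
`𝔽_p[ℚ_p / p ^ h ℤ_p]`, and the natural topology is given by the kernels `vanishingIdeal p h`. Both
`ℤ[1/p]` and its nonnegative part surject onto `ℚ_p / p ^ h ℤ_p`, so `𝔽_p[ℤ[1/p]]` and the
polynomials in the `t_n` are dense. On `𝔽_p[ℤ[1/p]]` the kernel of level `h` is generated by `[p ^
h] - [0]`, which in characteristic `p` is `([1] - [0]) ^ p ^ h`; on polynomials in `t_n` it is
generated by `t_n ^ p ^ (n + h) = t ^ p ^ h`. Completeness carries this to the measures
(`eq_span_pow_of_dense`): the kernel of level `h` is `(t ^ p ^ h)`. Hence the topology is `t`-adic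
and the completion statements follow. Comparison with polynomials also shows that the ring is a
domain and that Frobenius is bijective.

For `ℤ_p`-valued measures, divisibility by `p` is tested on values, which gives `p`-torsion
freeness, `p`-adic completeness and the kernel of reduction. Surjectivity of reduction is a
successive approximation in which `Δ_{p^h} - Δ_0` lifts `t ^ p ^ h`. The same element generates,
with `p ^ n`, the ideal of measures divisible by `p ^ n` at radius `h` (`basicIdeal_eq_span`), which
compares the natural topology with the `(p, T)`-adic one. Density and kernels are lifted from `𝔽_p`
to `ℤ` by induction on the power of `p` (`isRingCompletion_span_pair`).

A `p`-torsion free, `p`-complete ring with perfect residue ring is a ring of Witt vectors, through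
Fontaine's map `θ`. The `T̃_n` are the Teichmüller lifts of the `t_n`; congruences modulo `p` gain
one factor `p` with each `p`-th power, which gives the limit formula. The roots of `T̃` are found by
a finer argument modulo `p ^ 2` for `p` odd, and by factoring differences of squares for `p = 2`.
Finally the product topology on Witt vectors is the `(p, [t])`-adic one, because Witt coefficients
and `p`-adic expansions determine each other up to Frobenius twists. -/

/-! ### Topologies defined by subgroups and ideals -/

/-- In a complete group whose topology is given by a decreasing sequence of subgroups, a sequence
whose successive differences lie in these subgroups has a limit, at the expected speed. -/
theorem exists_forall_sub_mem_of_succ_sub_mem {B : Type*} [AddCommGroup B] [UniformSpace B]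
    [IsUniformAddGroup B] [CompleteSpace B] (K : ℕ → AddSubgroup B)
    (hK : (𝓝 (0 : B)).HasBasis (fun _ => True) fun n => (K n : Set B)) (anti : Antitone K)
    (s : ℕ → B) (hs : ∀ n, s (n + 1) - s n ∈ K n) : ∃ x, ∀ n, x - s n ∈ K n := by
  have hs' : ∀ n m, n ≤ m → s m - s n ∈ K n := by
    intro n m hnm
    induction m, hnm using Nat.le_induction with
    | base => simp
    | succ m hm ih =>
      have := (K n).add_mem (anti hm (hs m)) ih
      rwa [sub_add_sub_cancel] at this
  have hc : CauchySeq s := by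
    refine hK.uniformity_of_nhds_zero.cauchySeq_iff.2 fun i _ => ⟨i, fun m hm n hn => ?_⟩
    have := (K i).sub_mem (hs' i n hn) (hs' i m hm)
    simpa using this
  obtain ⟨x, hx⟩ := cauchySeq_tendsto_of_complete hc
  refine ⟨x, fun n => ?_⟩
  have h0 : Tendsto (fun m => s m - x) atTop (𝓝 0) := tendsto_sub_nhds_zero_iff.2 hx
  obtain ⟨N, hN⟩ := (hK.tendsto_right_iff.1 h0 n trivial).exists_forall_of_atTop
  have := (K n).sub_mem (hs' n (max n N) (le_max_left _ _)) (hN (max n N) (le_max_right _ _))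
  simpa using this

/-- A group topology on a ring with the powers of an ideal, up to cofinality, as a basis of
neighborhoods of zero is adic. -/
theorem isAdic_of_hasBasis {B ι : Type*} [CommRing B] [TopologicalSpace B]
    [IsTopologicalAddGroup B] {q : ι → Prop} {K : ι → Set B} (hK : (𝓝 (0 : B)).HasBasis q K)
    (I : Ideal B) (h1 : ∀ n, ∃ i, q i ∧ K i ⊆ (I ^ n : Ideal B))
    (h2 : ∀ i, q i → ∃ n, ((I ^ n : Ideal B) : Set B) ⊆ K i) : IsAdic I := by
  refine IsTopologicalAddGroup.ext inferInstance
    (I.adic_basis.toRing_subgroups_basis.toRingFilterBasis.toAddGroupFilterBasis.isTopologicalAddGroup)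
    ?_
  refine hK.ext I.hasBasis_nhds_zero_adic (fun i hi => ?_) fun n _ => ?_
  · obtain ⟨n, hn⟩ := h2 i hi
    exact ⟨n, trivial, hn⟩
  · obtain ⟨i, hi, h⟩ := h1 n
    exact ⟨i, hi, h⟩

/-- The measures come only with a uniform group structure; continuity of convolution is deduced here
from the adic description of their topology. -/
theorem isTopologicalRing_of_isAdic {B : Type} [CommRing B] [T : TopologicalSpace B] {I : Ideal B}
    (h : IsAdic I) : IsTopologicalRing B := by
  have : T = I.adicTopology := h
  rw [this]
  exact I.adic_basis.toRing_subgroups_basis.toRingFilterBasis.isTopologicalRing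

/-! ### The natural topology of the uniform measures -/

namespace UnifMeasure
open DiscreteMeasure

variable {p : ℕ} [Fact p.Prime] {k : Type} [CommRing k] [UniformSpace k]
  [IsUniformAddGroup k] [IsTopologicalRing k]

theorem unifMeasurableOfRadius_mono {h h' : ℕ} (hh : h ≤ h') :
    unifMeasurableOfRadius p h ⊆ unifMeasurableOfRadius p h' := by
  rintro _ ⟨V, rfl⟩
  exact ⟨transition hh ⁻¹' V, mk_preimage_transition hh V⟩

theorem radii_nonempty : (radii p).Nonempty := Set.range_nonempty _

theorem radii_directedOn : DirectedOn (· ⊆ ·) (radii p) := by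
  rintro _ ⟨h, rfl⟩ _ ⟨h', rfl⟩
  exact ⟨_, ⟨max h h', rfl⟩, fun U hU => unifMeasurableOfRadius_mono (le_max_left _ _) hU,
    fun U hU => unifMeasurableOfRadius_mono (le_max_right _ _) hU⟩

theorem sUnion_radii : ⋃₀ radii p = Set.univ := by
  refine Set.eq_univ_of_forall fun U => ?_
  obtain ⟨h, hU⟩ := U.2
  exact ⟨_, ⟨h, rfl⟩, hU⟩

theorem isInducing_toUniformOnFun :
    IsUniformInducing (toUniformOnFun : UnifMeasure p k →+ _) := ⟨rfl⟩

theorem toUniformOnFun_injective :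
    Function.Injective (toUniformOnFun : UnifMeasure p k →+ _) := fun _ _ h => toFun_injective h

instance [T2Space k] : T2Space (UnifMeasure p k) := by
  have := UniformOnFun.t2Space_of_covering (β := k) (sUnion_radii (p := p))
  exact T2Space.of_injective_continuous toUniformOnFun_injective
    isInducing_toUniformOnFun.uniformContinuous.continuous

variable [IsLinearTopology k k]

theorem isClosed_of_isOpen {J : Ideal k} (hJ : IsOpen (J : Set k)) : IsClosed (J : Set k) :=
  J.toAddSubgroup.isClosed_of_isOpen hJ

theorem _root_.HasSum.mem_ideal {A : Type} {f : A → k} {s : k} (h : HasSum f s) {J : Ideal k}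
    (hJ : IsOpen (J : Set k)) (hf : ∀ a, f a ∈ J) : s ∈ J :=
  (isClosed_of_isOpen hJ).mem_of_tendsto h (Eventually.of_forall fun _ => J.sum_mem fun a _ => hf a)

/-- The sets `Σ_h` increase with `h`, so a single radius and a single open ideal of `k` suffice to
define a basic neighborhood. -/
theorem hasBasis_uniformOnFun (p : ℕ) [Fact p.Prime] (k : Type) [CommRing k] [UniformSpace k]
    [IsUniformAddGroup k] [IsTopologicalRing k] [IsLinearTopology k k] :
    (𝓝 (0 : UniformOnFun (unifMeasurable p) k (radii p))).HasBasis
      (fun i : ℕ × Ideal k => IsOpen (i.2 : Set k))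
      fun i => {f | ∀ V, push (UniformOnFun.toFun (radii p) f) i.1 V ∈ i.2} := by
  have := UniformOnFun.hasBasis_nhds_zero_of_basis (radii p) radii_nonempty radii_directedOn
    (IsLinearTopology.hasBasis_open_ideal (R := k))
  refine this.to_hasBasis ?_ ?_
  · rintro ⟨_, J⟩ ⟨⟨h, rfl⟩, hJ⟩
    refine ⟨(h, J), hJ, fun f hf U hU => ?_⟩
    obtain ⟨U, hU'⟩ := U
    obtain ⟨V, rfl⟩ := hU
    exact hf V
  · rintro ⟨h, J⟩ hJ
    exact ⟨(_, J), ⟨⟨h, rfl⟩, hJ⟩, fun f hf V => hf _ ⟨V, rfl⟩⟩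

/-- Measures are closed in the complete space of set functions. Modulo an open ideal `J`, a limit
`f` agrees on `Σ_h` with a measure; since `J` absorbs finite sums of errors, the partial sums for
`f` are eventually within `J` of its value on the union. -/
instance [CompleteSpace k] : CompleteSpace (UnifMeasure p k) := by
  have hcl : IsClosed (Set.range (toUniformOnFun : UnifMeasure p k →+ _)) := by
    refine isClosed_of_closure_subset fun f hf => ?_
    have key : ∀ h (J : Ideal k), IsOpen (J : Set k) → ∃ μ : UnifMeasure p k,
        ∀ V, push μ.toFun h V - push (UniformOnFun.toFun (radii p) f) h V ∈ J := by
      intro h J hJ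
      have h1 : Tendsto (fun g => g - f) (𝓝 f) (𝓝 0) := tendsto_sub_nhds_zero_iff.2 tendsto_id
      have h2 := h1 ((hasBasis_uniformOnFun p k).mem_of_mem (i := (h, J)) hJ)
      obtain ⟨_, hg, μ, rfl⟩ := mem_closure_iff_nhds.1 hf _ h2
      exact ⟨μ, hg⟩
    refine ⟨ofPush (UniformOnFun.toFun (radii p) f) fun h => ?_, rfl⟩
    intro A V hV
    refine tendsto_sub_nhds_zero_iff.1 ?_
    refine (IsLinearTopology.hasBasis_open_ideal (R := k)).tendsto_right_iff.2 fun J hJ => ?_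
    obtain ⟨μ, hμ⟩ := key h J hJ
    have h3 : Tendsto _ _ _ := tendsto_sub_nhds_zero_iff.2 (isMeas_push μ h A V hV)
    have h4 := h3 (hJ.mem_nhds J.zero_mem)
    filter_upwards [h4] with s hs
    have h5 : ∑ a ∈ s, (push μ.toFun h (V a) -
        push (UniformOnFun.toFun (radii p) f) h (V a)) ∈ J := J.sum_mem fun a _ => hμ (V a)
    have := J.sub_mem (J.add_mem hs (hμ (⋃ a, V a))) h5
    rw [Finset.sum_sub_distrib] at this
    show _ ∈ J
    convert this using 1
    ring
  exact (completeSpace_iff_isComplete_range isInducing_toUniformOnFun).2 hcl.isComplete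

theorem hasBasis_nhds_zero (p : ℕ) [Fact p.Prime] (k : Type) [CommRing k] [UniformSpace k]
    [IsUniformAddGroup k] [IsTopologicalRing k] [IsLinearTopology k k] :
    (𝓝 (0 : UnifMeasure p k)).HasBasis (fun i : ℕ × Ideal k => IsOpen (i.2 : Set k))
      fun i => {μ | ∀ V, push μ.toFun i.1 V ∈ i.2} := by
  have h1 := isInducing_toUniformOnFun.isInducing.nhds_eq_comap (0 : UnifMeasure p k)
  rw [h1, map_zero]
  exact (hasBasis_uniformOnFun p k).comap _

/-- The value on `V` is the sum of the values at its points, and an open ideal is closed. -/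
theorem push_mem_iff {m : UnifMeasure p k} {h : ℕ} {J : Ideal k} (hJ : IsOpen (J : Set k)) :
    (∀ V, push m.toFun h V ∈ J) ↔ ∀ x, push m.toFun h {x} ∈ J := by
  refine ⟨fun H x => H _, fun H V => ?_⟩
  have h1 := isMeas_push m h V (fun d => {d.1})
    (fun a b hab => by simpa [Subtype.ext_iff] using hab)
  have hV : (⋃ a : V, ({a.1} : Set (ℚ_[p] ⧸ ballSubgroup p h))) = V := by ext; simp
  rw [hV] at h1
  exact h1.mem_ideal hJ fun a => H _

variable [CompleteSpace k] [T2Space k]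

/-- The ideal of the measures whose values on the sets of radius `h` lie in the open ideal `J`. -/
def levelIdeal (p : ℕ) [Fact p.Prime] (h : ℕ) (J : Ideal k) (hJ : IsOpen (J : Set k)) :
    Ideal (UnifMeasure p k) where
  carrier := {μ | ∀ V, push μ.toFun h V ∈ J}
  zero_mem' _ := J.zero_mem
  add_mem' ha hb V := J.add_mem (ha V) (hb V)
  smul_mem' c μ hμ V := by
    rw [smul_eq_mul, push_mul]
    exact ((isMeas_push c h).summable _).hasSum.mem_ideal hJ fun d => J.mul_mem_left _ (hμ _)

theorem mem_levelIdeal {h : ℕ} {J : Ideal k} {hJ : IsOpen (J : Set k)} {μ : UnifMeasure p k} :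
    μ ∈ levelIdeal p h J hJ ↔ ∀ V, push μ.toFun h V ∈ J := Iff.rfl

theorem mem_levelIdeal_iff_singleton {h : ℕ} {J : Ideal k} {hJ : IsOpen (J : Set k)}
    {μ : UnifMeasure p k} : μ ∈ levelIdeal p h J hJ ↔ ∀ x, push μ.toFun h {x} ∈ J :=
  push_mem_iff hJ

theorem levelIdeal_mono {h h' : ℕ} (hh : h' ≤ h) {J J' : Ideal k} (hJJ : J ≤ J')
    (hJ : IsOpen (J : Set k)) (hJ' : IsOpen (J' : Set k)) :
    levelIdeal p h J hJ ≤ levelIdeal p h' J' hJ' := fun μ hμ V => by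
  rw [push_transition _ hh]
  exact hJJ (hμ _)

end UnifMeasure

/-! ### Group algebras modulo a cyclic subgroup -/

/-- Modulo `[g] - [0]`, the class of `[x]` depends only on the coset of `x` modulo `ℤ g`. Applied to
a map `r` choosing a representative in each coset, this computes the kernel of the passage to the
quotient group. -/
theorem AddMonoidAlgebra.sub_mapDomain_mem_span {R G : Type*} [CommRing R] [AddCommGroup G] (g : G)
    (r : G → G) (hr : ∀ x, ∃ n : ℤ, x - r x = n • g) (a : AddMonoidAlgebra R G) :
    a - a.mapDomain r ∈ Ideal.span {(single g 1 - single 0 1 : AddMonoidAlgebra R G)} := by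
  have hnat : ∀ n : ℕ, (single (n • g) 1 - single 0 1 : AddMonoidAlgebra R G) ∈
      Ideal.span {(single g 1 - single 0 1 : AddMonoidAlgebra R G)} := by
    intro n
    rw [Ideal.mem_span_singleton]
    have := sub_one_dvd_pow_sub_one (single g 1 : AddMonoidAlgebra R G) n
    simpa [AddMonoidAlgebra.single_pow, AddMonoidAlgebra.one_def] using this
  have hint : ∀ n : ℤ, (single (n • g) 1 - single 0 1 : AddMonoidAlgebra R G) ∈
      Ideal.span {(single g 1 - single 0 1 : AddMonoidAlgebra R G)} := by
    intro n
    obtain ⟨m, rfl | rfl⟩ := n.eq_nat_or_neg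
    · simpa using hnat m
    -- Negative multiples: `[-mg] - [0] = -[-mg] ([mg] - [0])`.
    · have := Ideal.mul_mem_left _ (-single (-(m • g)) 1) (hnat m)
      simpa [mul_sub, AddMonoidAlgebra.single_mul_single, neg_add_eq_sub] using this
  induction a using AddMonoidAlgebra.induction_linear with
  | zero => simp
  | add x y hx hy =>
    rw [AddMonoidAlgebra.mapDomain_add, add_sub_add_comm]
    exact Ideal.add_mem _ hx hy
  | single x c =>
    obtain ⟨n, hn⟩ := hr x
    have := Ideal.mul_mem_left _ (single (r x) c) (hint n)
    rwa [mul_sub, AddMonoidAlgebra.single_mul_single, AddMonoidAlgebra.single_mul_single, ← hn,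
      mul_one, add_zero, add_sub_cancel, ← AddMonoidAlgebra.mapDomain_single (f := r)] at this

/-! ### Cosets of `p ^ h ℤ_p` and elements of `ℤ[1/p]` -/

section padic
variable {p : ℕ} [Fact p.Prime]

theorem mem_ballSubgroup {h : ℕ} {x : ℚ_[p]} :
    x ∈ ballSubgroup p h ↔ ‖x‖ ≤ (p : ℝ) ^ (-(h : ℤ)) := Iff.rfl

theorem intCast_div_mem_ballSubgroup {h n : ℕ} {m : ℤ} :
    (m : ℚ_[p]) / (p : ℚ_[p]) ^ n ∈ ballSubgroup p h ↔ ((p ^ (n + h) : ℕ) : ℤ) ∣ m := by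
  have hp0 : (0 : ℝ) < p := by exact_mod_cast (Fact.out : p.Prime).pos
  rw [mem_ballSubgroup, Nat.cast_pow, ← Padic.norm_int_le_pow_iff_dvd, norm_div, norm_pow, Padic.norm_p,
    div_le_iff₀ (by positivity), inv_pow, ← zpow_natCast, ← zpow_neg, ← zpow_add₀ hp0.ne']
  push_cast
  rw [neg_add_rev]

/-- After scaling by `p ^ n` the element lies in `ℤ_p`, where it is congruent to a natural number
modulo `p ^ (n + h)`. A nonnegative representative is needed for approximation by polynomials in
`t_n`, without inverses. -/
theorem exists_natCast_div_eq (h : ℕ) (x : ℚ_[p] ⧸ ballSubgroup p h) :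
    ∃ m n : ℕ, ((((m : ℚ_[p]) / (p : ℚ_[p]) ^ n : ℚ_[p])) : ℚ_[p] ⧸ ballSubgroup p h) = x := by
  have hp0 : (0 : ℝ) < p := by exact_mod_cast (Fact.out : p.Prime).pos
  have hpp : (p : ℚ_[p]) ≠ 0 := by exact_mod_cast (Fact.out : p.Prime).ne_zero
  obtain ⟨x, rfl⟩ := QuotientAddGroup.mk_surjective x
  obtain ⟨n, hn⟩ : ∃ n : ℕ, ‖x‖ ≤ (p : ℝ) ^ n :=
    (pow_unbounded_of_one_lt ‖x‖ (by exact_mod_cast (Fact.out : p.Prime).one_lt)).imp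
      fun _ h => h.le
  have hy : ‖x * (p : ℚ_[p]) ^ n‖ ≤ 1 := by
    rw [norm_mul, norm_pow, Padic.norm_p, inv_pow]
    exact mul_inv_le_one_of_le₀ hn (by positivity)
  let y : ℤ_[p] := ⟨_, hy⟩
  refine ⟨y.appr (n + h), n, ?_⟩
  have h1 := PadicInt.appr_spec (n + h) y
  rw [← PadicInt.norm_le_pow_iff_mem_span_pow, PadicInt.norm_def] at h1
  rw [QuotientAddGroup.eq, mem_ballSubgroup]
  have h2 : -((y.appr (n + h) : ℚ_[p]) / (p : ℚ_[p]) ^ n) + x =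
      ((y - (y.appr (n + h) : ℤ_[p]) : ℤ_[p]) : ℚ_[p]) / (p : ℚ_[p]) ^ n := by
    push_cast
    rw [sub_div, show (y : ℚ_[p]) = x * (p : ℚ_[p]) ^ n from rfl, mul_div_cancel_right₀ _ (by positivity)]
    ring
  rw [h2, norm_div, norm_pow, Padic.norm_p, div_le_iff₀ (by positivity), inv_pow, ← zpow_natCast,
    ← zpow_neg, ← zpow_add₀ hp0.ne']
  refine h1.trans_eq ?_
  push_cast
  rw [neg_add_rev]

/-- The kernel of `ℤ[1/p] → ℚ_p / p ^ h ℤ_p` is thus cyclic, which makes the kernel on group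
algebras principal. -/
theorem exists_eq_zsmul_of_mem_zInv {h : ℕ} {x : ℚ_[p]} (hx : x ∈ UnifMeasure.zInv p)
    (hb : x ∈ ballSubgroup p h) : ∃ m : ℤ, x = m * (p : ℚ_[p]) ^ h := by
  have hpp : (p : ℚ_[p]) ≠ 0 := by exact_mod_cast (Fact.out : p.Prime).ne_zero
  obtain ⟨n, m, hm⟩ := hx
  obtain rfl : x = (m : ℚ_[p]) / (p : ℚ_[p]) ^ n := by rw [← hm, mul_div_cancel_right₀ _ (pow_ne_zero _ hpp)]
  obtain ⟨c, rfl⟩ := intCast_div_mem_ballSubgroup.1 hb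
  refine ⟨c, ?_⟩
  push_cast
  field_simp
  ring

theorem exists_notMem_ballSubgroup {x : ℚ_[p]} (hx : x ≠ 0) : ∃ h, x ∉ ballSubgroup p h := by
  have hp : (1 : ℝ) < p := by exact_mod_cast (Fact.out : p.Prime).one_lt
  obtain ⟨n, hn⟩ := exists_pow_lt_of_lt_one (norm_pos_iff.2 hx) (inv_lt_one_of_one_lt₀ hp)
  refine ⟨n, fun h => ?_⟩
  rw [mem_ballSubgroup, zpow_neg, zpow_natCast, ← inv_pow] at h
  linarith

end padic

/-! ### Dirac masses and group algebras inside the measures -/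

namespace UnifMeasure
open DiscreteMeasure

section dirac
variable {p : ℕ} [Fact p.Prime] {k : Type} [CommRing k] [UniformSpace k]

open Classical in
theorem push_dirac (a : ℚ_[p]) (h : ℕ) (x : ℚ_[p] ⧸ ballSubgroup p h) :
    push (dirac k a).toFun h {x} = if (a : ℚ_[p] ⧸ ballSubgroup p h) = x then 1 else 0 :=
  if_congr Iff.rfl rfl rfl

variable [IsUniformAddGroup k] [IsTopologicalRing k] [IsLinearTopology k k] [CompleteSpace k]
  [T2Space k]

theorem one_eq_dirac : (1 : UnifMeasure p k) = dirac k 0 := rfl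

theorem dirac_nsmul (n : ℕ) (a : ℚ_[p]) : dirac k (n • a) = dirac k a ^ n :=
  (diracHom p k).map_pow (Multiplicative.ofAdd a) n

theorem diracSub_eq (n : ℕ) : diracSub p k n = dirac k (1 / (p : ℚ_[p]) ^ n) - 1 := rfl

theorem dirac_natCast_div (m n : ℕ) :
    dirac k ((m : ℚ_[p]) / (p : ℚ_[p]) ^ n) = (diracSub p k n + 1) ^ m := by
  rw [diracSub_eq, sub_add_cancel, ← dirac_nsmul, nsmul_eq_mul, mul_one_div]

theorem push_ofGroupAlgebra (a : AddMonoidAlgebra k ℚ_[p]) (h : ℕ) (y : ℚ_[p] ⧸ ballSubgroup p h) :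
    push (ofGroupAlgebra p k k a).toFun h {y} =
      Finsupp.mapDomain (QuotientAddGroup.mk : ℚ_[p] → ℚ_[p] ⧸ ballSubgroup p h) a.coeff y := by
  classical
  induction a using AddMonoidAlgebra.induction_linear with
  | zero => rw [map_zero]; simp; rfl
  | add x z hx hz =>
    rw [map_add, AddMonoidAlgebra.coeff_add, Finsupp.mapDomain_add, Finsupp.add_apply, ← hx, ← hz]
    rfl
  | single x c =>
    have : ofGroupAlgebra p k k (AddMonoidAlgebra.single x c) = c • dirac k x :=
      AddMonoidAlgebra.lift_single _ _ _
    rw [this, AddMonoidAlgebra.coeff_single, Finsupp.mapDomain_single, Finsupp.single_apply]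
    refine Eq.trans (congrArg (c * ·) (push_dirac x h y)) ?_
    simp

/-- At a level fine enough to isolate `x` from the rest of the finite support, the value on the
coset of `x` is the coefficient of `x`. -/
theorem ofGroupAlgebra_injective : Function.Injective (ofGroupAlgebra p k k) := by
  classical
  rw [injective_iff_map_eq_zero]
  intro a ha
  ext x
  have : ∀ y : ℚ_[p], ∃ h, y ≠ x → y - x ∉ ballSubgroup p h := by
    intro y
    by_cases hy : y = x
    · exact ⟨0, fun h => absurd hy h⟩
    · exact (exists_notMem_ballSubgroup (sub_ne_zero.2 hy)).imp fun _ h _ => h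
  choose H hH using this
  have h1 := push_ofGroupAlgebra a (a.coeff.support.sup H) (x : ℚ_[p] ⧸ ballSubgroup p _)
  rw [ha, Finsupp.mapDomain, Finsupp.sum_apply, Finsupp.sum_eq_single x] at h1
  · rw [Finsupp.single_eq_same] at h1
    exact h1.symm
  · intro y hy hyx
    rw [Finsupp.single_eq_of_ne]
    intro h2
    refine hH y hyx (ballSubgroup_anti (Finset.le_sup (Finsupp.mem_support_iff.2 hy)) ?_)
    have := QuotientAddGroup.eq.1 h2
    rwa [neg_add_eq_sub] at this
  · simp

theorem ofGroupAlgebraZInv_eq {R : Type} [CommRing R] [Algebra R (UnifMeasure p k)]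
    (a : AddMonoidAlgebra R (zInv p)) :
    ofGroupAlgebraZInv p R k a = ofGroupAlgebra p R k (a.mapDomain (zInv p).subtype) := by
  induction a using AddMonoidAlgebra.induction_linear with
  | zero => simp
  | add x z hx hz => rw [map_add, AddMonoidAlgebra.mapDomain_add, map_add, hx, hz]
  | single x c =>
    rw [AddMonoidAlgebra.mapDomain_single]
    refine (AddMonoidAlgebra.lift_single _ _ _).trans ?_
    exact (AddMonoidAlgebra.lift_single (diracHom p k) (x : ℚ_[p]) c).symm

theorem ofGroupAlgebraZInv_injective : Function.Injective (ofGroupAlgebraZInv p k k) := by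
  intro a b hab
  rw [ofGroupAlgebraZInv_eq, ofGroupAlgebraZInv_eq] at hab
  exact AddMonoidAlgebra.mapDomain_injective (zInv p).subtype_injective
    (ofGroupAlgebra_injective hab)

/-- Modulo `levelIdeal p h J`, every measure is a finite combination of Dirac masses at
nonnegative elements of `ℤ[1/p]`. -/
theorem exists_sub_mem_levelIdeal (μ : UnifMeasure p k) (h : ℕ) (J : Ideal k)
    (hJ : IsOpen (J : Set k)) (S : AddSubmonoid (UnifMeasure p k))
    (hS : ∀ (c : k) (m n : ℕ), c • dirac k ((m : ℚ_[p]) / (p : ℚ_[p]) ^ n) ∈ S) :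
    ∃ ν ∈ S, μ - ν ∈ levelIdeal p h J hJ := by
  classical
  choose m n hmn using exists_natCast_div_eq (p := p) h
  -- Summability leaves only finitely many points of level `h` with a value outside `J`; a weighted
  -- Dirac mass at a representative corrects each of them.
  have hf := (isMeas_push μ h).finite J hJ
  refine ⟨∑ x ∈ hf.toFinset, push μ.toFun h {x} •
    dirac k ((m x : ℚ_[p]) / (p : ℚ_[p]) ^ n x), S.sum_mem fun x _ => hS _ _ _, ?_⟩
  rw [mem_levelIdeal_iff_singleton]
  intro y
  let ev : UnifMeasure p k →+ k :=
    { toFun := fun μ => push μ.toFun h {y}, map_zero' := rfl, map_add' := fun _ _ => rfl }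
  have h1 : ∀ x, ev (push μ.toFun h {x} • dirac k ((m x : ℚ_[p]) / (p : ℚ_[p]) ^ n x)) =
      if x = y then push μ.toFun h {y} else 0 := by
    intro x
    refine Eq.trans (congrArg (push μ.toFun h {x} * ·) (push_dirac _ h y)) ?_
    rw [hmn]
    split_ifs with hxy
    · rw [hxy, mul_one]
    · rw [mul_zero]
  show ev (μ - _) ∈ J
  rw [map_sub, map_sum, Finset.sum_congr rfl fun x _ => h1 x, Finset.sum_ite_eq']
  split_ifs with hy
  · rw [show ev μ = push μ.toFun h {y} from rfl, sub_self]
    exact J.zero_mem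
  · rw [sub_zero, show ev μ = push μ.toFun h {y} from rfl]
    simpa using hy

end dirac
end UnifMeasure

/-! ### Principal filtrations and completions -/

section abstractCompletion

variable {A B : Type} [CommRing A] [CommRing B]

/-- The hypotheses make `A / x ^ M → B / f(x) ^ M` bijective, and bijectivity passes to the
quotients by smaller powers. This interpolates between the exponents `p ^ h`. -/
theorem pow_dvd_of_map_mem_span (f : A →+* B) (x : A) (N M : ℕ) (hNM : N ≤ M)
    (hker : ∀ a, f a ∈ Ideal.span {f x ^ M} → x ^ M ∣ a)
    (hd : ∀ b, ∃ a, b - f a ∈ Ideal.span {f x ^ M}) (a : A)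
    (ha : f a ∈ Ideal.span {f x ^ N}) : x ^ N ∣ a := by
  obtain ⟨b, hb⟩ := Ideal.mem_span_singleton.1 ha
  obtain ⟨c, hc⟩ := hd b
  have h1 : f (a - x ^ N * c) ∈ Ideal.span {f x ^ M} := by
    rw [map_sub, map_mul, map_pow, hb, ← mul_sub]
    exact Ideal.mul_mem_left _ _ hc
  have := (pow_dvd_pow x hNM).trans (hker _ h1)
  rwa [dvd_sub_left (dvd_mul_right _ _)] at this

variable [UniformSpace B] [IsUniformAddGroup B] [CompleteSpace B] [T2Space B]

/-- If a principal ideal filtration of `A` is induced by a complete filtration `K` of `B` in which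
`A` is dense, then the filtration of `B` is principal too. -/
theorem eq_span_pow_of_dense (f : A →+* B) (K : ℕ → Ideal B)
    (hK : (𝓝 (0 : B)).HasBasis (fun _ => True) fun n => (K n : Set B)) (anti : Antitone K)
    (x : A) (e : ℕ → ℕ) (he : ∀ h m, h ≤ m → e h + e m ≤ e (m + 1)) (hx : ∀ h, f x ^ e h ∈ K h)
    (hker : ∀ h a, f a ∈ K h → x ^ e h ∣ a) (hd : ∀ h b, ∃ a, b - f a ∈ K h) (h : ℕ) :
    K h = Ideal.span {f x ^ e h} := by
  refine le_antisymm (fun b hb => ?_) ((Ideal.span_singleton_le_iff_mem _).2 (hx h))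
  have hmono : Monotone e := monotone_nat_of_le_succ fun n => (Nat.le_add_left _ _).trans (he n n le_rfl)
  -- The approximations `a m` of `b` are divisible by `x ^ e h`; the quotients will converge to the
  -- cofactor of `f x ^ e h` in `b`.
  choose a ha using fun m => hd (h + m + 1) b
  have hdvd : ∀ m, x ^ e h ∣ a m := fun m => hker h _ <| by
    have := (K h).sub_mem hb (anti (by omega) (ha m))
    rwa [sub_sub_cancel] at this
  have hstep : ∀ m, x ^ e (h + m + 1) ∣ a (m + 1) - a m := fun m => hker _ _ <| by
    have := (K (h + m + 1)).sub_mem (ha m) (anti (by omega) (ha (m + 1)))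
    rwa [sub_sub_sub_cancel_left, ← map_sub] at this
  choose d hd' using hstep
  obtain ⟨c₀, hc₀⟩ := hdvd 0
  -- The quotients `c m` are built recursively from the divisibility of the differences, because `x`
  -- is not assumed regular in `A` and independent choices need not be Cauchy.
  let c : ℕ → A := fun m => Nat.rec c₀ (fun m c => c + x ^ (e (h + m + 1) - e h) * d m) m
  have hc : ∀ m, a m = x ^ e h * c m := by
    intro m
    induction m with
    | zero => exact hc₀
    | succ m ih =>
      have h1 : e h ≤ e (h + m + 1) := hmono (by omega)
      have h2 : a (m + 1) = a m + x ^ e (h + m + 1) * d m := by rw [← hd']; ring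
      have h3 : c (m + 1) = c m + x ^ (e (h + m + 1) - e h) * d m := rfl
      rw [h2, h3, mul_add, ← ih, ← mul_assoc, ← pow_add, Nat.add_sub_cancel' h1]
  obtain ⟨y, hy⟩ := exists_forall_sub_mem_of_succ_sub_mem (fun m => (K m).toAddSubgroup) hK
    (fun _ _ hmn => anti hmn) (fun m => f (c m)) fun m => by
      have h3 : c (m + 1) = c m + x ^ (e (h + m + 1) - e h) * d m := rfl
      show f (c (m + 1)) - f (c m) ∈ K m
      rw [h3, map_add, add_sub_cancel_left, map_mul, map_pow]
      -- By the growth condition `he`, the exponent `e (h + m + 1) - e h` is still at least `e (h +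
      -- m)`, so dividing by `x ^ e h` costs one level only.
      refine Ideal.mul_mem_right _ _ (anti (Nat.le_add_left m h) ?_)
      refine Ideal.pow_mem_of_pow_mem _ (hx (h + m)) ?_
      have := he h (h + m) (by omega)
      omega
  have hz : ∀ m, b - f x ^ e h * y ∈ K m := by
    intro m
    have h1 := (K m).mul_mem_left (f x ^ e h) (hy m)
    have h2 := anti (show m ≤ h + m + 1 by omega) (ha m)
    rw [hc, map_mul, map_pow] at h2
    have := (K m).sub_mem h2 h1
    convert this using 1
    ring
  have : b - f x ^ e h * y = 0 := by
    by_contra hne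
    obtain ⟨m, -, hm⟩ := hK.mem_iff.1 (isOpen_compl_singleton.mem_nhds (Ne.symm hne))
    exact hm (hz m) rfl
  rw [sub_eq_zero.1 this]
  exact Ideal.mul_mem_right _ _ (Ideal.mem_span_singleton_self _)

/-- A criterion for a ring to be the completion of another one, for adic topologies. -/
theorem isRingCompletion_adic (f : A →+* B) (I : Ideal A) (I' : Ideal B) (hI' : IsAdic I')
    (hle : I.map f ≤ I') (hker : ∀ n, ∃ m, ∀ a, f a ∈ I' ^ m → a ∈ I ^ n)
    (hd : ∀ b n, ∃ a, b - f a ∈ I' ^ n) : IsRingCompletion I.adicTopology f where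
  isTopologicalRing := isTopologicalRing_of_isAdic hI'
  complete := inferInstance
  separated := inferInstance
  inducing := by
    refine IsTopologicalAddGroup.ext
      I.adic_basis.toRing_subgroups_basis.toRingFilterBasis.toAddGroupFilterBasis.isTopologicalAddGroup
      (topologicalAddGroup_induced f) ?_
    rw [nhds_induced, map_zero]
    refine I.hasBasis_nhds_zero_adic.ext (hI'.hasBasis_nhds_zero.comap f) (fun n _ => ?_) fun n _ => ?_
    · obtain ⟨m, hm⟩ := hker n
      exact ⟨m, trivial, hm⟩
    · refine ⟨n, trivial, fun a ha => ?_⟩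
      have := Ideal.mem_map_of_mem f ha
      rw [Ideal.map_pow] at this
      exact Ideal.pow_right_mono hle n this
  dense := by
    intro b
    refine mem_closure_iff_nhds_basis (hI'.hasBasis_nhds b) |>.2 fun n _ => ?_
    obtain ⟨a, ha⟩ := hd b n
    exact ⟨f a, ⟨a, rfl⟩, -(b - f a), neg_mem ha, by ring⟩

/-- A dense subring whose topology is, by definition, the induced one. -/
theorem isRingCompletion_induced {I : Ideal B} (hI : IsAdic I)
    (f : A →+* B) (hf : DenseRange f) : IsRingCompletion (I.adicTopology.induced f) f where
  isTopologicalRing := isTopologicalRing_of_isAdic hI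
  complete := inferInstance
  separated := inferInstance
  inducing := congrArg (TopologicalSpace.induced f) (Eq.symm hI)
  dense := hf

end abstractCompletion

/-! ### Identification with the algebraic adic completion -/

section equiv

variable {A B : Type} [CommRing A] [CommRing B]

/-- An adically complete ring with the same quotients as `A` is the adic completion of `A`. -/
theorem exists_adicCompletion_ringEquiv (f : A →+* B) (I : Ideal A) (I' : Ideal B)
    [IsAdicComplete I' B] (hle : I.map f ≤ I') (hker : ∀ n a, f a ∈ I' ^ n → a ∈ I ^ n)
    (hd : ∀ b n, ∃ a, b - f a ∈ I' ^ n) :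
    ∃ j : AdicCompletion I A ≃+* B, ∀ a, j (AdicCompletion.of I A a) = f a := by
  have hle' : ∀ n, I ^ n ≤ (I' ^ n).comap f := fun n => by
    rw [← Ideal.map_le_iff_le_comap, Ideal.map_pow]
    exact Ideal.pow_right_mono hle n
  -- The hypotheses say that `g n` is an isomorphism for every `n`; the equivalence is the limit of
  -- these, by completeness on both sides.
  let g : ∀ n, A ⧸ I ^ n →+* B ⧸ I' ^ n := fun n => Ideal.quotientMap _ f (hle' n)
  have hg : ∀ n, Function.Injective (g n) := fun n => Ideal.quotientMap_injective' fun a ha => hker n a ha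
  have hg' : ∀ n, Function.Surjective (g n) := by
    intro n b
    obtain ⟨b, rfl⟩ := Ideal.Quotient.mk_surjective b
    obtain ⟨a, ha⟩ := hd b n
    refine ⟨Ideal.Quotient.mk _ a, ?_⟩
    rw [Ideal.quotientMap_mk]
    exact ((Ideal.Quotient.mk_eq_mk_iff_sub_mem _ _).2 ha).symm
  let F : ∀ n, AdicCompletion I A →+* B ⧸ I' ^ n := fun n =>
    (g n).comp (AdicCompletion.evalₐ I n : AdicCompletion I A →+* _)
  have hF : ∀ {m n : ℕ} (hle : m ≤ n), (Ideal.Quotient.factorPow I' hle).comp (F n) = F m := by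
    intro m n hmn
    refine RingHom.ext fun x => ?_
    induction x using AdicCompletion.induction_on with
    | _ s =>
    have h1 := s.2 hmn
    rw [smul_eq_mul, Ideal.mul_top, SModEq.sub_mem] at h1
    have h2 : ∀ n, F n (AdicCompletion.mk I A s) = Ideal.Quotient.mk _ (f (s n)) := fun n => by
      show g n (AdicCompletion.evalₐ I n (AdicCompletion.mk I A s)) = _
      rw [AdicCompletion.evalₐ_mk, Ideal.quotientMap_mk]
    rw [RingHom.comp_apply, h2, h2]
    refine Eq.symm ((Ideal.Quotient.mk_eq_mk_iff_sub_mem _ _).2 ?_)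
    rw [← map_sub]
    exact hle' m h1
  let j := IsAdicComplete.liftRingHom I' F hF
  have hj : ∀ n x, Ideal.Quotient.mk (I' ^ n) (j x) = g n (AdicCompletion.evalₐ I n x) :=
    fun n x => IsAdicComplete.mk_liftRingHom I' F hF n x
  have hinj : Function.Injective j := by
    rw [injective_iff_map_eq_zero]
    intro x hx
    refine AdicCompletion.ext_evalₐ fun n => hg n ?_
    rw [← hj, hx]
    simp
  have hext : ∀ b b' : B, (∀ n, Ideal.Quotient.mk (I' ^ n) b = Ideal.Quotient.mk (I' ^ n) b') →
      b = b' := fun b b' hb => by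
    refine (IsHausdorff.eq_iff_smodEq (I := I')).2 fun n => ?_
    rw [smul_eq_mul, Ideal.mul_top, SModEq.sub_mem]
    exact (Ideal.Quotient.mk_eq_mk_iff_sub_mem _ _).1 (hb n)
  refine ⟨RingEquiv.ofBijective j ⟨hinj, fun b => ?_⟩, fun a => hext _ _ fun n => ?_⟩
  · choose a ha using hd b
    have hs : ∀ n, a n ≡ a (n + 1) [SMOD (I ^ n • ⊤ : Ideal A)] := fun n => by
      rw [smul_eq_mul, Ideal.mul_top, SModEq.sub_mem]
      refine hker _ _ ?_
      have := (I' ^ n).sub_mem (Ideal.pow_le_pow_right n.le_succ (ha (n + 1))) (ha n)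
      rwa [sub_sub_sub_cancel_left, ← map_sub] at this
    refine ⟨AdicCompletion.mk I A (AdicCompletion.AdicCauchySequence.mk I A a hs),
      hext _ _ fun n => ?_⟩
    refine (hj n _).trans ?_
    rw [AdicCompletion.evalₐ_mk, Ideal.quotientMap_mk]
    exact ((Ideal.Quotient.mk_eq_mk_iff_sub_mem _ _).2 (ha n)).symm
  · refine (hj n _).trans ?_
    rw [AdicCompletion.evalₐ_of, Ideal.quotientMap_mk]

end equiv

/-! ### Polynomials with exponents in `ℤ[1/p]` -/

namespace PerfPoly
variable {p : ℕ} [Fact p.Prime]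

theorem exists_natCast_eq (q : zInvNonneg p) : ∃ n m : ℕ, (q : ℚ) * (p : ℚ) ^ n = m := by
  obtain ⟨h0, n, m, hm⟩ := q.2
  refine ⟨n, m.toNat, ?_⟩
  have : 0 ≤ m := by
    have : (0 : ℚ) ≤ m := hm ▸ by positivity
    exact_mod_cast this
  rw [hm]
  exact_mod_cast (Int.toNat_of_nonneg this).symm

section eval
variable {M : Type*} [CommMonoid M] (x : ℕ → M)

theorem pow_pow_eq (hx : ∀ n, x (n + 1) ^ p = x n) (n m : ℕ) : x (n + m) ^ p ^ m = x n := by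
  induction m with
  | zero => simp
  | succ m ih => rw [pow_succ', pow_mul, ← add_assoc, hx, ih]

/-- Both sides are the same power of `x (n + n')`, by reduction to a common denominator; hence the
representation of `q` chosen in `powHom` is immaterial. -/
theorem pow_eq_pow (hx : ∀ n, x (n + 1) ^ p = x n) {q : ℚ} {n m n' m' : ℕ}
    (h : q * (p : ℚ) ^ n = m) (h' : q * (p : ℚ) ^ n' = m') : x n ^ m = x n' ^ m' := by
  rw [← pow_pow_eq x hx n n', ← pow_pow_eq x hx n' n, ← pow_mul, ← pow_mul, add_comm n' n]
  congr 1
  have : ((p ^ n' * m : ℕ) : ℚ) = ((p ^ n * m' : ℕ) : ℚ) := by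
    push_cast
    rw [← h, ← h']
    ring
  exact_mod_cast this

/-- The homomorphism `q = m / p ^ n ↦ x n ^ m` attached to a compatible system of `p`-power
roots. -/
noncomputable def powHom (hx : ∀ n, x (n + 1) ^ p = x n) : Multiplicative (zInvNonneg p) →* M where
  toFun q := x (exists_natCast_eq q.toAdd).choose ^ (exists_natCast_eq q.toAdd).choose_spec.choose
  map_one' := by
    rw [pow_eq_pow x hx (exists_natCast_eq _).choose_spec.choose_spec
      (show (((1 : Multiplicative (zInvNonneg p)).toAdd : zInvNonneg p) : ℚ) * (p : ℚ) ^ 0 = (0 : ℕ)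
        by simp), pow_zero]
  map_mul' q r := by
    obtain ⟨n, m, h⟩ := exists_natCast_eq q.toAdd
    obtain ⟨n', m', h'⟩ := exists_natCast_eq r.toAdd
    have h1 : (q.toAdd : ℚ) * (p : ℚ) ^ (n + n') = (m * p ^ n' : ℕ) := by
      push_cast; rw [← h]; ring
    have h2 : (r.toAdd : ℚ) * (p : ℚ) ^ (n + n') = (m' * p ^ n : ℕ) := by
      push_cast; rw [← h']; ring
    have h3 : ((q * r).toAdd : ℚ) * (p : ℚ) ^ (n + n') = (m * p ^ n' + m' * p ^ n : ℕ) := by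
      rw [Nat.cast_add, ← h1, ← h2, ← add_mul]; rfl
    rw [pow_eq_pow x hx (exists_natCast_eq _).choose_spec.choose_spec h1,
      pow_eq_pow x hx (exists_natCast_eq _).choose_spec.choose_spec h2,
      pow_eq_pow x hx (exists_natCast_eq _).choose_spec.choose_spec h3, pow_add]

theorem powHom_apply (hx : ∀ n, x (n + 1) ^ p = x n) (q : zInvNonneg p) {n m : ℕ}
    (h : (q : ℚ) * (p : ℚ) ^ n = m) : powHom x hx (Multiplicative.ofAdd q) = x n ^ m :=
  pow_eq_pow x hx (exists_natCast_eq _).choose_spec.choose_spec h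

end eval

variable (R : Type) [CommRing R] {B : Type} [CommRing B] [Algebra R B]

/-- Evaluation at a compatible system of `p`-power roots. -/
noncomputable def eval (x : ℕ → B) (hx : ∀ n, x (n + 1) ^ p = x n) : PerfPoly R p →ₐ[R] B :=
  AddMonoidAlgebra.lift R B (zInvNonneg p) (powHom x hx)

theorem eval_root (x : ℕ → B) (hx : ∀ n, x (n + 1) ^ p = x n) (n : ℕ) :
    eval R x hx (root R p n) = x n := by
  refine (AddMonoidAlgebra.lift_single _ _ _).trans ?_
  have hp : (p : ℚ) ≠ 0 := by exact_mod_cast (Fact.out : p.Prime).ne_zero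
  rw [one_smul, powHom_apply x hx _ (n := n) (m := 1) (by simp [hp]), pow_one]

theorem root_pow_eq_single {q : zInvNonneg p} {n m : ℕ} (h : (q : ℚ) * (p : ℚ) ^ n = m) (c : R) :
    c • root R p n ^ m = AddMonoidAlgebra.single q c := by
  have hp : (p : ℚ) ≠ 0 := by exact_mod_cast (Fact.out : p.Prime).ne_zero
  rw [root, AddMonoidAlgebra.single_pow, AddMonoidAlgebra.smul_single, one_pow, smul_eq_mul, mul_one]
  congr 1
  ext
  rw [AddSubmonoidClass.coe_nsmul, nsmul_eq_mul, ← h]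
  field_simp

theorem root_succ_pow (n : ℕ) : root R p (n + 1) ^ p = root R p n := by
  have hp : (p : ℚ) ≠ 0 := by exact_mod_cast (Fact.out : p.Prime).ne_zero
  have := root_pow_eq_single R (p := p) (q := ⟨1 / (p : ℚ) ^ n, by positivity, n, 1, by simp [hp]⟩)
    (n := n + 1) (m := p) (by field_simp; ring) 1
  rwa [one_smul] at this

theorem root_pow_pow (n m : ℕ) : root R p (n + m) ^ p ^ m = root R p n :=
  pow_pow_eq _ (root_succ_pow R) n m

variable {R}

/-- Every element of `R[X^{1/p^∞}]` is a polynomial in `X^{1/p^n}` for `n` large. -/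
theorem exists_aeval_root (a : PerfPoly R p) :
    ∃ n₀, ∀ n, n₀ ≤ n → ∃ P : Polynomial R, Polynomial.aeval (root R p n) P = a := by
  induction a using AddMonoidAlgebra.induction_linear with
  | zero => exact ⟨0, fun n _ => ⟨0, map_zero _⟩⟩
  | add x y hx hy =>
    obtain ⟨n, hn⟩ := hx
    obtain ⟨m, hm⟩ := hy
    refine ⟨max n m, fun l hl => ?_⟩
    obtain ⟨P, rfl⟩ := hn l (le_of_max_le_left hl)
    obtain ⟨Q, rfl⟩ := hm l (le_of_max_le_right hl)
    exact ⟨P + Q, map_add _ _ _⟩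
  | single q c =>
    obtain ⟨n, m, h⟩ := exists_natCast_eq q
    refine ⟨n, fun l hl => ?_⟩
    obtain ⟨d, rfl⟩ := Nat.exists_eq_add_of_le hl
    refine ⟨Polynomial.monomial (m * p ^ d) c, ?_⟩
    rw [Polynomial.aeval_monomial, ← Algebra.smul_def, root_pow_eq_single]
    push_cast
    rw [← h]
    ring

end PerfPoly

/-! ### The filtration by radius of `𝔽_p`-valued measures -/

namespace UnifMeasure
open DiscreteMeasure

variable {p : ℕ} [Fact p.Prime]

/-- The measures with values in `𝔽_p` which vanish on the sets of radius `h`. -/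
noncomputable abbrev vanishingIdeal (p : ℕ) [Fact p.Prime] (h : ℕ) :
    Ideal (UnifMeasure p (ZMod p)) :=
  levelIdeal p h ⊥ (isOpen_discrete _)

theorem vanishingIdeal_antitone : Antitone (vanishingIdeal p) := fun _ _ hh =>
  levelIdeal_mono hh le_rfl _ _

theorem hasBasis_vanishingIdeal : (𝓝 (0 : UnifMeasure p (ZMod p))).HasBasis (fun _ => True)
    fun h => (vanishingIdeal p h : Set (UnifMeasure p (ZMod p))) := by
  refine (hasBasis_nhds_zero p (ZMod p)).to_hasBasis ?_ ?_
  · rintro ⟨h, J⟩ hJ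
    exact ⟨h, trivial, levelIdeal_mono le_rfl bot_le _ hJ⟩
  · intro h _
    exact ⟨(h, ⊥), isOpen_discrete _, fun μ hμ => hμ⟩

theorem eq_zero_of_forall_mem_vanishingIdeal {μ : UnifMeasure p (ZMod p)}
    (h : ∀ n, μ ∈ vanishingIdeal p n) : μ = 0 :=
  toFun_injective <| ext_push fun n V => h n V

theorem dirac_sub_dirac_mem {k : Type} [CommRing k] [UniformSpace k] [IsUniformAddGroup k]
    [IsTopologicalRing k] [IsLinearTopology k k] [CompleteSpace k] [T2Space k] {a b : ℚ_[p]} {h : ℕ}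
    (hab : a - b ∈ ballSubgroup p h) (J : Ideal k) (hJ : IsOpen (J : Set k)) :
    dirac k a - dirac k b ∈ levelIdeal p h J hJ := by
  classical
  rw [mem_levelIdeal_iff_singleton]
  intro x
  have : (b : ℚ_[p] ⧸ ballSubgroup p h) = a := QuotientAddGroup.eq.2 (by rwa [neg_add_eq_sub])
  show push (dirac k a).toFun h {x} - push (dirac k b).toFun h {x} ∈ J
  rw [push_dirac, push_dirac, this, sub_self]
  exact J.zero_mem

instance : Nontrivial (UnifMeasure p (ZMod p)) := by
  classical
  refine ⟨1, 0, fun h => ?_⟩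
  have h1 : push (1 : UnifMeasure p (ZMod p)).toFun 0 {0} = 1 := by
    rw [one_eq_dirac, push_dirac]; simp
  rw [h] at h1
  exact zero_ne_one h1

instance : CharP (UnifMeasure p (ZMod p)) p :=
  charP_of_injective_algebraMap (algebraMap (ZMod p) (UnifMeasure p (ZMod p))).injective p

/-- Frobenius turns `p`-th powers of `δ_a - δ_0` into multiplication of `a` by `p`. This is what
makes the filtration by radius a filtration by powers of `t`. -/
theorem dirac_sub_one_pow (a : ℚ_[p]) (n : ℕ) :
    (dirac (ZMod p) a - 1) ^ p ^ n = dirac (ZMod p) (a * (p : ℚ_[p]) ^ n) - 1 := by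
  rw [sub_pow_char_pow, one_pow, ← dirac_nsmul, nsmul_eq_mul, mul_comm]
  push_cast
  rfl

theorem diracSub_succ_pow (n : ℕ) :
    diracSub p (ZMod p) (n + 1) ^ p = diracSub p (ZMod p) n := by
  have hp : (p : ℚ_[p]) ≠ 0 := by exact_mod_cast (Fact.out : p.Prime).ne_zero
  have := dirac_sub_one_pow (p := p) (1 / (p : ℚ_[p]) ^ (n + 1)) 1
  rw [pow_one, pow_one] at this
  rw [diracSub_eq, diracSub_eq, this]
  congr 2
  field_simp
  ring

theorem diracSub_pow_pow (n m : ℕ) :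
    diracSub p (ZMod p) (n + m) ^ p ^ m = diracSub p (ZMod p) n :=
  PerfPoly.pow_pow_eq _ diracSub_succ_pow n m

theorem diracSub_pow_self (n : ℕ) : diracSub p (ZMod p) n ^ p ^ n = diracSub p (ZMod p) 0 := by
  simpa using diracSub_pow_pow (p := p) 0 n

theorem diracSub_zero_pow (h : ℕ) :
    diracSub p (ZMod p) 0 ^ p ^ h = dirac (ZMod p) ((p : ℚ_[p]) ^ h) - 1 := by
  rw [diracSub_eq, dirac_sub_one_pow]
  simp

theorem pow_mem_ballSubgroup (h : ℕ) : (p : ℚ_[p]) ^ h ∈ ballSubgroup p h := by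
  rw [mem_ballSubgroup, norm_pow, Padic.norm_p, zpow_neg, zpow_natCast, inv_pow]

theorem diracSub_zero_pow_mem (h : ℕ) : diracSub p (ZMod p) 0 ^ p ^ h ∈ vanishingIdeal p h := by
  rw [diracSub_zero_pow]
  exact dirac_sub_dirac_mem (by rw [sub_zero]; exact pow_mem_ballSubgroup h) _ _

/-- The kernel of `𝔽_p[ℤ[1/p]] → 𝔽_p[ℚ_p / p ^ h ℤ_p]`. -/
theorem pow_dvd_of_ofGroupAlgebraZInv_mem (h : ℕ) (a : AddMonoidAlgebra (ZMod p) (zInv p))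
    (ha : ofGroupAlgebraZInv p (ZMod p) (ZMod p) a ∈ vanishingIdeal p h) :
    (AddMonoidAlgebra.single (zInvOne p) 1 - AddMonoidAlgebra.single 0 1) ^ p ^ h ∣ a := by
  have hp : (p : ℚ_[p]) ≠ 0 := by exact_mod_cast (Fact.out : p.Prime).ne_zero
  let π : zInv p → ℚ_[p] ⧸ ballSubgroup p h := fun x => (x : ℚ_[p])
  have hπ : Function.Surjective π := by
    intro x
    obtain ⟨m, n, rfl⟩ := exists_natCast_div_eq h x
    exact ⟨⟨(m : ℚ_[p]) / (p : ℚ_[p]) ^ n, n, m, by field_simp; simp⟩, rfl⟩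
  have h0 : Finsupp.mapDomain π a.coeff = 0 := by
    ext y
    have := mem_levelIdeal_iff_singleton.1 ha y
    rw [ofGroupAlgebraZInv_eq, push_ofGroupAlgebra, AddMonoidAlgebra.coeff_mapDomain,
      ← Finsupp.mapDomain_comp] at this
    exact this
  have h1 : a.mapDomain (Function.surjInv hπ ∘ π) = 0 := by
    ext x
    rw [AddMonoidAlgebra.coeff_mapDomain, Finsupp.mapDomain_comp, h0]
    simp
  -- Moving each point to its chosen representative kills `a` and changes it by a multiple of `[p ^
  -- h] - [0]`, which is the `p ^ h`-th power of `[1] - [0]`.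
  have h2 := AddMonoidAlgebra.sub_mapDomain_mem_span (p ^ h • zInvOne p) (Function.surjInv hπ ∘ π)
    (fun x => by
      have h3 : π (Function.surjInv hπ (π x)) = π x := Function.surjInv_eq hπ _
      have h4 := QuotientAddGroup.eq.1 h3
      rw [neg_add_eq_sub] at h4
      obtain ⟨m, hm⟩ := exists_eq_zsmul_of_mem_zInv
        (x - Function.surjInv hπ (π x)).2 (by exact h4)
      refine ⟨m, Subtype.ext (hm.trans ?_)⟩
      simp [zInvOne]) a
  rw [h1, sub_zero, Ideal.mem_span_singleton] at h2
  have : CharP (AddMonoidAlgebra (ZMod p) (zInv p)) p :=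
    charP_of_injective_algebraMap (algebraMap (ZMod p) _).injective p
  rw [sub_pow_char_pow, AddMonoidAlgebra.single_pow, AddMonoidAlgebra.single_pow]
  simpa using h2

open Polynomial in
/-- The kernel of `𝔽_p[Z] → 𝔽_p[ℚ_p / p ^ h ℤ_p]`, `Z ↦ δ_{1/p^n}`. -/
theorem dvd_of_aeval_dirac_mem (n h : ℕ) (Q : (ZMod p)[X])
    (hQ : aeval (dirac (ZMod p) (1 / (p : ℚ_[p]) ^ n)) Q ∈ vanishingIdeal p h) :
    X ^ p ^ (n + h) - 1 ∣ Q := by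
  classical
  have hp : (p : ℚ_[p]) ≠ 0 := by exact_mod_cast (Fact.out : p.Prime).ne_zero
  have hN : p ^ (n + h) ≠ 0 := pow_ne_zero _ (Fact.out : p.Prime).ne_zero
  have hm : (X ^ p ^ (n + h) - 1 : (ZMod p)[X]).Monic := by
    simpa using monic_X_pow_sub_C (1 : ZMod p) hN
  have hdeg : (X ^ p ^ (n + h) - 1 : (ZMod p)[X]).natDegree = p ^ (n + h) := by
    simpa using natDegree_X_pow_sub_C (n := p ^ (n + h)) (r := (1 : ZMod p))
  rw [← modByMonic_eq_zero_iff_dvd hm]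
  -- The divisor maps into the ideal because `p ^ (n + h) / p ^ n = p ^ h`. The remainder vanishes,
  -- since the points `i / p ^ n` for `i < p ^ (n + h)` lie in distinct cosets and its coefficients
  -- are the values there.
  set r := Q %ₘ (X ^ p ^ (n + h) - 1) with hr
  have hrdeg : r.natDegree < p ^ (n + h) := by
    rw [← hdeg]
    refine natDegree_modByMonic_lt Q hm fun h1 => ?_
    rw [h1, natDegree_one] at hdeg
    exact hN hdeg.symm
  have h1 : aeval (dirac (ZMod p) (1 / (p : ℚ_[p]) ^ n)) r ∈ vanishingIdeal p h := by
    rw [hr, modByMonic_eq_sub_mul_div]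
    rw [map_sub, map_mul]
    refine sub_mem hQ (Ideal.mul_mem_right _ _ ?_)
    rw [map_sub, map_one, map_pow, aeval_X, ← dirac_nsmul]
    refine dirac_sub_dirac_mem ?_ _ _
    have : p ^ (n + h) • (1 / (p : ℚ_[p]) ^ n) - 0 = (p : ℚ_[p]) ^ h := by
      rw [nsmul_eq_mul, pow_add]
      push_cast
      field_simp
      simp
    rw [this]
    exact pow_mem_ballSubgroup h
  ext i
  rw [coeff_zero]
  by_cases hi : i < p ^ (n + h)
  swap
  · exact coeff_eq_zero_of_natDegree_lt (by omega)
  let y : ℚ_[p] ⧸ ballSubgroup p h := ((i : ℚ_[p]) / (p : ℚ_[p]) ^ n : ℚ_[p])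
  let ev : UnifMeasure p (ZMod p) →+ ZMod p :=
    { toFun := fun μ => push μ.toFun h {y}, map_zero' := rfl, map_add' := fun _ _ => rfl }
  have h2 : ev (aeval (dirac (ZMod p) (1 / (p : ℚ_[p]) ^ n)) r) = 0 :=
    mem_levelIdeal_iff_singleton.1 h1 y
  rw [aeval_eq_sum_range' hrdeg, map_sum, Finset.sum_eq_single i] at h2
  · rw [← dirac_nsmul] at h2
    refine Eq.trans ?_ h2
    refine Eq.trans ?_ (congrArg (r.coeff i * ·) (push_dirac _ h y)).symm
    rw [if_pos, mul_one]
    rw [nsmul_eq_mul, mul_one_div]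
  · intro j hj hji
    rw [← dirac_nsmul]
    refine (congrArg (r.coeff j * ·) (push_dirac _ h y)).trans ?_
    rw [if_neg, mul_zero]
    intro h3
    have h4 := QuotientAddGroup.eq.1 h3
    have h5 : -(j • (1 / (p : ℚ_[p]) ^ n)) + (i : ℚ_[p]) / (p : ℚ_[p]) ^ n =
        (((i : ℤ) - (j : ℤ) : ℤ) : ℚ_[p]) / (p : ℚ_[p]) ^ n := by
      push_cast
      rw [nsmul_eq_mul]
      ring
    rw [h5, intCast_div_mem_ballSubgroup] at h4
    rw [Finset.mem_range] at hj
    have := Int.eq_zero_of_abs_lt_dvd h4 (by rw [abs_lt]; omega)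
    omega
  · intro h3
    exact absurd (Finset.mem_range.2 hi) h3

open Polynomial in
/-- The kernel of `𝔽_p[Y] → 𝔽_p[ℚ_p / p ^ h ℤ_p]`, `Y ↦ t_n`. -/
theorem pow_dvd_of_aeval_diracSub_mem (n h : ℕ) (P : (ZMod p)[X])
    (hP : aeval (diracSub p (ZMod p) n) P ∈ vanishingIdeal p h) : X ^ p ^ (n + h) ∣ P := by
  -- Change of variable `Y = Z - 1`, under which `Z ^ p ^ (n + h) - 1` becomes `Y ^ p ^ (n + h)` in
  -- characteristic `p`.
  have h1 := dvd_of_aeval_dirac_mem n h (P.comp (X - 1)) (by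
    rwa [aeval_comp, map_sub, aeval_X, map_one])
  have h2 : (X - 1 : (ZMod p)[X]) ^ p ^ (n + h) = X ^ p ^ (n + h) - 1 := by
    rw [sub_pow_char_pow, one_pow]
  rw [← h2] at h1
  have h3 := map_dvd (compRingHom (X + 1 : (ZMod p)[X])) h1
  simpa [comp_assoc] using h3

end UnifMeasure

/-! ### `𝔽_p`-valued measures: `t`-adic topology, domain, perfectness -/

namespace UnifMeasure
open DiscreteMeasure

variable {p : ℕ} [Fact p.Prime]

/-- The map `𝔽_p[t^{1/p^∞}] → D_unif(ℚ_p, 𝔽_p)`, `t^{1/p^n} ↦ t_n`. -/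
noncomputable def ofPerfPoly (p : ℕ) [Fact p.Prime] :
    PerfPoly (ZMod p) p →ₐ[ZMod p] UnifMeasure p (ZMod p) :=
  PerfPoly.eval (ZMod p) (diracSub p (ZMod p)) diracSub_succ_pow

theorem ofPerfPoly_root (n : ℕ) :
    ofPerfPoly p (PerfPoly.root (ZMod p) p n) = diracSub p (ZMod p) n :=
  PerfPoly.eval_root _ _ _ n

theorem ofPerfPoly_aeval_root (n : ℕ) (P : Polynomial (ZMod p)) :
    ofPerfPoly p (Polynomial.aeval (PerfPoly.root (ZMod p) p n) P) =
      Polynomial.aeval (diracSub p (ZMod p) n) P := by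
  rw [← Polynomial.aeval_algHom_apply, ofPerfPoly_root]

/-- The exponent `p ^ (n + h)` of `X^{1/p^n}` is the exponent `p ^ h` of `X`, independently of the
denominator `p ^ n`. -/
theorem pow_dvd_of_ofPerfPoly_mem (h : ℕ) (a : PerfPoly (ZMod p) p)
    (ha : ofPerfPoly p a ∈ vanishingIdeal p h) : PerfPoly.root (ZMod p) p 0 ^ p ^ h ∣ a := by
  obtain ⟨n, hn⟩ := PerfPoly.exists_aeval_root a
  obtain ⟨P, rfl⟩ := hn n le_rfl
  rw [ofPerfPoly_aeval_root] at ha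
  have h1 := map_dvd (Polynomial.aeval (PerfPoly.root (ZMod p) p n))
    (pow_dvd_of_aeval_diracSub_mem n h P ha)
  have h2 := PerfPoly.root_pow_pow (p := p) (ZMod p) 0 n
  rw [zero_add] at h2
  rwa [map_pow, Polynomial.aeval_X, pow_add, pow_mul, h2] at h1

theorem ofPerfPoly_injective : Function.Injective (ofPerfPoly p) := by
  rw [injective_iff_map_eq_zero]
  intro a ha
  obtain ⟨n, hn⟩ := PerfPoly.exists_aeval_root a
  obtain ⟨P, rfl⟩ := hn n le_rfl
  rw [ofPerfPoly_aeval_root] at ha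
  suffices P = 0 by rw [this, map_zero]
  by_contra hP
  -- Any level `h` with `p ^ (n + h)` larger than the degree of `P` would do; the degree itself is
  -- one.
  have h1 := Polynomial.natDegree_le_of_dvd (pow_dvd_of_aeval_diracSub_mem n P.natDegree P
    (by rw [ha]; exact Ideal.zero_mem _)) hP
  rw [Polynomial.natDegree_X_pow] at h1
  have h2 : n + P.natDegree < p ^ (n + P.natDegree) := Nat.lt_pow_self (Fact.out : p.Prime).one_lt
  omega

/-- The Dirac mass at `m / p ^ n` is `(1 + t_n) ^ m`, a polynomial in `t_n`. -/
theorem exists_sub_ofPerfPoly_mem (h : ℕ) (μ : UnifMeasure p (ZMod p)) :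
    ∃ a, μ - ofPerfPoly p a ∈ vanishingIdeal p h := by
  obtain ⟨_, ⟨a, rfl⟩, ha⟩ := exists_sub_mem_levelIdeal μ h ⊥ (isOpen_discrete _)
    ((ofPerfPoly p).range.toSubsemiring.toAddSubmonoid) (fun c m n => by
      refine (ofPerfPoly p).range.smul_mem ?_ c
      rw [dirac_natCast_div]
      exact (ofPerfPoly p).range.pow_mem ((ofPerfPoly p).range.add_mem
        ((ofPerfPoly p).mem_range.2 ⟨_, ofPerfPoly_root n⟩) (ofPerfPoly p).range.one_mem) m)
  exact ⟨a, ha⟩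

theorem ofGroupAlgebraZInv_single (a : zInv p) (c : ZMod p) :
    ofGroupAlgebraZInv p (ZMod p) (ZMod p) (AddMonoidAlgebra.single a c) =
      c • dirac (ZMod p) (a : ℚ_[p]) :=
  AddMonoidAlgebra.lift_single _ _ _

theorem ofGroupAlgebraZInv_sub : ofGroupAlgebraZInv p (ZMod p) (ZMod p)
    (AddMonoidAlgebra.single (zInvOne p) 1 - AddMonoidAlgebra.single 0 1) =
      diracSub p (ZMod p) 0 := by
  rw [map_sub, ofGroupAlgebraZInv_single, ofGroupAlgebraZInv_single, one_smul, one_smul, diracSub]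
  simp [zInvOne]

theorem exists_sub_ofGroupAlgebraZInv_mem (h : ℕ) (μ : UnifMeasure p (ZMod p)) :
    ∃ a, μ - ofGroupAlgebraZInv p (ZMod p) (ZMod p) a ∈ vanishingIdeal p h := by
  have hp : (p : ℚ_[p]) ≠ 0 := by exact_mod_cast (Fact.out : p.Prime).ne_zero
  obtain ⟨_, ⟨a, rfl⟩, ha⟩ := exists_sub_mem_levelIdeal μ h ⊥ (isOpen_discrete _)
    (AddMonoidHom.mrange (ofGroupAlgebraZInv p (ZMod p) (ZMod p)).toAddMonoidHom) (fun c m n =>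
      ⟨AddMonoidAlgebra.single ⟨(m : ℚ_[p]) / (p : ℚ_[p]) ^ n, n, m, by field_simp; simp⟩ c,
        ofGroupAlgebraZInv_single _ c⟩)
  exact ⟨a, ha⟩

/-- The measures with values in `𝔽_p` vanishing on the sets of radius `h` are the multiples of
`t ^ p ^ h`. -/
theorem vanishingIdeal_eq_span (h : ℕ) :
    vanishingIdeal p h = Ideal.span {diracSub p (ZMod p) 0 ^ p ^ h} := by
  have := eq_span_pow_of_dense (ofPerfPoly p : PerfPoly (ZMod p) p →+* _) (vanishingIdeal p)
    hasBasis_vanishingIdeal vanishingIdeal_antitone (PerfPoly.root (ZMod p) p 0) (p ^ ·)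
    -- The growth condition for the exponents `p ^ h`: `p ^ h + p ^ m ≤ 2 p ^ m ≤ p ^ (m + 1)`.
    (fun h m hm => by
      have h1 : p ^ h ≤ p ^ m := Nat.pow_le_pow_right (Fact.out : p.Prime).pos hm
      have h2 : 2 * p ^ m ≤ p * p ^ m := Nat.mul_le_mul_right _ (Fact.out : p.Prime).two_le
      show p ^ h + p ^ m ≤ p ^ (m + 1)
      rw [pow_succ']
      omega)
    (fun h => by
      show ofPerfPoly p _ ^ _ ∈ _
      rw [ofPerfPoly_root]
      exact diracSub_zero_pow_mem h)
    pow_dvd_of_ofPerfPoly_mem exists_sub_ofPerfPoly_mem h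
  rw [this]
  exact congrArg (fun x => Ideal.span {x ^ p ^ h}) (ofPerfPoly_root 0)

theorem isAdic_diracSub : IsAdic (Ideal.span {diracSub p (ZMod p) 0}) := by
  refine isAdic_of_hasBasis hasBasis_vanishingIdeal _ (fun n => ⟨n, trivial, ?_⟩)
    fun h _ => ⟨p ^ h, ?_⟩
  · rw [vanishingIdeal_eq_span, Ideal.span_singleton_pow]
    exact Ideal.span_singleton_le_span_singleton.2
      (pow_dvd_pow _ (Nat.lt_pow_self (Fact.out : p.Prime).one_lt).le)
  · rw [vanishingIdeal_eq_span, Ideal.span_singleton_pow]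

instance : IsAdicComplete (Ideal.span {diracSub p (ZMod p) 0}) (UnifMeasure p (ZMod p)) :=
  isAdic_diracSub.isAdicComplete_iff.2 ⟨inferInstance, inferInstance⟩

/-! ### Dense subrings on which the level ideals induce the powers of a lift of `t` -/

section criterion
variable {A : Type} [CommRing A] (f : A →+* UnifMeasure p (ZMod p)) (x : A)
  (hx : f x = diracSub p (ZMod p) 0)
  (hker : ∀ h a, f a ∈ vanishingIdeal p h → x ^ p ^ h ∣ a)
  (hd : ∀ h μ, ∃ a, μ - f a ∈ vanishingIdeal p h)
include hx hd

theorem exists_sub_mem_span_pow (μ : UnifMeasure p (ZMod p)) (n : ℕ) :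
    ∃ a, μ - f a ∈ Ideal.span {diracSub p (ZMod p) 0 ^ n} := by
  obtain ⟨a, ha⟩ := hd n μ
  refine ⟨a, ?_⟩
  rw [vanishingIdeal_eq_span] at ha
  exact Ideal.span_singleton_le_span_singleton.2
      (pow_dvd_pow _ (Nat.lt_pow_self (Fact.out : p.Prime).one_lt).le) ha

include hker

theorem pow_dvd_of_mem_span_pow (n : ℕ) (a : A)
    (ha : f a ∈ Ideal.span {diracSub p (ZMod p) 0 ^ n}) : x ^ n ∣ a := by
  rw [← hx] at ha
  refine pow_dvd_of_map_mem_span f x n (p ^ n) (Nat.lt_pow_self (Fact.out : p.Prime).one_lt).le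
    (fun a ha => hker n a ?_) (fun b => ?_) a ha
  · rwa [vanishingIdeal_eq_span, ← hx]
  · simpa only [vanishingIdeal_eq_span, ← hx] using hd n b

theorem isRingCompletion_span : IsRingCompletion (Ideal.span {x}).adicTopology f := by
  refine isRingCompletion_adic f _ _ isAdic_diracSub ?_ (fun n => ⟨n, fun a ha => ?_⟩) fun b n => ?_
  · rw [Ideal.map_span, Set.image_singleton, hx]
  · rw [Ideal.span_singleton_pow] at ha ⊢
    exact Ideal.mem_span_singleton.2 (pow_dvd_of_mem_span_pow f x hx hker hd n a ha)
  · rw [Ideal.span_singleton_pow]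
    exact exists_sub_mem_span_pow f x hx hd b n

end criterion

theorem isRingCompletion_ofGroupAlgebraZInv_zmod : IsRingCompletion
    (Ideal.span {(AddMonoidAlgebra.single (zInvOne p) 1 - AddMonoidAlgebra.single 0 1 :
      AddMonoidAlgebra (ZMod p) (zInv p))}).adicTopology
    (ofGroupAlgebraZInv p (ZMod p) (ZMod p)) :=
  isRingCompletion_span _ _ ofGroupAlgebraZInv_sub pow_dvd_of_ofGroupAlgebraZInv_mem
    exists_sub_ofGroupAlgebraZInv_mem

theorem isRingCompletion_ofPerfPoly :
    IsRingCompletion (Ideal.span {PerfPoly.root (ZMod p) p 0}).adicTopology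
      (ofPerfPoly p : PerfPoly (ZMod p) p →+* UnifMeasure p (ZMod p)) :=
  isRingCompletion_span _ _ (ofPerfPoly_root 0) pow_dvd_of_ofPerfPoly_mem exists_sub_ofPerfPoly_mem

theorem isRingCompletion_ofGroupAlgebra_zmod : IsRingCompletion
    ((Ideal.span {diracSub p (ZMod p) 0}).adicTopology.induced (ofGroupAlgebra p (ZMod p) (ZMod p)))
    (ofGroupAlgebra p (ZMod p) (ZMod p)) := by
  refine isRingCompletion_induced isAdic_diracSub _ ?_
  refine isRingCompletion_ofGroupAlgebraZInv_zmod.dense.mono ?_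
  rintro _ ⟨a, rfl⟩
  exact ⟨_, (ofGroupAlgebraZInv_eq a).symm⟩

theorem exists_completion_ringEquiv : ∃ j : PerfPoly.Completion p ≃+* UnifMeasure p (ZMod p),
    ∀ x, j (AdicCompletion.of _ _ x) = ofPerfPoly p x := by
  refine exists_adicCompletion_ringEquiv (ofPerfPoly p : PerfPoly (ZMod p) p →+* _) _
    (Ideal.span {diracSub p (ZMod p) 0}) ?_ (fun n a ha => ?_) fun b n => ?_
  · rw [Ideal.map_span, Set.image_singleton]
    exact le_of_eq (congrArg (fun x => Ideal.span {x}) (ofPerfPoly_root 0))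
  · rw [Ideal.span_singleton_pow] at ha ⊢
    exact Ideal.mem_span_singleton.2 (pow_dvd_of_mem_span_pow _ _ (ofPerfPoly_root 0)
      pow_dvd_of_ofPerfPoly_mem exists_sub_ofPerfPoly_mem n a ha)
  · rw [Ideal.span_singleton_pow]
    exact exists_sub_mem_span_pow _ _ (ofPerfPoly_root 0) exists_sub_ofPerfPoly_mem b n

-- Modulo level `h + 1` both factors are polynomials in one `t_l`, where the order at `0` is
-- additive: an order of at least `2 p ^ (l + h)` for the product forces at least `p ^ (l + h)` for
-- a factor. Losing one level is harmless when the levels are used together to prove that there are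
-- no zero divisors.
open Polynomial in
theorem mem_or_mem_vanishingIdeal {μ ν : UnifMeasure p (ZMod p)} {h : ℕ}
    (hμν : μ * ν ∈ vanishingIdeal p (h + 1)) :
    μ ∈ vanishingIdeal p h ∨ ν ∈ vanishingIdeal p h := by
  obtain ⟨a, ha⟩ := exists_sub_ofPerfPoly_mem (h + 1) μ
  obtain ⟨b, hb⟩ := exists_sub_ofPerfPoly_mem (h + 1) ν
  obtain ⟨n, hn⟩ := PerfPoly.exists_aeval_root a
  obtain ⟨m, hm⟩ := PerfPoly.exists_aeval_root b
  obtain ⟨P, rfl⟩ := hn (max n m) (le_max_left _ _)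
  obtain ⟨Q, rfl⟩ := hm (max n m) (le_max_right _ _)
  generalize max n m = l at *
  rw [ofPerfPoly_aeval_root] at ha hb
  have h1 : aeval (diracSub p (ZMod p) l) (P * Q) ∈ vanishingIdeal p (h + 1) := by
    rw [map_mul]
    have := sub_mem (sub_mem hμν (Ideal.mul_mem_left _ μ hb))
      (Ideal.mul_mem_right (aeval (diracSub p (ZMod p) l) Q) _ ha)
    convert this using 1
    ring
  have h2 : (X : (ZMod p)[X]) ^ (2 * p ^ (l + h)) ∣ P * Q := by
    refine (pow_dvd_pow X ?_).trans (pow_dvd_of_aeval_diracSub_mem l (h + 1) _ h1)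
    rw [← add_assoc, pow_succ']
    exact Nat.mul_le_mul_right _ (Fact.out : p.Prime).two_le
  have h3 : (X : (ZMod p)[X]) ^ p ^ (l + h) ∣ P ∨ X ^ p ^ (l + h) ∣ Q := by
    rw [pow_dvd_iff_le_emultiplicity, emultiplicity_mul prime_X] at h2
    rw [pow_dvd_iff_le_emultiplicity, pow_dvd_iff_le_emultiplicity]
    by_contra! H
    have := ENat.add_lt_add H.1 H.2
    rw [← two_mul] at this
    push_cast at h2
    exact absurd h2 (not_le.2 this)
  have h4 : ∀ {R : (ZMod p)[X]} {μ : UnifMeasure p (ZMod p)}, X ^ p ^ (l + h) ∣ R →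
      μ - aeval (diracSub p (ZMod p) l) R ∈ vanishingIdeal p (h + 1) → μ ∈ vanishingIdeal p h := by
    rintro R μ hR hμ
    have h5 := map_dvd (aeval (diracSub p (ZMod p) l)) hR
    rw [map_pow, aeval_X, pow_add, pow_mul, diracSub_pow_self] at h5
    have h6 := (vanishingIdeal p h).mem_of_dvd h5 (diracSub_zero_pow_mem h)
    have := add_mem (vanishingIdeal_antitone h.le_succ hμ) h6
    rwa [sub_add_cancel] at this
  exact h3.imp (fun h => h4 h ha) fun h => h4 h hb

instance : NoZeroDivisors (UnifMeasure p (ZMod p)) where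
  eq_zero_or_eq_zero_of_mul_eq_zero {μ ν} hμν := by
    by_contra! H
    have : ∀ {μ : UnifMeasure p (ZMod p)}, μ ≠ 0 → ∃ h, μ ∉ vanishingIdeal p h := by
      intro μ hμ
      by_contra! h
      exact hμ (eq_zero_of_forall_mem_vanishingIdeal h)
    obtain ⟨h, hh⟩ := this H.1
    obtain ⟨h', hh'⟩ := this H.2
    have : μ * ν ∈ vanishingIdeal p (max h h' + 1) := by rw [hμν]; exact Ideal.zero_mem _
    rcases mem_or_mem_vanishingIdeal this with h1 | h1
    · exact hh (vanishingIdeal_antitone (le_max_left _ _) h1)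
    · exact hh' (vanishingIdeal_antitone (le_max_right _ _) h1)

instance : IsDomain (UnifMeasure p (ZMod p)) := NoZeroDivisors.to_isDomain _

/-- The coefficients are in the prime field, so `P(y) ^ p = P(y ^ p)`, and the variable has a `p`-th
root. -/
theorem exists_pow_eq_perfPoly (a : PerfPoly (ZMod p) p) : ∃ b, b ^ p = a := by
  obtain ⟨n, hn⟩ := PerfPoly.exists_aeval_root a
  obtain ⟨P, rfl⟩ := hn n le_rfl
  refine ⟨Polynomial.aeval (PerfPoly.root (ZMod p) p (n + 1)) P, ?_⟩
  rw [← map_pow, ← ZMod.expand_card, Polynomial.expand_aeval, PerfPoly.root_succ_pow]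

/-- Frobenius is injective on a domain. It sends `(t)` to a generator of `(t ^ p)`, and modulo `t ^
p` every measure is a polynomial, hence a `p`-th power; `t`-adic completeness turns this into
surjectivity. -/
instance : PerfectRing (UnifMeasure p (ZMod p)) p := by
  have hH : IsHausdorff ((Ideal.span {diracSub p (ZMod p) 0}).map
      (frobenius (UnifMeasure p (ZMod p)) p)) (UnifMeasure p (ZMod p)) := by
    refine ⟨fun x hx => IsHausdorff.haus (I := Ideal.span {diracSub p (ZMod p) 0}) inferInstance x
      fun n => ?_⟩
    refine (hx n).mono (Submodule.smul_mono_left (Ideal.pow_right_mono ?_ n))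
    rw [Ideal.map_span, Set.image_singleton, Ideal.span_singleton_le_span_singleton]
    exact dvd_pow_self _ (Fact.out : p.Prime).ne_zero
  refine ⟨frobenius_inj (UnifMeasure p (ZMod p)) p, ?_⟩
  refine surjective_of_mk_map_comp_surjective (I := Ideal.span {diracSub p (ZMod p) 0})
    (frobenius (UnifMeasure p (ZMod p)) p) fun y => ?_
  obtain ⟨b, rfl⟩ := Ideal.Quotient.mk_surjective y
  obtain ⟨a, ha⟩ := exists_sub_mem_span_pow (ofPerfPoly p : PerfPoly (ZMod p) p →+* _) _
    (ofPerfPoly_root 0) exists_sub_ofPerfPoly_mem b p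
  obtain ⟨c, rfl⟩ := exists_pow_eq_perfPoly a
  refine ⟨ofPerfPoly p c, ((Ideal.Quotient.mk_eq_mk_iff_sub_mem _ _).2 ?_).symm⟩
  rw [Ideal.map_span, Set.image_singleton, frobenius_def, frobenius_def]
  rwa [map_pow] at ha

end UnifMeasure

/-! ### `ℤ_p`-valued measures: reduction modulo `p` and natural topology -/

theorem PadicInt.isOpen_span_pow (p : ℕ) [Fact p.Prime] (n : ℕ) :
    IsOpen ((Ideal.span {(p : ℤ_[p]) ^ n} : Ideal ℤ_[p]) : Set ℤ_[p]) := by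
  have hp : (0 : ℝ) < p := by exact_mod_cast (Fact.out : p.Prime).pos
  have : ((Ideal.span {(p : ℤ_[p]) ^ n} : Ideal ℤ_[p]) : Set ℤ_[p]) =
      Metric.closedBall 0 ((p : ℝ) ^ (-(n : ℤ))) := by
    ext x
    simp [← PadicInt.norm_le_pow_iff_mem_span_pow]
  rw [this]
  exact IsUltrametricDist.isOpen_closedBall _ (by positivity)

theorem PadicInt.hasBasis_span_pow (p : ℕ) [Fact p.Prime] :
    (𝓝 (0 : ℤ_[p])).HasBasis (fun _ : ℕ => True)
      fun n => ((Ideal.span {(p : ℤ_[p]) ^ n} : Ideal ℤ_[p]) : Set ℤ_[p]) := by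
  have hp : (1 : ℝ) < p := by exact_mod_cast (Fact.out : p.Prime).one_lt
  have := Metric.nhds_basis_closedBall_pow (x := (0 : ℤ_[p])) (inv_pos.2 (by linarith : (0 : ℝ) < p))
    (inv_lt_one_of_one_lt₀ hp)
  convert this using 2 with n
  ext x
  simp [← PadicInt.norm_le_pow_iff_mem_span_pow]

namespace UnifMeasure
open DiscreteMeasure

variable {p : ℕ} [Fact p.Prime]

theorem natCast_mul_toFun {k : Type} [CommRing k] [UniformSpace k] [IsUniformAddGroup k]
    [IsTopologicalRing k] [IsLinearTopology k k] [CompleteSpace k] [T2Space k] (n : ℕ)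
    (μ : UnifMeasure p k) (U : unifMeasurable p) :
    ((n : UnifMeasure p k) * μ).toFun U = n * μ.toFun U := by
  rw [← nsmul_eq_mul, ← nsmul_eq_mul]
  rfl

theorem pow_mul_toFun (n : ℕ) (μ : UnifMeasure p ℤ_[p]) (U : unifMeasurable p) :
    ((p : UnifMeasure p ℤ_[p]) ^ n * μ).toFun U = (p : ℤ_[p]) ^ n * μ.toFun U := by
  have := natCast_mul_toFun (p ^ n) μ U
  push_cast at this
  exact this

theorem eq_zero_of_natCast_mul_eq_zero {μ : UnifMeasure p ℤ_[p]}
    (h : (p : UnifMeasure p ℤ_[p]) * μ = 0) : μ = 0 := by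
  refine toFun_injective (funext fun U => ?_)
  have h1 := natCast_mul_toFun p μ U
  rw [h] at h1
  have hp : (p : ℤ_[p]) ≠ 0 := by exact_mod_cast (Fact.out : p.Prime).ne_zero
  exact (mul_eq_zero.1 h1.symm).resolve_left hp

/-- The measures divisible by `p ^ n` are the ones with all values divisible by `p ^ n`. -/
theorem mem_span_pow_iff {n : ℕ} {μ : UnifMeasure p ℤ_[p]} :
    μ ∈ Ideal.span {(p : UnifMeasure p ℤ_[p]) ^ n} ↔
      ∀ U, μ.toFun U ∈ Ideal.span {(p : ℤ_[p]) ^ n} := by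
  constructor
  · intro h U
    obtain ⟨ν, rfl⟩ := Ideal.mem_span_singleton.1 h
    rw [pow_mul_toFun]
    exact Ideal.mul_mem_right _ _ (Ideal.mem_span_singleton_self _)
  · intro h
    choose ν hν using fun U => Ideal.mem_span_singleton.1 (h U)
    have hp : (p : ℤ_[p]) ^ n ≠ 0 := pow_ne_zero _ (by exact_mod_cast (Fact.out : p.Prime).ne_zero)
    -- Multiplication by `p ^ n` is a closed embedding of `ℤ_p`, so convergence of the series
    -- descends to the divided values.
    have hind : IsInducing (AddMonoidHom.mulLeft ((p : ℤ_[p]) ^ n)) :=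
      ((continuous_const_mul ((p : ℤ_[p]) ^ n)).isClosedEmbedding
        (mul_right_injective₀ hp)).isInducing
    refine Ideal.mem_span_singleton.2 ⟨⟨ν, fun h A U hU hd => ?_⟩,
      toFun_injective (funext fun U => ?_)⟩
    · refine (hind.hasSum_iff _ _).1 ?_
      convert μ.hasSum_iUnion h A U hU hd using 1
      · exact funext fun a => (hν _).symm
      · exact (hν _).symm
    · rw [pow_mul_toFun]
      exact hν U

theorem reduction_toFun (μ : UnifMeasure p ℤ_[p]) (U : unifMeasurable p) :
    (reduction p μ).toFun U = PadicInt.toZMod (μ.toFun U) := rfl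

theorem toZMod_eq_zero_iff {x : ℤ_[p]} :
    (PadicInt.toZMod x : ZMod p) = 0 ↔ x ∈ Ideal.span {(p : ℤ_[p])} := by
  rw [← RingHom.mem_ker, PadicInt.ker_toZMod, PadicInt.maximalIdeal_eq_span_p]

theorem ker_reduction :
    RingHom.ker (reduction p) = Ideal.span {(p : UnifMeasure p ℤ_[p])} := by
  ext μ
  have := mem_span_pow_iff (n := 1) (μ := μ)
  rw [pow_one, pow_one] at this
  rw [this, RingHom.mem_ker]
  refine ⟨fun h U => ?_, fun h => toFun_injective (funext fun U => ?_)⟩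
  · rw [← toZMod_eq_zero_iff, ← reduction_toFun, h]
    rfl
  · rw [reduction_toFun, toZMod_eq_zero_iff.2 (h U)]
    rfl

theorem exists_eq_mul_of_reduction_eq_zero {μ : UnifMeasure p ℤ_[p]} (h : reduction p μ = 0) :
    ∃ ν, μ = p * ν := by
  have : μ ∈ RingHom.ker (reduction p) := h
  rw [ker_reduction] at this
  exact Ideal.mem_span_singleton.1 this

theorem reduction_dirac (a : ℚ_[p]) : reduction p (dirac ℤ_[p] a) = dirac (ZMod p) a := by
  classical
  refine toFun_injective (funext fun U => ?_)
  show PadicInt.toZMod (if a ∈ U.1 then (1 : ℤ_[p]) else 0) = if a ∈ U.1 then 1 else 0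
  split_ifs <;> simp

theorem reduction_diracSub (n : ℕ) : reduction p (diracSub p ℤ_[p] n) = diracSub p (ZMod p) n := by
  rw [diracSub_eq, map_sub, map_one, reduction_dirac, ← diracSub_eq]

theorem reduction_mem_vanishingIdeal {h : ℕ} {μ : UnifMeasure p ℤ_[p]} :
    reduction p μ ∈ vanishingIdeal p h ↔
      μ ∈ levelIdeal p h (Ideal.span {(p : ℤ_[p]) ^ 1}) (PadicInt.isOpen_span_pow p 1) := by
  simp only [mem_levelIdeal, Ideal.mem_bot, pow_one]
  exact forall_congr' fun V => toZMod_eq_zero_iff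

/-- The basic neighborhoods of zero in the `ℤ_p`-valued uniform measures. -/
noncomputable abbrev basicIdeal (p : ℕ) [Fact p.Prime] (h n : ℕ) : Ideal (UnifMeasure p ℤ_[p]) :=
  levelIdeal p h (Ideal.span {(p : ℤ_[p]) ^ n}) (PadicInt.isOpen_span_pow p n)

theorem basicIdeal_mono {h h' n n' : ℕ} (hh : h' ≤ h) (hn : n' ≤ n) :
    basicIdeal p h n ≤ basicIdeal p h' n' :=
  levelIdeal_mono hh (Ideal.span_singleton_le_span_singleton.2 (pow_dvd_pow _ hn)) _ _

theorem hasBasis_basicIdeal : (𝓝 (0 : UnifMeasure p ℤ_[p])).HasBasis (fun _ => True)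
    fun n => (basicIdeal p n n : Set (UnifMeasure p ℤ_[p])) := by
  refine (hasBasis_nhds_zero p ℤ_[p]).to_hasBasis ?_ ?_
  · rintro ⟨h, J⟩ hJ
    obtain ⟨n, -, hn⟩ := (PadicInt.hasBasis_span_pow p).mem_iff.1 (hJ.mem_nhds J.zero_mem)
    refine ⟨max h n, trivial, fun μ hμ => ?_⟩
    exact levelIdeal_mono le_rfl hn _ hJ (basicIdeal_mono (le_max_left h n) (le_max_right h n) hμ)
  · intro n _
    exact ⟨(n, Ideal.span {(p : ℤ_[p]) ^ n}), PadicInt.isOpen_span_pow p n, fun μ hμ => hμ⟩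

theorem exists_forall_sub_mem_basicIdeal (s : ℕ → UnifMeasure p ℤ_[p])
    (hs : ∀ n, s (n + 1) - s n ∈ basicIdeal p n n) : ∃ x, ∀ n, x - s n ∈ basicIdeal p n n :=
  exists_forall_sub_mem_of_succ_sub_mem (fun n => (basicIdeal p n n).toAddSubgroup)
    hasBasis_basicIdeal (fun _ _ h => basicIdeal_mono h h) s hs

theorem span_pow_le_basicIdeal (h n : ℕ) :
    Ideal.span {(p : UnifMeasure p ℤ_[p]) ^ n} ≤ basicIdeal p h n :=
  fun _ hμ _ => mem_span_pow_iff.1 hμ _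

/-- A `p`-adic Cauchy sequence converges for the coarser natural topology. Its congruences modulo `p
^ n` pass to the limit one set at a time, by comparison with a term whose index exceeds both `n` and
the radius of the set. -/
instance isAdicComplete_span_p :
    IsAdicComplete (Ideal.span {(p : UnifMeasure p ℤ_[p])}) (UnifMeasure p ℤ_[p]) where
  haus' μ hμ := by
    refine toFun_injective (funext fun U => ?_)
    have h1 : ∀ n : ℕ, μ.toFun U ∈ Ideal.span {(p : ℤ_[p]) ^ n} := fun n => by
      have := hμ n
      rw [smul_eq_mul, Ideal.mul_top, SModEq.zero, Ideal.span_singleton_pow] at this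
      exact mem_span_pow_iff.1 this U
    by_contra hne
    obtain ⟨n, -, hn⟩ := (PadicInt.hasBasis_span_pow p).mem_iff.1
      (isOpen_compl_singleton.mem_nhds (Ne.symm hne))
    exact hn (h1 n) rfl
  prec' f hf := by
    simp only [smul_eq_mul, Ideal.mul_top, SModEq.sub_mem, Ideal.span_singleton_pow] at hf ⊢
    obtain ⟨L, hL⟩ := exists_forall_sub_mem_basicIdeal f fun n => by
      refine span_pow_le_basicIdeal n n ?_
      rw [← neg_sub]
      exact neg_mem (hf n.le_succ)
    refine ⟨L, fun n => mem_span_pow_iff.2 ?_⟩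
    rintro ⟨U, h, V, rfl⟩
    have h1 : L - f (max n h) ∈ basicIdeal p h n := basicIdeal_mono (le_max_right n h)
      (le_max_left n h) (hL _)
    have h2 := sub_mem (span_pow_le_basicIdeal h n (hf (le_max_left n h))) h1
    rw [sub_sub_sub_cancel_right] at h2
    exact h2 V

/-- `Δ_{p^h} - Δ_0`. -/
noncomputable def diracPowSub (p : ℕ) [Fact p.Prime] (h : ℕ) : UnifMeasure p ℤ_[p] :=
  dirac ℤ_[p] ((p : ℚ_[p]) ^ h) - 1

theorem diracPowSub_mem (h n : ℕ) : diracPowSub p h ∈ basicIdeal p h n :=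
  dirac_sub_dirac_mem (by rw [sub_zero]; exact pow_mem_ballSubgroup h) _ _

theorem reduction_diracPowSub (h : ℕ) :
    reduction p (diracPowSub p h) = diracSub p (ZMod p) 0 ^ p ^ h := by
  rw [diracPowSub, map_sub, map_one, reduction_dirac, diracSub_zero_pow]

theorem exists_sub_reduction_mem (h : ℕ) (ν : UnifMeasure p (ZMod p)) :
    ∃ μ, ν - reduction p μ ∈ vanishingIdeal p h := by
  obtain ⟨_, ⟨a, rfl⟩, ha⟩ := exists_sub_mem_levelIdeal ν h ⊥ (isOpen_discrete _)
    (AddMonoidHom.mrange (reduction p).toAddMonoidHom) (fun c m n => by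
      refine ⟨(c.val : UnifMeasure p ℤ_[p]) * dirac ℤ_[p] ((m : ℚ_[p]) / (p : ℚ_[p]) ^ n), ?_⟩
      show reduction p _ = _
      rw [map_mul, reduction_dirac, map_natCast, Algebra.smul_def,
        ← map_natCast (algebraMap (ZMod p) (UnifMeasure p (ZMod p))), ZMod.natCast_zmod_val])
  exact ⟨a, ha⟩

/-- Lifting values one by one need not preserve additivity. Instead, an error vanishing at radius
`h` is `t ^ p ^ h * ν'`, and it is corrected by `Δ_{p^h} - Δ_0` times an approximate lift of `ν'`.
The corrections vanish at radius `h`, so they add up to a measure. -/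
theorem reduction_surjective : Function.Surjective (reduction p) := by
  intro ν
  have step : ∀ h (μ : UnifMeasure p ℤ_[p]), ν - reduction p μ ∈ vanishingIdeal p h →
      ∃ x ∈ basicIdeal p h h, ν - reduction p (μ + x) ∈ vanishingIdeal p (h + 1) := by
    intro h μ hμ
    rw [vanishingIdeal_eq_span] at hμ
    obtain ⟨ν', hν'⟩ := Ideal.mem_span_singleton.1 hμ
    obtain ⟨x, hx⟩ := exists_sub_reduction_mem (h + 1) ν'
    refine ⟨diracPowSub p h * x, Ideal.mul_mem_right _ _ (diracPowSub_mem h h), ?_⟩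
    rw [map_add, map_mul, reduction_diracPowSub, ← sub_sub, hν', ← mul_sub]
    exact Ideal.mul_mem_left _ _ hx
  choose x hx hx' using step
  obtain ⟨μ₀, hμ₀⟩ := exists_sub_reduction_mem 0 ν
  let s : ∀ n, {μ // ν - reduction p μ ∈ vanishingIdeal p n} := fun n =>
    Nat.rec ⟨μ₀, hμ₀⟩ (fun n μ => ⟨μ.1 + x n μ.1 μ.2, hx' n μ.1 μ.2⟩) n
  obtain ⟨L, hL⟩ := exists_forall_sub_mem_basicIdeal (fun n => (s n).1) fun n => by
    show (s n).1 + x n (s n).1 (s n).2 - (s n).1 ∈ _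
    rw [add_sub_cancel_left]
    exact hx n _ _
  refine ⟨L, (sub_eq_zero.1 (eq_zero_of_forall_mem_vanishingIdeal fun n => ?_)).symm⟩
  -- The index `n + 1` guarantees a factor `p` even for `n = 0`.
  have h1 : reduction p (L - (s (n + 1)).1) ∈ vanishingIdeal p n :=
    reduction_mem_vanishingIdeal.2 (basicIdeal_mono n.le_succ (by omega) (hL (n + 1)))
  have h2 := sub_mem (vanishingIdeal_antitone n.le_succ (s (n + 1)).2) h1
  rw [map_sub] at h2
  convert h2 using 1
  ring

theorem mul_mem_basicIdeal_succ_iff {h n : ℕ} {μ : UnifMeasure p ℤ_[p]} :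
    (p : UnifMeasure p ℤ_[p]) * μ ∈ basicIdeal p h (n + 1) ↔ μ ∈ basicIdeal p h n := by
  have hp : (p : ℤ_[p]) ≠ 0 := by exact_mod_cast (Fact.out : p.Prime).ne_zero
  simp only [mem_levelIdeal, push, natCast_mul_toFun, Ideal.mem_span_singleton, pow_succ',
    mul_dvd_mul_iff_left hp]

/-- The measures whose values on the sets of radius `h` are divisible by `p ^ n` form the ideal
generated by `Δ_{p^h} - Δ_0` and `p ^ n`. -/
theorem basicIdeal_eq_span (h n : ℕ) : basicIdeal p h n =
    Ideal.span {diracPowSub p h, (p : UnifMeasure p ℤ_[p]) ^ n} := by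
  refine le_antisymm ?_ ?_
  · induction n with
    | zero =>
      intro μ _
      rw [pow_zero, (Ideal.eq_top_iff_one _).2 (Ideal.subset_span (by simp))]
      trivial
    | succ n ih =>
      intro μ hμ
      -- Modulo `p` the measure is a multiple of `t ^ p ^ h`, the reduction of `Δ_{p^h} - Δ_0`.
      -- Subtracting a lift of this multiple leaves `p μ''`, with `μ''` in the ideal for exponent
      -- `n`.
      have h1 : reduction p μ ∈ vanishingIdeal p h :=
        reduction_mem_vanishingIdeal.2 (basicIdeal_mono le_rfl (by omega) hμ)
      rw [vanishingIdeal_eq_span] at h1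
      obtain ⟨ν, hν⟩ := Ideal.mem_span_singleton.1 h1
      obtain ⟨μ', rfl⟩ := reduction_surjective ν
      obtain ⟨μ'', h2⟩ := exists_eq_mul_of_reduction_eq_zero
        (μ := μ - diracPowSub p h * μ') (by
          rw [map_sub, map_mul, reduction_diracPowSub, hν, sub_self])
      have h3 : μ'' ∈ basicIdeal p h n := by
        rw [← mul_mem_basicIdeal_succ_iff, ← h2]
        exact sub_mem hμ (Ideal.mul_mem_right _ _ (diracPowSub_mem h _))
      obtain ⟨a, b, hab⟩ := Ideal.mem_span_pair.1 (ih h3)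
      refine Ideal.mem_span_pair.2 ⟨μ' + p * a, b, ?_⟩
      rw [← sub_add_cancel μ (diracPowSub p h * μ'), h2, ← hab]
      ring
  · rw [Ideal.span_le]
    rintro x (rfl | rfl)
    · exact diracPowSub_mem h n
    · exact span_pow_le_basicIdeal h n (Ideal.mem_span_singleton_self _)

/-- With `x = Δ_{p^h} - Δ_0`, the next element is `(1 + x) ^ p - 1`, a combination of `x ^ p` and `p
x`; both gain at least one power of `(p, T)`. -/
theorem diracPowSub_mem_pow (h : ℕ) : diracPowSub p h ∈
    Ideal.span {(p : UnifMeasure p ℤ_[p]), diracSub p ℤ_[p] 0} ^ (h + 1) := by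
  have hpI : (p : UnifMeasure p ℤ_[p]) ∈
      Ideal.span {(p : UnifMeasure p ℤ_[p]), diracSub p ℤ_[p] 0} := Ideal.subset_span (by simp)
  induction h with
  | zero =>
    have : diracPowSub p 0 = diracSub p ℤ_[p] 0 := by simp [diracPowSub, diracSub_eq]
    rw [this, zero_add, pow_one]
    exact Ideal.subset_span (by simp)
  | succ h ih =>
    have h1 : diracPowSub p (h + 1) = (diracPowSub p h + 1) ^ p - 1 := by
      rw [diracPowSub, diracPowSub, sub_add_cancel, ← dirac_nsmul, nsmul_eq_mul, pow_succ']
    obtain ⟨r, hr⟩ := exists_add_pow_prime_eq (Fact.out : p.Prime) (diracPowSub p h) 1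
    rw [h1, hr, one_pow]
    have h2 : diracPowSub p h ^ p ∈
        Ideal.span {(p : UnifMeasure p ℤ_[p]), diracSub p ℤ_[p] 0} ^ (h + 1 + 1) := by
      refine Ideal.pow_le_pow_right ?_ (show _ ∈ _ ^ ((h + 1) * p) from ?_)
      · have := Nat.mul_le_mul_left (h + 1) (Fact.out : p.Prime).two_le
        omega
      · rw [pow_mul]
        exact Ideal.pow_mem_pow ih p
    have h3 : (p : UnifMeasure p ℤ_[p]) * diracPowSub p h ∈
        Ideal.span {(p : UnifMeasure p ℤ_[p]), diracSub p ℤ_[p] 0} ^ (h + 1 + 1) := by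
      rw [pow_succ' _ (h + 1)]
      exact Ideal.mul_mem_mul hpI ih
    have := add_mem h2 (Ideal.mul_mem_right r _ h3)
    convert this using 1
    ring

/-- `T ^ p ^ h` is a multiple of `p` modulo `Δ_{p^h} - Δ_0`, which vanishes at radius `h`; its
`n`-th power is then divisible by `p ^ n` there. -/
theorem pow_diracSub_mem_basicIdeal (h n : ℕ) :
    diracSub p ℤ_[p] 0 ^ (p ^ h * n) ∈ basicIdeal p h n := by
  have h1 : diracSub p ℤ_[p] 0 ^ p ^ h ∈ basicIdeal p h 1 := by
    rw [← reduction_mem_vanishingIdeal, map_pow, reduction_diracSub]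
    exact diracSub_zero_pow_mem h
  rw [basicIdeal_eq_span, pow_one] at h1
  obtain ⟨a, b, hab⟩ := Ideal.mem_span_pair.1 h1
  have h2 := sub_dvd_pow_sub_pow (a * diracPowSub p h + b * p) (b * p) n
  rw [add_sub_cancel_right] at h2
  have h3 := (basicIdeal p h n).mem_of_dvd h2 (Ideal.mul_mem_left _ _ (diracPowSub_mem h n))
  have h4 : (b * (p : UnifMeasure p ℤ_[p])) ^ n ∈ basicIdeal p h n := by
    rw [mul_pow]
    exact Ideal.mul_mem_left _ _ (span_pow_le_basicIdeal h n (Ideal.mem_span_singleton_self _))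
  have := add_mem h3 h4
  rwa [sub_add_cancel, hab, ← pow_mul] at this

theorem isAdic_span_p_diracSub :
    IsAdic (Ideal.span {(p : UnifMeasure p ℤ_[p]), diracSub p ℤ_[p] 0}) := by
  -- The exponent `h + p ^ h * h` comes from `(I + J) ^ (a + b) ≤ I ^ a + J ^ b`, with `a = h` for
  -- `p` and `b = p ^ h * h` for `T`.
  refine isAdic_of_hasBasis hasBasis_basicIdeal _ (fun n => ⟨n, trivial, ?_⟩)
    fun h _ => ⟨h + p ^ h * h, ?_⟩
  · show basicIdeal p n n ≤ _
    rw [basicIdeal_eq_span, Ideal.span_le]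
    rintro x (rfl | rfl)
    · exact Ideal.pow_le_pow_right n.le_succ (diracPowSub_mem_pow n)
    · exact Ideal.pow_mem_pow (Ideal.subset_span (by simp)) n
  · show Ideal.span _ ^ _ ≤ basicIdeal p h h
    rw [Ideal.span_insert]
    refine (Ideal.sup_pow_add_le_pow_sup_pow).trans (sup_le ?_ ?_)
    · rw [Ideal.span_singleton_pow]
      exact span_pow_le_basicIdeal h h
    · rw [Ideal.span_singleton_pow, Ideal.span_singleton_le_iff_mem]
      exact pow_diracSub_mem_basicIdeal h h

end UnifMeasure

/-! ### Lifting density and kernels from characteristic `p` -/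

section modP

variable {A B A' B' : Type} [CommRing A] [CommRing B] [CommRing A'] [CommRing B'] {p : ℕ}
  {f : A →+* B} {f' : A' →+* B'} {rA : A →+* A'} {rB : B →+* B'}

/-- Induction on `k`: the statement modulo `p` removes a multiple of `x ^ M` from `a`, and what is
left is `p a'`, with `a'` subject to the hypothesis for exponent `k`. -/
theorem mem_span_pair_of_map_mem (hcomm : ∀ a, rB (f a) = f' (rA a)) (hrA : Function.Surjective rA)
    (hA : ∀ a, rA a = 0 → ∃ c, a = p * c) (hpB : rB p = 0) (hB : ∀ b, rB b = 0 → ∃ c, b = p * c)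
    (hp : ∀ b : B, p * b = 0 → b = 0) {x : A} {M : ℕ} (hx : ∀ b, f' (rA x) ^ M * b = 0 → b = 0)
    (hdvd : ∀ a, f' a ∈ Ideal.span {f' (rA x) ^ M} → rA x ^ M ∣ a) (k : ℕ) (a : A)
    (ha : f a ∈ Ideal.span {(p : B) ^ k, f x ^ M}) : a ∈ Ideal.span {(p : A) ^ k, x ^ M} := by
  induction k generalizing a with
  | zero =>
    rw [pow_zero, (Ideal.eq_top_iff_one _).2 (Ideal.subset_span (by simp))]
    trivial
  | succ k ih =>
    obtain ⟨u, v, huv⟩ := Ideal.mem_span_pair.1 ha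
    have h1 : f' (rA a) = f' (rA x) ^ M * rB v := by
      rw [← hcomm, ← huv, map_add, map_mul, map_mul, map_pow, map_pow, hpB, ← hcomm]
      ring
    obtain ⟨b', hb'⟩ := hdvd _ (h1 ▸ Ideal.mul_mem_right _ _ (Ideal.mem_span_singleton_self _))
    obtain ⟨b, rfl⟩ := hrA b'
    obtain ⟨a', ha'⟩ := hA (a - x ^ M * b) (by rw [map_sub, map_mul, map_pow, hb', sub_self])
    -- Regularity of `f' (rA x) ^ M` forces `v` and `f b` to agree modulo `p`; this is what permits
    -- the division of the relation by `p`.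
    obtain ⟨w, hw⟩ := hB (v - f b) (hx _ (by
      rw [map_sub, mul_sub, ← h1, hcomm, hb', map_mul, map_pow, sub_self]))
    have h2 : f a' = u * p ^ k + w * f x ^ M := by
      refine sub_eq_zero.1 (hp _ ?_)
      have h3 : (p : B) * f a' = f a - f x ^ M * f b := by
        rw [← map_natCast f, ← map_mul, ← ha', map_sub, map_mul, map_pow]
      rw [mul_sub, h3, ← huv, eq_add_of_sub_eq hw]
      ring
    obtain ⟨c, d, hcd⟩ := Ideal.mem_span_pair.1 (ih a' (Ideal.mem_span_pair.2 ⟨u, w, h2.symm⟩))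
    refine Ideal.mem_span_pair.2 ⟨c, p * d + b, ?_⟩
    rw [eq_add_of_sub_eq ha', ← hcd]
    ring

theorem exists_sub_mem_span_pair (hcomm : ∀ a, rB (f a) = f' (rA a)) (hrA : Function.Surjective rA)
    (hrB : Function.Surjective rB) (hB : ∀ b, rB b = 0 → ∃ c, b = p * c) {x : A} {M : ℕ}
    (hd : ∀ b, ∃ a, b - f' a ∈ Ideal.span {f' (rA x) ^ M}) (k : ℕ) (b : B) :
    ∃ a, b - f a ∈ Ideal.span {(p : B) ^ k, f x ^ M} := by
  induction k generalizing b with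
  | zero =>
    rw [pow_zero, (Ideal.eq_top_iff_one _).2 (Ideal.subset_span (by simp))]
    exact ⟨0, trivial⟩
  | succ k ih =>
    obtain ⟨a', ha'⟩ := hd (rB b)
    obtain ⟨a, rfl⟩ := hrA a'
    obtain ⟨c', hc'⟩ := Ideal.mem_span_singleton.1 ha'
    obtain ⟨c, rfl⟩ := hrB c'
    obtain ⟨b', hb'⟩ := hB (b - f a - f x ^ M * c) (by
      rw [map_sub, map_sub, hcomm, hc', map_mul, map_pow, hcomm, sub_self])
    obtain ⟨a₁, h1⟩ := ih b'
    obtain ⟨u, v, huv⟩ := Ideal.mem_span_pair.1 h1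
    refine ⟨a + p * a₁, Ideal.mem_span_pair.2 ⟨u, p * v + c, ?_⟩⟩
    have h2 : b = f a + (f x ^ M * c + p * b') := by rw [← hb']; ring
    rw [h2, eq_add_of_sub_eq huv.symm, map_add, map_mul, map_natCast]
    ring

/-- An element of the kernel is divisible by `p`, and its quotient is again in the kernel since `B`
has no `p`-torsion; so it is divisible by all powers of `p`. -/
theorem injective_of_injective_mod (hcomm : ∀ a, rB (f a) = f' (rA a))
    (hA : ∀ a, rA a = 0 → ∃ c, a = p * c) (hsep : ∀ a : A, (∀ k, (p : A) ^ k ∣ a) → a = 0)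
    (hp : ∀ b : B, p * b = 0 → b = 0) (hf' : Function.Injective f') : Function.Injective f := by
  rw [injective_iff_map_eq_zero]
  intro a ha
  refine hsep a fun k => ?_
  induction k generalizing a with
  | zero => simp
  | succ k ih =>
    obtain ⟨c, rfl⟩ := hA a (hf' (by rw [← hcomm, ha, map_zero, map_zero]))
    rw [map_mul, map_natCast] at ha
    rw [pow_succ']
    exact mul_dvd_mul_left _ (ih c (hp _ ha))

/-- Completions modulo `p` lift to completions for the topology defined by `p` and a lift of the
generator. -/
theorem isRingCompletion_span_pair [UniformSpace B] [IsUniformAddGroup B] [CompleteSpace B]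
    [T2Space B] (hcomm : ∀ a, rB (f a) = f' (rA a)) (hrA : Function.Surjective rA)
    (hrB : Function.Surjective rB) (hA : ∀ a, rA a = 0 → ∃ c, a = p * c) (hpB : rB p = 0)
    (hB : ∀ b, rB b = 0 → ∃ c, b = p * c) (hp : ∀ b : B, p * b = 0 → b = 0) {x : A}
    (hx : ∀ (n : ℕ) b, f' (rA x) ^ n * b = 0 → b = 0)
    (hdvd : ∀ (n : ℕ) a, f' a ∈ Ideal.span {f' (rA x) ^ n} → rA x ^ n ∣ a)
    (hd : ∀ (n : ℕ) b, ∃ a, b - f' a ∈ Ideal.span {f' (rA x) ^ n})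
    (hadic : IsAdic (Ideal.span {(p : B), f x})) :
    IsRingCompletion (Ideal.span {(p : A), x}).adicTopology f := by
  have hle : ∀ {C : Type} [CommRing C] (y : C) (n : ℕ),
      Ideal.span {(p : C) ^ n, y ^ n} ≤ Ideal.span {(p : C), y} ^ n := by
    intro C _ y n
    rw [Ideal.span_le]
    rintro z (rfl | rfl)
    · exact Ideal.pow_mem_pow (Ideal.subset_span (by simp)) n
    · exact Ideal.pow_mem_pow (Ideal.subset_span (by simp)) n
  -- The exponent `n + n` is chosen because `(p, y) ^ (n + n)` is contained in `(p ^ n, y ^ n)`.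
  refine isRingCompletion_adic f _ _ hadic ?_ (fun n => ⟨n + n, fun a ha => ?_⟩) fun b n => ?_
  · rw [Ideal.map_span, Set.image_pair, map_natCast]
  · refine hle x n (mem_span_pair_of_map_mem hcomm hrA hA hpB hB hp (hx n) (hdvd n) n a ?_)
    rw [Ideal.span_insert] at ha ⊢
    have := Ideal.sup_pow_add_le_pow_sup_pow ha
    rwa [Ideal.span_singleton_pow, Ideal.span_singleton_pow] at this
  · obtain ⟨a, ha⟩ := exists_sub_mem_span_pair hcomm hrA hrB hB (hd n) n b
    exact ⟨a, hle (f x) n ha⟩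

end modP

/-! ### Monoid algebras over `ℤ` and their reduction modulo `p` -/

namespace AddMonoidAlgebra
variable (p : ℕ) [Fact p.Prime] {G : Type} [AddCommMonoid G]

/-- Reduction modulo `p` of the coefficients. -/
noncomputable def reductionMod (G : Type) [AddCommMonoid G] :
    AddMonoidAlgebra ℤ G →+* AddMonoidAlgebra (ZMod p) G :=
  mapRingHom G (Int.castRingHom (ZMod p))

theorem reductionMod_single (x : G) (c : ℤ) :
    reductionMod p G (single x c) = single x (c : ZMod p) := by
  simp [reductionMod]

theorem reductionMod_surjective : Function.Surjective (reductionMod p G) :=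
  map_surjective (Int.castRingHom (ZMod p) : ℤ →+ ZMod p) ZMod.intCast_surjective

variable {p}

theorem coeff_natCast_mul (n : ℕ) (a : AddMonoidAlgebra ℤ G) (x : G) :
    ((n : AddMonoidAlgebra ℤ G) * a).coeff x = n * a.coeff x := by
  rw [← nsmul_eq_mul, coeff_smul, Finsupp.smul_apply, nsmul_eq_mul]

theorem exists_eq_mul_of_reductionMod_eq_zero (a : AddMonoidAlgebra ℤ G)
    (ha : reductionMod p G a = 0) : ∃ c, a = p * c := by
  refine ⟨ofCoeff (a.coeff.mapRange (· / (p : ℤ)) (Int.zero_ediv _)), ?_⟩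
  ext x
  rw [coeff_natCast_mul]
  have h1 : ((a.coeff x : ℤ) : ZMod p) = 0 := by
    have := congrArg (fun b => b.coeff x) ha
    simpa [reductionMod] using this
  exact (Int.mul_ediv_cancel' ((ZMod.intCast_zmod_eq_zero_iff_dvd _ _).1 h1)).symm

theorem eq_zero_of_forall_pow_dvd (a : AddMonoidAlgebra ℤ G)
    (ha : ∀ k, (p : AddMonoidAlgebra ℤ G) ^ k ∣ a) : a = 0 := by
  ext x
  -- The exponent `k = |c|` suffices for a coefficient `c`, as `p ^ k > k`.
  obtain ⟨c, hc⟩ := ha (a.coeff x).natAbs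
  have h1 : ((p ^ (a.coeff x).natAbs : ℕ) : ℤ) ∣ a.coeff x := by
    have := coeff_natCast_mul (p ^ (a.coeff x).natAbs) c x
    rw [Nat.cast_pow, ← hc] at this
    exact ⟨_, this⟩
  refine Int.eq_zero_of_abs_lt_dvd h1 ?_
  rw [Int.abs_eq_natAbs]
  exact_mod_cast Nat.lt_pow_self (Fact.out : p.Prime).one_lt

end AddMonoidAlgebra

/-! ### Measures as completions of integral group algebras -/

namespace UnifMeasure
variable {p : ℕ} [Fact p.Prime]

theorem diracSub_zmod_ne_zero (n : ℕ) : diracSub p (ZMod p) n ≠ 0 := by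
  intro h
  have h1 : ofPerfPoly p (PerfPoly.root (ZMod p) p n) = ofPerfPoly p 0 := by
    rw [ofPerfPoly_root, h, map_zero]
  have h2 := ofPerfPoly_injective h1
  rw [PerfPoly.root, AddMonoidAlgebra.single_eq_zero] at h2
  exact one_ne_zero h2

theorem reduction_natCast : reduction p (p : UnifMeasure p ℤ_[p]) = 0 := by
  rw [map_natCast, CharP.cast_eq_zero]

/-- Stated for any monoid, to cover both the group algebras and the polynomials in the `T̃_n`. -/
theorem reduction_lift {G : Type} [AddCommMonoid G] (F : Multiplicative G →* UnifMeasure p ℤ_[p])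
    (F' : Multiplicative G →* UnifMeasure p (ZMod p)) (hF : ∀ x, reduction p (F x) = F' x)
    (a : AddMonoidAlgebra ℤ G) : reduction p (AddMonoidAlgebra.lift ℤ _ G F a) =
      AddMonoidAlgebra.lift (ZMod p) _ G F' (AddMonoidAlgebra.reductionMod p G a) := by
  induction a using AddMonoidAlgebra.induction_linear with
  | zero => simp
  | add x y hx hy => rw [map_add, map_add, map_add, map_add, hx, hy]
  | single x c =>
    rw [AddMonoidAlgebra.reductionMod_single, AddMonoidAlgebra.lift_single,
      AddMonoidAlgebra.lift_single, map_zsmul, hF, Int.cast_smul_eq_zsmul]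

theorem reduction_ofGroupAlgebra (a : AddMonoidAlgebra ℤ ℚ_[p]) :
    reduction p (ofGroupAlgebra p ℤ ℤ_[p] a) =
      ofGroupAlgebra p (ZMod p) (ZMod p) (AddMonoidAlgebra.reductionMod p _ a) :=
  reduction_lift _ _ (fun _ => reduction_dirac _) a

theorem reduction_ofGroupAlgebraZInv (a : AddMonoidAlgebra ℤ (zInv p)) :
    reduction p (ofGroupAlgebraZInv p ℤ ℤ_[p] a) =
      ofGroupAlgebraZInv p (ZMod p) (ZMod p) (AddMonoidAlgebra.reductionMod p _ a) :=
  reduction_lift _ _ (fun _ => reduction_dirac _) a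

theorem ofGroupAlgebra_int_injective : Function.Injective (ofGroupAlgebra p ℤ ℤ_[p]) :=
  injective_of_injective_mod reduction_ofGroupAlgebra
    AddMonoidAlgebra.exists_eq_mul_of_reductionMod_eq_zero
    AddMonoidAlgebra.eq_zero_of_forall_pow_dvd (fun _ => eq_zero_of_natCast_mul_eq_zero)
    ofGroupAlgebra_injective

theorem ofGroupAlgebraZInv_int_injective : Function.Injective (ofGroupAlgebraZInv p ℤ ℤ_[p]) :=
  injective_of_injective_mod reduction_ofGroupAlgebraZInv
    AddMonoidAlgebra.exists_eq_mul_of_reductionMod_eq_zero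
    AddMonoidAlgebra.eq_zero_of_forall_pow_dvd (fun _ => eq_zero_of_natCast_mul_eq_zero)
    ofGroupAlgebraZInv_injective

theorem ofGroupAlgebraZInv_int_sub : ofGroupAlgebraZInv p ℤ ℤ_[p]
    (AddMonoidAlgebra.single (zInvOne p) 1 - AddMonoidAlgebra.single 0 1) = diracSub p ℤ_[p] 0 := by
  have h : ∀ a : zInv p, ofGroupAlgebraZInv p ℤ ℤ_[p] (AddMonoidAlgebra.single a 1) =
      dirac ℤ_[p] (a : ℚ_[p]) := fun a => by
    refine (AddMonoidAlgebra.lift_single _ _ _).trans ?_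
    rw [one_smul]
    rfl
  rw [map_sub, h, h, diracSub]
  simp [zInvOne]

/-- Lifting to `ℤ_p`-valued measures of the description of a dense subring of the `𝔽_p`-valued
ones. -/
theorem isRingCompletion_int {G : Type} [AddCommMonoid G]
    (f : AddMonoidAlgebra ℤ G →+* UnifMeasure p ℤ_[p])
    (f' : AddMonoidAlgebra (ZMod p) G →+* UnifMeasure p (ZMod p))
    (hcomm : ∀ a, reduction p (f a) = f' (AddMonoidAlgebra.reductionMod p G a))
    (x : AddMonoidAlgebra ℤ G)
    (hx : f' (AddMonoidAlgebra.reductionMod p G x) = diracSub p (ZMod p) 0)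
    (hker : ∀ h a, f' a ∈ vanishingIdeal p h → AddMonoidAlgebra.reductionMod p G x ^ p ^ h ∣ a)
    (hd : ∀ h μ, ∃ a, μ - f' a ∈ vanishingIdeal p h)
    (hadic : IsAdic (Ideal.span {(p : UnifMeasure p ℤ_[p]), f x})) :
    IsRingCompletion (Ideal.span {(p : AddMonoidAlgebra ℤ G), x}).adicTopology f := by
  refine isRingCompletion_span_pair hcomm (AddMonoidAlgebra.reductionMod_surjective p)
    reduction_surjective AddMonoidAlgebra.exists_eq_mul_of_reductionMod_eq_zero reduction_natCast
    (fun _ => exists_eq_mul_of_reduction_eq_zero) (fun _ => eq_zero_of_natCast_mul_eq_zero) ?_ ?_ ?_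
    hadic
  · intro n b hb
    rw [hx] at hb
    exact (mul_eq_zero.1 hb).resolve_left (pow_ne_zero _ (diracSub_zmod_ne_zero 0))
  · intro n a ha
    rw [hx] at ha
    exact pow_dvd_of_mem_span_pow f' _ hx hker hd n a ha
  · intro n b
    rw [hx]
    exact exists_sub_mem_span_pow f' _ hx hd b n

theorem isRingCompletion_ofGroupAlgebraZInv_int : IsRingCompletion
    (Ideal.span {(p : AddMonoidAlgebra ℤ (zInv p)),
      AddMonoidAlgebra.single (zInvOne p) 1 - AddMonoidAlgebra.single 0 1}).adicTopology
    (ofGroupAlgebraZInv p ℤ ℤ_[p]) := by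
  have h1 : AddMonoidAlgebra.reductionMod p (zInv p)
      (AddMonoidAlgebra.single (zInvOne p) 1 - AddMonoidAlgebra.single 0 1) =
      AddMonoidAlgebra.single (zInvOne p) 1 - AddMonoidAlgebra.single 0 1 := by
    rw [map_sub, AddMonoidAlgebra.reductionMod_single, AddMonoidAlgebra.reductionMod_single,
      Int.cast_one]
  refine isRingCompletion_int (ofGroupAlgebraZInv p ℤ ℤ_[p])
    (ofGroupAlgebraZInv p (ZMod p) (ZMod p)) reduction_ofGroupAlgebraZInv
    (AddMonoidAlgebra.single (zInvOne p) 1 - AddMonoidAlgebra.single 0 1) ?_ ?_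
    exists_sub_ofGroupAlgebraZInv_mem ?_
  · rw [h1, ofGroupAlgebraZInv_sub]
  · rw [h1]
    exact pow_dvd_of_ofGroupAlgebraZInv_mem
  · rw [ofGroupAlgebraZInv_int_sub]
    exact isAdic_span_p_diracSub

theorem isRingCompletion_ofGroupAlgebra_int : IsRingCompletion
    ((Ideal.span {(p : UnifMeasure p ℤ_[p]), diracSub p ℤ_[p] 0}).adicTopology.induced
      (ofGroupAlgebra p ℤ ℤ_[p])) (ofGroupAlgebra p ℤ ℤ_[p]) := by
  refine isRingCompletion_induced isAdic_span_p_diracSub _ ?_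
  refine isRingCompletion_ofGroupAlgebraZInv_int.dense.mono ?_
  rintro _ ⟨a, rfl⟩
  exact ⟨_, (ofGroupAlgebraZInv_eq a).symm⟩

end UnifMeasure

/-! ### Strict `p`-rings and Witt vectors -/

section strict

variable {p : ℕ} [Fact p.Prime] {A R : Type} [CommRing A] [CommRing R] [CharP R p] [PerfectRing R p]
  {r : A →+* R}

theorem WittVector.mem_span_p_pow_iff_forall_coeff_eq {x y : WittVector p R} {n : ℕ} :
    y - x ∈ Ideal.span {(p : WittVector p R) ^ n} ↔ ∀ i < n, y.coeff i = x.coeff i := by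
  rw [WittVector.mem_span_p_pow_iff_le_coeff_eq_zero, WittVector.le_coeff_eq_iff_le_sub_coeff_eq_zero]

theorem exists_eq_mul_of_ker_eq (hker : RingHom.ker r = Ideal.span {(p : A)}) (a : A)
    (ha : r a = 0) : ∃ c, a = p * c :=
  Ideal.mem_span_singleton.1 (hker ▸ (RingHom.mem_ker.2 ha))

/-- A `p`-torsion free, `p`-adically complete ring with perfect residue ring `R` of
characteristic `p` is isomorphic to the Witt vectors of `R`. -/
theorem exists_ringEquiv_wittVector [Nontrivial R] [IsAdicComplete (Ideal.span {(p : A)}) A]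
    (hr : Function.Surjective r) (hker : RingHom.ker r = Ideal.span {(p : A)})
    (hp : ∀ a : A, p * a = 0 → a = 0) :
    ∃ e : A ≃+* WittVector p R, ∀ a, (e a).coeff 0 = r a := by
  have hrp : r p = 0 := by rw [map_natCast, CharP.cast_eq_zero]
  have : Fact ¬IsUnit (p : A) := ⟨fun h => by
    have := h.map r
    rw [hrp] at this
    exact not_isUnit_zero this⟩
  let ρ : R ≃+* ModP A p :=
    ((Ideal.quotEquivOfEq hker.symm).trans (RingHom.quotientKerEquivOfSurjective hr)).symm
  have hρ : ∀ a, ρ (r a) = Ideal.Quotient.mk _ a := fun a => by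
    rw [RingEquiv.symm_apply_eq]
    rfl
  -- As `R` is perfect, its identification with `A / p` lifts to the tilt of `A`. Fontaine's `θ`
  -- composed with the induced map on Witt vectors is then a map `W(R) → A` which is an isomorphism
  -- modulo `p`: it is injective because `A` has no `p`-torsion, and surjective by `p`-adic
  -- completeness.
  let ℓ : R →+* PreTilt A p := Perfection.lift p R (ModP A p) (ρ : R →+* ModP A p)
  have hℓ : ∀ x, PreTilt.coeff 0 (ℓ x) = ρ x := fun x => rfl
  let θ : WittVector p R →+* A := (WittVector.fontaineTheta A p).comp (WittVector.map ℓ)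
  have hθ : ∀ x, r (θ x) = x.coeff 0 := fun x => by
    refine ρ.injective ?_
    rw [hρ]
    refine (WittVector.mk_fontaineTheta _).trans ?_
    rw [WittVector.map_coeff, hℓ]
  have hinj : Function.Injective θ :=
    injective_of_injective_mod (f' := RingHom.id R) (rA := WittVector.constantCoeff) (rB := r) hθ
      (exists_eq_mul_of_ker_eq WittVector.ker_constantCoeff)
      (fun a ha => IsHausdorff.haus (I := Ideal.span {(p : WittVector p R)}) inferInstance a
        fun n => by
          rw [smul_eq_mul, Ideal.mul_top, SModEq.zero, Ideal.span_singleton_pow]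
          exact Ideal.mem_span_singleton.2 (ha n)) hp Function.injective_id
  have hmap : (Ideal.span {(p : WittVector p R)}).map θ = Ideal.span {(p : A)} := by
    rw [Ideal.map_span, Set.image_singleton, map_natCast]
  have hsurj : Function.Surjective θ := by
    have : IsHausdorff ((Ideal.span {(p : WittVector p R)}).map θ) A := by
      rw [hmap]
      infer_instance
    refine surjective_of_mk_map_comp_surjective (I := Ideal.span {(p : WittVector p R)}) θ fun y => ?_
    obtain ⟨a, rfl⟩ := Ideal.Quotient.mk_surjective y
    refine ⟨WittVector.teichmuller p (r a), (Ideal.Quotient.mk_eq_mk_iff_sub_mem _ _).2 ?_⟩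
    rw [hmap, ← hker, RingHom.mem_ker, map_sub, hθ, WittVector.teichmuller_coeff_zero, sub_self]
  refine ⟨(RingEquiv.ofBijective θ ⟨hinj, hsurj⟩).symm, fun a => ?_⟩
  rw [← hθ]
  exact congrArg r ((RingEquiv.ofBijective θ ⟨hinj, hsurj⟩).apply_symm_apply a)

/-- An endomorphism of the Witt vectors of a perfect ring which is trivial modulo `p` is
trivial. -/
theorem WittVector.eq_id_of_coeff_zero_eq (g : WittVector p R →+* WittVector p R)
    (hg : ∀ x, (g x).coeff 0 = x.coeff 0) : g = RingHom.id _ := by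
  have hdvd : ∀ x, (p : WittVector p R) ∣ g x - x := fun x => by
    rw [← Ideal.mem_span_singleton, ← pow_one (p : WittVector p R),
      WittVector.mem_span_p_pow_iff_forall_coeff_eq]
    intro i hi
    obtain rfl : i = 0 := by omega
    exact hg x
  have hn : ∀ n : ℕ, (Ideal.Quotient.mk (Ideal.span {(p : WittVector p R)} ^ n)).comp g =
      Ideal.Quotient.mk (Ideal.span {(p : WittVector p R)} ^ n) := by
    intro n
    -- Modulo `p ^ n` it is enough to test Teichmüller elements. Each is a `p ^ n`-th power `[y] ^ p
    -- ^ n`, and `g [y] ≡ [y]` modulo `p` yields a congruence modulo `p ^ (n + 1)` between these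
    -- powers.
    refine WittVector.eq_of_apply_teichmuller_eq _ _ ⟨n, ?_⟩ fun x => ?_
    · rw [← map_natCast (Ideal.Quotient.mk (Ideal.span {(p : WittVector p R)} ^ n)), ← map_pow,
        Ideal.Quotient.eq_zero_iff_mem]
      exact Ideal.pow_mem_pow (Ideal.mem_span_singleton_self _) n
    · obtain ⟨y, rfl⟩ := (iterateFrobeniusEquiv R p n).surjective x
      rw [iterateFrobeniusEquiv_def, map_pow, RingHom.comp_apply, map_pow]
      refine (Ideal.Quotient.mk_eq_mk_iff_sub_mem _ _).2 ?_
      rw [Ideal.span_singleton_pow, Ideal.mem_span_singleton]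
      exact (pow_dvd_pow _ n.le_succ).trans (dvd_sub_pow_of_dvd_sub (hdvd _) n)
  refine RingHom.ext fun x => (IsHausdorff.eq_iff_smodEq (I := Ideal.span {(p : WittVector p R)})).2
    fun n => ?_
  rw [smul_eq_mul, Ideal.mul_top, SModEq.sub_mem]
  exact (Ideal.Quotient.mk_eq_mk_iff_sub_mem _ _).1 (RingHom.congr_fun (hn n) x)

theorem ringEquiv_wittVector_unique {e e' : A ≃+* WittVector p R}
    (h : ∀ a, (e' a).coeff 0 = (e a).coeff 0) : e' = e := by
  have := WittVector.eq_id_of_coeff_zero_eq ((e' : A →+* WittVector p R).comp (e.symm : _ →+* A))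
    fun x => (h _).trans (by simp)
  ext1 a
  have h2 := RingHom.congr_fun this (e a)
  simpa using h2

theorem isStrictPRing_of_ker_eq [IsAdicComplete (Ideal.span {(p : A)}) A]
    (hr : Function.Surjective r) (hker : RingHom.ker r = Ideal.span {(p : A)})
    (hp : ∀ a : A, p * a = 0 → a = 0) : IsStrictPRing p A := by
  let ρ : A ⧸ Ideal.span {(p : A)} ≃+* R :=
    (Ideal.quotEquivOfEq hker.symm).trans (RingHom.quotientKerEquivOfSurjective hr)
  refine ⟨?_, inferInstance, charP_of_injective_ringHom (f := (ρ.symm : R →+* _)) ρ.symm.injective p, ?_⟩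
  · exact mem_nonZeroDivisors_iff.2 ⟨fun a => hp a, fun a ha => hp a (by rwa [mul_comm])⟩
  · constructor
    have h : (fun x : A ⧸ Ideal.span {(p : A)} => x ^ p) = ρ.symm ∘ (fun x : R => x ^ p) ∘ ρ := by
      funext x
      simp
    rw [h]
    exact ρ.symm.bijective.comp ((PerfectRing.bijective_frobenius (R := R) (p := p)).comp ρ.bijective)

end strict

/-! ### Adic and product topologies on Witt vectors -/

section topology

theorem isHomeomorph_of_eq_induced {X Y : Type} (tX : TopologicalSpace X) (tY : TopologicalSpace Y)
    (e : X ≃ Y) (h : tX = tY.induced e) : @IsHomeomorph X Y tX tY e :=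
  (Equiv.toHomeomorphOfIsInducing e ⟨h⟩).isHomeomorph

theorem adicTopology_eq_induced {A B : Type} [CommRing A] [CommRing B] (e : A ≃+* B) (I : Ideal A)
    (J : Ideal B) (h : I.map (e : A →+* B) = J) : I.adicTopology = J.adicTopology.induced e := by
  subst h
  let τ := (I.map (e : A →+* B)).adicTopology
  have : IsTopologicalRing B := isTopologicalRing_of_isAdic (I := I.map (e : A →+* B)) rfl
  refine IsTopologicalAddGroup.ext
    I.adic_basis.toRing_subgroups_basis.toRingFilterBasis.toAddGroupFilterBasis.isTopologicalAddGroup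
    (topologicalAddGroup_induced e) ?_
  rw [nhds_induced, map_zero]
  refine I.hasBasis_nhds_zero_adic.ext ((Ideal.hasBasis_nhds_zero_adic _).comap e)
    (fun n _ => ⟨n, trivial, fun a ha => ?_⟩) fun n _ => ⟨n, trivial, fun a ha => ?_⟩
  · have ha' : e a ∈ (I.map (e : A →+* B)) ^ n := ha
    rw [← Ideal.map_pow] at ha'
    have := Ideal.mem_map_of_mem (e.symm : B →+* A) ha'
    rw [Ideal.map_map] at this
    simpa using this
  · show e a ∈ (I.map (e : A →+* B)) ^ n
    rw [← Ideal.map_pow]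
    exact Ideal.mem_map_of_mem (e : A →+* B) ha

namespace WittVector
variable {p : ℕ} [Fact p.Prime] {R : Type} [CommRing R] [CharP R p] [PerfectRing R p]

/-- Adding a multiple of `p ^ n` does not affect the coefficients of index below `n`, and `[t] ^ M`
dies in `W(R / t ^ M)`. -/
theorem coeff_sub_mem_of_sub_mem {x y : WittVector p R} {t : R} {n M : ℕ}
    (h : y - x ∈ Ideal.span {(p : WittVector p R) ^ n, teichmuller p t ^ M}) {i : ℕ} (hi : i < n) :
    y.coeff i - x.coeff i ∈ Ideal.span {t ^ M} := by
  obtain ⟨u, v, huv⟩ := Ideal.mem_span_pair.1 h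
  have h1 : y.coeff i = (y - u * (p : WittVector p R) ^ n).coeff i := by
    refine mem_span_p_pow_iff_forall_coeff_eq.1 ?_ i hi
    rw [sub_sub_cancel]
    exact Ideal.mul_mem_left _ _ (Ideal.mem_span_singleton_self _)
  have h2 : map (Ideal.Quotient.mk (Ideal.span {t ^ M})) (y - u * (p : WittVector p R) ^ n) =
      map (Ideal.Quotient.mk (Ideal.span {t ^ M})) x := by
    rw [← sub_eq_zero, ← map_sub]
    have : y - u * (p : WittVector p R) ^ n - x = v * teichmuller p t ^ M := by
      rw [sub_right_comm, ← huv]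
      ring
    rw [this, map_mul, ← map_pow, map_teichmuller,
      Ideal.Quotient.eq_zero_iff_mem.2 (Ideal.mem_span_singleton_self _), teichmuller_zero, mul_zero]
  have h3 := congrArg (fun z => z.coeff i) h2
  simp only [map_coeff] at h3
  rw [← h1] at h3
  exact (Ideal.Quotient.mk_eq_mk_iff_sub_mem _ _).1 h3

/-- Modulo `p ^ n`, `z = y - x` is the sum of the `p ^ i [φ^{-i}(z_i)]` for `i < n`. The inverse
Frobenius `φ^{-i}` divides exponents of `t` by `p ^ i`, so the exponent `M * p ^ n` leaves at least
`M`. That `z_i` inherits the congruences between the coefficients of `y` and `x` is seen in the Witt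
vectors of the quotient of `R`. -/
theorem sub_mem_of_coeff_sub_mem {x y : WittVector p R} {t : R} {n M : ℕ}
    (h : ∀ i < n, y.coeff i - x.coeff i ∈ Ideal.span {t ^ (M * p ^ n)}) :
    y - x ∈ Ideal.span {(p : WittVector p R) ^ n, teichmuller p t ^ M} := by
  have h1 : ∀ i < n, (y - x).coeff i ∈ Ideal.span {t ^ (M * p ^ n)} := by
    intro i hi
    have := (le_coeff_eq_iff_le_sub_coeff_eq_zero (n := n)
      (x := map (Ideal.Quotient.mk (Ideal.span {t ^ (M * p ^ n)})) y)
      (y := map (Ideal.Quotient.mk (Ideal.span {t ^ (M * p ^ n)})) x)).1 (fun j hj => by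
        rw [map_coeff, map_coeff]
        exact (Ideal.Quotient.mk_eq_mk_iff_sub_mem _ _).2 (h j hj)) i hi
    rw [← map_sub, map_coeff] at this
    exact Ideal.Quotient.eq_zero_iff_mem.1 this
  generalize y - x = z at *
  cases n with
  | zero =>
    rw [pow_zero, (Ideal.eq_top_iff_one _).2 (Ideal.subset_span (by simp))]
    trivial
  | succ m =>
    have h2 := dvd_sub_sum_teichmuller_iterateFrobeniusEquiv_coeff z m
    have h3 : ∀ i ∈ Finset.Iic m, teichmuller p (((_root_.frobeniusEquiv R p).symm ^ i)
        (z.coeff i)) * (p : WittVector p R) ^ i ∈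
          Ideal.span {(p : WittVector p R) ^ (m + 1), teichmuller p t ^ M} := by
      intro i hi
      rw [Finset.mem_Iic] at hi
      refine Ideal.mul_mem_right _ _ ?_
      obtain ⟨w, hw⟩ := Ideal.mem_span_singleton.1 (h1 i (by omega))
      obtain ⟨d, hd⟩ := Nat.exists_eq_add_of_le (show i ≤ m + 1 by omega)
      have h4 : ((_root_.frobeniusEquiv R p).symm ^ i) (z.coeff i) =
          t ^ M * (t ^ (M * p ^ d - M) * ((_root_.frobeniusEquiv R p).symm ^ i) w) := by
        have h5 : ((_root_.frobeniusEquiv R p).symm ^ i) ((t ^ (M * p ^ d)) ^ p ^ i) =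
            t ^ (M * p ^ d) := by
          rw [← iterateFrobeniusEquiv_symm, RingEquiv.symm_apply_eq, iterateFrobeniusEquiv_def]
        have h6 : M ≤ M * p ^ d := Nat.le_mul_of_pos_right _ (pow_pos (Fact.out : p.Prime).pos _)
        rw [hw, hd, map_mul, show M * p ^ (i + d) = M * p ^ d * p ^ i by rw [pow_add]; ring, pow_mul,
          h5, ← mul_assoc, ← pow_add, Nat.add_sub_cancel' h6]
      rw [h4, map_mul, map_pow]
      exact Ideal.mul_mem_right _ _ (Ideal.subset_span (by simp))
    have h7 := add_mem (Ideal.mem_of_dvd _ h2 (Ideal.subset_span (by simp)))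
      (Ideal.sum_mem (Ideal.span {(p : WittVector p R) ^ (m + 1), teichmuller p t ^ M}) h3)
    rwa [sub_add_cancel] at h7

/-- On the Witt vectors of a perfect ring, the product of the `t`-adic topologies is the
`(p, [t])`-adic topology. -/
theorem adicTopology_eq_wittProductTopology (t : R) :
    (Ideal.span {(p : WittVector p R), teichmuller p t}).adicTopology =
      wittProductTopology p (Ideal.span {t}).adicTopology := by
  let τ := (Ideal.span {t}).adicTopology
  refine TopologicalSpace.ext_nhds fun x => ?_
  rw [nhds_induced, nhds_pi, Filter.pi, Filter.comap_iInf]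
  simp only [Filter.comap_comap]
  refine le_antisymm (le_iInf fun i => ?_) ?_
  · rw [← Filter.map_le_iff_le_comap]
    refine ((Ideal.hasBasis_nhds_adic _ _).map _).le_basis_iff (Ideal.hasBasis_nhds_adic _ _) |>.2
      fun N _ => ⟨i + 1 + N, trivial, ?_⟩
    rintro _ ⟨_, ⟨z, hz, rfl⟩, rfl⟩
    refine ⟨(x + z).coeff i - x.coeff i, ?_, add_sub_cancel _ _⟩
    rw [Ideal.span_singleton_pow]
    refine coeff_sub_mem_of_sub_mem (n := i + 1) ?_ (Nat.lt_succ_self i)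
    rw [add_sub_cancel_left, Ideal.span_insert]
    rw [Ideal.span_insert] at hz
    have := Ideal.sup_pow_add_le_pow_sup_pow hz
    rwa [Ideal.span_singleton_pow, Ideal.span_singleton_pow] at this
  · refine (Ideal.hasBasis_nhds_adic _ _).ge_iff.2 fun n _ => ?_
    have h1 : ∀ i, {y : WittVector p R | y.coeff i - x.coeff i ∈ Ideal.span {t ^ (n * p ^ n)}} ∈
        ⨅ i, Filter.comap ((fun f : ℕ → R => f i) ∘ fun (x : WittVector p R) i => x.coeff i)
          (@nhds R (Ideal.span {t}).adicTopology (x.coeff i)) := by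
      intro i
      refine Filter.mem_iInf_of_mem i ⟨_, (Ideal.hasBasis_nhds_adic _ _).mem_of_mem
        (i := n * p ^ n) trivial, ?_⟩
      rintro y ⟨z, hz, hz'⟩
      rw [Ideal.span_singleton_pow] at hz
      have hz'' : x.coeff i + z = y.coeff i := hz'
      rwa [Set.mem_ofPred_eq, ← hz'', add_sub_cancel_left]
    filter_upwards [(Filter.biInter_finset_mem (Finset.range n)).2 fun i _ => h1 i] with y hy
    refine ⟨y - x, ?_, add_sub_cancel _ _⟩
    have h2 := sub_mem_of_coeff_sub_mem (x := x) (y := y) (t := t) (n := n) (M := n) fun i hi => by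
      have := Set.mem_iInter₂.1 hy i (Finset.mem_range.2 hi)
      exact this
    refine Ideal.span_le.2 ?_ h2
    rintro z (rfl | rfl)
    · exact Ideal.pow_mem_pow (Ideal.subset_span (by simp)) n
    · exact Ideal.pow_mem_pow (Ideal.subset_span (by simp)) n

/-- This is the case `t = 0` of the preceding comparison. -/
theorem pAdicTopology_eq_wittProductTopology_bot :
    pAdicTopology p (WittVector p R) = wittProductTopology p ⊥ := by
  have h1 := adicTopology_eq_wittProductTopology (p := p) (0 : R)
  have h2 : (Ideal.span {(0 : R)}).adicTopology = ⊥ := by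
    let := (⊥ : TopologicalSpace R)
    have : DiscreteTopology R := ⟨rfl⟩
    have h3 : IsAdic (⊥ : Ideal R) := is_bot_adic_iff.2 this
    rw [Set.singleton_zero, Ideal.span_zero]
    exact h3.symm
  rw [teichmuller_zero, h2] at h1
  rw [← h1, Ideal.span_insert, Set.singleton_zero, Ideal.span_zero, sup_bot_eq]

end WittVector
end topology

/-! ### Uniqueness of `p`-power roots -/

section roots

variable {p : ℕ} [Fact p.Prime] {A : Type} [CommRing A] [IsDomain A] (hprime : Prime (p : A))
include hprime

/-- A `p`-th root is determined by its reduction modulo `p`, for `p` odd. -/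
theorem eq_of_pow_prime_eq (hodd : Odd p) {a b : A} (h : a ^ p = b ^ p) (hab : (p : A) ∣ a - b)
    (hb : ¬(p : A) ∣ b) : a = b := by
  by_contra hne
  obtain ⟨c, hc⟩ := hab
  obtain rfl : a = b + p * c := by rw [← hc]; ring
  have h1 := Commute.geom_sum₂_mul (Commute.all (b + p * c) b) p
  rw [h, sub_self] at h1
  have h2 := (mul_eq_zero.1 h1).resolve_right (sub_ne_zero.2 hne)
  -- For `p` odd, `(a ^ p - b ^ p) / (a - b)` is congruent to `p b ^ (p - 1)` modulo `p ^ 2`; if it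
  -- vanished, `p` would divide `b`.
  have h3 := odd_sq_dvd_geom_sum₂_sub b c hodd
  rw [h2, zero_sub, dvd_neg, pow_two, mul_dvd_mul_iff_left hprime.ne_zero] at h3
  exact hb (hprime.dvd_of_dvd_pow h3)

theorem eq_of_pow_prime_pow_eq (hodd : Odd p) {a b : A} (n : ℕ) (h : a ^ p ^ n = b ^ p ^ n)
    (hab : (p : A) ∣ a - b) (hb : ¬(p : A) ∣ b) : a = b := by
  induction n with
  | zero => simpa using h
  | succ n ih =>
    rw [pow_succ, pow_mul, pow_mul] at h
    exact ih (eq_of_pow_prime_eq hprime hodd h (hab.trans (sub_dvd_pow_sub_pow _ _ _))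
      fun h => hb (hprime.dvd_of_dvd_pow h))

-- A sign can only appear at the last square root. Earlier it would give `u ^ 2 = -v ^ 2` with `u =
-- v + 2c`, hence `v ^ 2` divisible by `2`, against the primality of `2` and the hypothesis on `b`.
omit [Fact p.Prime] in
theorem eq_or_eq_neg_of_pow_two_pow_eq (hp2 : p = 2) {a b : A} (n : ℕ)
    (h : a ^ 2 ^ (n + 1) = b ^ 2 ^ (n + 1)) (hab : (p : A) ∣ a - b) (hb : ¬(p : A) ∣ b) :
    a = b ∨ a = -b := by
  subst hp2
  induction n with
  | zero => simpa using sq_eq_sq_iff_eq_or_eq_neg.1 h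
  | succ n ih =>
    rw [pow_succ 2 (n + 1), pow_mul, pow_mul] at h
    rcases sq_eq_sq_iff_eq_or_eq_neg.1 h with h | h
    · exact ih h
    · exfalso
      rw [pow_succ, pow_mul, pow_mul] at h
      obtain ⟨c, hc⟩ := hab.trans (sub_dvd_pow_sub_pow a b (2 ^ n))
      have h1 : a ^ 2 ^ n = b ^ 2 ^ n + 2 * c := by
        push_cast at hc
        rw [← hc]; ring
      generalize a ^ 2 ^ n = u at *
      generalize hv : b ^ 2 ^ n = v at *
      subst h1
      have h2 : ((2 : ℕ) : A) * (v ^ 2 + 2 * (v * c + c ^ 2)) = 0 := by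
        push_cast
        linear_combination h
      have h3 := (mul_eq_zero.1 h2).resolve_left hprime.ne_zero
      have h4 : ((2 : ℕ) : A) ∣ v ^ 2 := ⟨-(v * c + c ^ 2), by push_cast; linear_combination h3⟩
      rw [← hv] at h4
      exact hb (hprime.dvd_of_dvd_pow (hprime.dvd_of_dvd_pow h4))

end roots

/-! ### The Teichmüller elements `T̃_n` -/

namespace UnifMeasure
variable {p : ℕ} [Fact p.Prime]

section witt
variable {e : UnifMeasure p ℤ_[p] ≃+* WittVector p (UnifMeasure p (ZMod p))}

/-- The element `T̃_n = e⁻¹ [t_n]`. -/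
noncomputable def teichmullerDirac
    (e : UnifMeasure p ℤ_[p] ≃+* WittVector p (UnifMeasure p (ZMod p))) (n : ℕ) :
    UnifMeasure p ℤ_[p] :=
  e.symm (WittVector.teichmuller p (diracSub p (ZMod p) n))

theorem apply_teichmullerDirac (n : ℕ) :
    e (teichmullerDirac e n) = WittVector.teichmuller p (diracSub p (ZMod p) n) :=
  e.apply_symm_apply _

theorem teichmullerDirac_succ_pow (n : ℕ) :
    teichmullerDirac e (n + 1) ^ p = teichmullerDirac e n := by
  rw [teichmullerDirac, ← map_pow, ← map_pow, diracSub_succ_pow, teichmullerDirac]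

variable (he : ∀ μ, (e μ).coeff 0 = reduction p μ)
include he

theorem reduction_teichmullerDirac (n : ℕ) :
    reduction p (teichmullerDirac e n) = diracSub p (ZMod p) n := by
  rw [← he, apply_teichmullerDirac, WittVector.teichmuller_coeff_zero]

theorem exists_diracSub_sub_eq_mul (n : ℕ) :
    ∃ c, diracSub p ℤ_[p] n - teichmullerDirac e n = p * c :=
  exists_eq_mul_of_reduction_eq_zero (by
    rw [map_sub, reduction_diracSub, reduction_teichmullerDirac he, sub_self])

/-- `T_{n+m}` and `T̃_{n+m}` agree modulo `p`, so their `p ^ m`-th powers agree modulo `p ^ (m +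
1)`, and the second power is `T̃_n`. -/
theorem tendsto_diracSub_pow (n : ℕ) :
    Tendsto (fun m => diracSub p ℤ_[p] (n + m) ^ p ^ m) atTop
      (@nhds _ (pAdicTopology p (UnifMeasure p ℤ_[p])) (teichmullerDirac e n)) := by
  refine (Ideal.hasBasis_nhds_adic _ _).tendsto_right_iff.2 fun N _ => ?_
  filter_upwards [eventually_ge_atTop N] with m hm
  refine ⟨diracSub p ℤ_[p] (n + m) ^ p ^ m - teichmullerDirac e n, ?_, add_sub_cancel _ _⟩
  rw [Ideal.span_singleton_pow, ← PerfPoly.pow_pow_eq _ (teichmullerDirac_succ_pow (e := e)) n m]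
  obtain ⟨c, hc⟩ := exists_diracSub_sub_eq_mul he (n + m)
  exact Ideal.mem_span_singleton.2 ((pow_dvd_pow _ (by omega : N ≤ m + 1)).trans
    (dvd_sub_pow_of_dvd_sub ⟨c, hc⟩ m))

theorem span_p_teichmullerDirac : Ideal.span {(p : UnifMeasure p ℤ_[p]), teichmullerDirac e 0} =
    Ideal.span {(p : UnifMeasure p ℤ_[p]), diracSub p ℤ_[p] 0} := by
  obtain ⟨c, hc⟩ := exists_diracSub_sub_eq_mul he 0
  refine le_antisymm (Ideal.span_le.2 ?_) (Ideal.span_le.2 ?_)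
  · rintro x (rfl | rfl)
    · exact Ideal.subset_span (by simp)
    · exact Ideal.mem_span_pair.2 ⟨-c, 1, by linear_combination hc⟩
  · rintro x (rfl | rfl)
    · exact Ideal.subset_span (by simp)
    · exact Ideal.mem_span_pair.2 ⟨c, 1, by linear_combination -hc⟩

theorem isAdic_span_p_teichmullerDirac :
    IsAdic (Ideal.span {(p : UnifMeasure p ℤ_[p]), teichmullerDirac e 0}) := by
  rw [span_p_teichmullerDirac he]
  exact isAdic_span_p_diracSub

omit he in
theorem natCast_dvd_iff {μ : UnifMeasure p ℤ_[p]} :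
    (p : UnifMeasure p ℤ_[p]) ∣ μ ↔ reduction p μ = 0 := by
  rw [← Ideal.mem_span_singleton, ← ker_reduction, RingHom.mem_ker]

omit he in
theorem isDomain_int (e : UnifMeasure p ℤ_[p] ≃+* WittVector p (UnifMeasure p (ZMod p))) :
    IsDomain (UnifMeasure p ℤ_[p]) :=
  e.toMulEquiv.isDomain _

omit he in
theorem prime_natCast : Prime (p : UnifMeasure p ℤ_[p]) := by
  refine ⟨fun h => ?_, fun h => ?_, fun a b hab => ?_⟩
  · have := eq_zero_of_natCast_mul_eq_zero (p := p) (μ := 1) (by rw [h, zero_mul])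
    have h2 := congrArg (reduction p) this
    rw [map_one, map_zero] at h2
    exact one_ne_zero h2
  · have := h.map (reduction p)
    rw [reduction_natCast] at this
    exact not_isUnit_zero this
  · rw [natCast_dvd_iff, map_mul, mul_eq_zero] at hab
    rwa [natCast_dvd_iff, natCast_dvd_iff]

/-- The reduction of a root is a `p ^ n`-th root of `t`, so it is `t_n` by injectivity of Frobenius.
The root is thus congruent to `T̃_n` modulo `p`, and `p` does not divide `T̃_n` because `t_n ≠ 0`.
-/
theorem pow_eq_teichmullerDirac_iff (n : ℕ) (hn : 1 ≤ n) (x : UnifMeasure p ℤ_[p]) :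
    x ^ p ^ n = teichmullerDirac e 0 ↔
      x = teichmullerDirac e n ∨ p = 2 ∧ x = -teichmullerDirac e n := by
  have := isDomain_int e
  have hT : teichmullerDirac e n ^ p ^ n = teichmullerDirac e 0 := by
    simpa using PerfPoly.pow_pow_eq _ (teichmullerDirac_succ_pow (e := e)) 0 n
  constructor
  · intro hx
    have h1 : reduction p x = diracSub p (ZMod p) n := by
      refine iterateFrobenius_inj (UnifMeasure p (ZMod p)) p n ?_
      rw [iterateFrobenius_def, iterateFrobenius_def, ← map_pow, hx, reduction_teichmullerDirac he,
        diracSub_pow_self]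
    have h2 : (p : UnifMeasure p ℤ_[p]) ∣ x - teichmullerDirac e n := by
      rw [natCast_dvd_iff, map_sub, h1, reduction_teichmullerDirac he, sub_self]
    have h3 : ¬(p : UnifMeasure p ℤ_[p]) ∣ teichmullerDirac e n := by
      rw [natCast_dvd_iff, reduction_teichmullerDirac he]
      exact diracSub_zmod_ne_zero n
    rw [← hT] at hx
    rcases (Fact.out : p.Prime).eq_two_or_odd' with hp | hp
    · obtain ⟨m, rfl⟩ := Nat.exists_eq_add_of_le' hn
      refine (eq_or_eq_neg_of_pow_two_pow_eq prime_natCast hp m ?_ h2 h3).imp_right fun h => ⟨hp, h⟩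
      have h4 : ∀ y : UnifMeasure p ℤ_[p], y ^ 2 ^ (m + 1) = y ^ p ^ (m + 1) := fun y =>
        congrArg (fun q : ℕ => y ^ q ^ (m + 1)) hp.symm
      rw [h4, h4, hx]
    · exact Or.inl (eq_of_pow_prime_pow_eq prime_natCast hp n hx h2 h3)
  · rintro (rfl | ⟨hp, rfl⟩)
    · exact hT
    · have h2 : Even p := by rw [hp]; exact even_two
      exact (Even.neg_pow (Nat.even_pow.2 ⟨h2, by omega⟩) _).trans hT

omit he in
/-- The map `ℤ[X^{1/p^∞}] → D_unif(ℚ_p, ℤ_p)`, `X^{1/p^n} ↦ T̃_n`. -/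
noncomputable def ofPerfPolyInt
    (e : UnifMeasure p ℤ_[p] ≃+* WittVector p (UnifMeasure p (ZMod p))) :
    PerfPoly ℤ p →ₐ[ℤ] UnifMeasure p ℤ_[p] :=
  PerfPoly.eval ℤ (teichmullerDirac e) teichmullerDirac_succ_pow

omit he in
theorem ofPerfPolyInt_root (n : ℕ) :
    ofPerfPolyInt e (PerfPoly.root ℤ p n) = teichmullerDirac e n :=
  PerfPoly.eval_root _ _ _ n

theorem reduction_ofPerfPolyInt (a : PerfPoly ℤ p) :
    reduction p (ofPerfPolyInt e a) = ofPerfPoly p (AddMonoidAlgebra.reductionMod p _ a) := by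
  refine reduction_lift _ _ (fun q => ?_) a
  obtain ⟨n, m, h⟩ := PerfPoly.exists_natCast_eq q.toAdd
  have h1 := PerfPoly.powHom_apply (teichmullerDirac e) teichmullerDirac_succ_pow q.toAdd h
  have h2 := PerfPoly.powHom_apply (diracSub p (ZMod p)) diracSub_succ_pow q.toAdd h
  rw [ofAdd_toAdd] at h1 h2
  rw [h1, h2, map_pow, reduction_teichmullerDirac he]

theorem ofPerfPolyInt_injective : Function.Injective (ofPerfPolyInt e) :=
  injective_of_injective_mod (f := (ofPerfPolyInt e : PerfPoly ℤ p →+* UnifMeasure p ℤ_[p]))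
    (f' := (ofPerfPoly p : PerfPoly (ZMod p) p →+* UnifMeasure p (ZMod p))) (reduction_ofPerfPolyInt he)
    AddMonoidAlgebra.exists_eq_mul_of_reductionMod_eq_zero
    AddMonoidAlgebra.eq_zero_of_forall_pow_dvd (fun _ => eq_zero_of_natCast_mul_eq_zero)
    ofPerfPoly_injective

theorem isRingCompletion_ofPerfPolyInt :
    IsRingCompletion (Ideal.span {(p : PerfPoly ℤ p), PerfPoly.root ℤ p 0}).adicTopology
      (ofPerfPolyInt e : PerfPoly ℤ p →+* UnifMeasure p ℤ_[p]) := by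
  have h1 : AddMonoidAlgebra.reductionMod p (zInvNonneg p) (PerfPoly.root ℤ p 0) =
      PerfPoly.root (ZMod p) p 0 := by
    rw [PerfPoly.root, AddMonoidAlgebra.reductionMod_single, Int.cast_one, PerfPoly.root]
  refine isRingCompletion_int (ofPerfPolyInt e : PerfPoly ℤ p →+* UnifMeasure p ℤ_[p])
    (ofPerfPoly p : PerfPoly (ZMod p) p →+* UnifMeasure p (ZMod p)) (reduction_ofPerfPolyInt he) (PerfPoly.root ℤ p 0)
    ?_ ?_ exists_sub_ofPerfPoly_mem ?_
  · rw [h1]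
    exact ofPerfPoly_root 0
  · rw [h1]
    exact pow_dvd_of_ofPerfPoly_mem
  · have h2 : (ofPerfPolyInt e : PerfPoly ℤ p →+* UnifMeasure p ℤ_[p]) (PerfPoly.root ℤ p 0) =
        teichmullerDirac e 0 := ofPerfPolyInt_root 0
    rw [h2]
    exact isAdic_span_p_teichmullerDirac he

omit he in
theorem pAdicTopology_eq_induced :
    pAdicTopology p (UnifMeasure p ℤ_[p]) =
      (pAdicTopology p (WittVector p (UnifMeasure p (ZMod p)))).induced e :=
  adicTopology_eq_induced e _ _ (by rw [Ideal.map_span, Set.image_singleton, map_natCast])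

/-- `e` carries `(p, T̃)` to `(p, [t])`, whose adic topology is the product one. Replacing `T` by
`T̃` does not change the ideal on the side of measures, since they agree modulo `p`. -/
theorem topology_eq_induced_wittProductTopology :
    (inferInstance : TopologicalSpace (UnifMeasure p ℤ_[p])) =
      (wittProductTopology p (R := UnifMeasure p (ZMod p)) inferInstance).induced e := by
  have h1 : (inferInstance : TopologicalSpace (UnifMeasure p ℤ_[p])) =
      (Ideal.span {(p : UnifMeasure p ℤ_[p]), teichmullerDirac e 0}).adicTopology :=
    isAdic_span_p_teichmullerDirac he
  have h2 : (inferInstance : TopologicalSpace (UnifMeasure p (ZMod p))) =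
      (Ideal.span {diracSub p (ZMod p) 0}).adicTopology := isAdic_diracSub
  rw [h1, h2, ← WittVector.adicTopology_eq_wittProductTopology]
  refine adicTopology_eq_induced e _ _ ?_
  rw [Ideal.map_span, Set.image_pair, map_natCast]
  exact congrArg (fun x => Ideal.span {_, x}) (apply_teichmullerDirac 0)

end witt

end UnifMeasure

/-! ### The identification with `A_inf` and the final statement -/

/-- The isomorphism of rings of Witt vectors induced by an isomorphism of rings. -/
noncomputable def wittVectorMapEquiv (p : ℕ) [Fact p.Prime] {R S : Type} [CommRing R] [CommRing S]
    (j : R ≃+* S) : WittVector p R ≃+* WittVector p S :=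
  RingEquiv.ofRingHom (WittVector.map (j : R →+* S)) (WittVector.map (j.symm : S →+* R))
    (by ext x n; simp [WittVector.map_coeff]) (by ext x n; simp [WittVector.map_coeff])

theorem proposition8p2 (p : ℕ) [Fact p.Prime] :
    ∃ (φ : PerfPoly (ZMod p) p →+* UnifMeasure p (ZMod p))
      (j : PerfPoly.Completion p ≃+* UnifMeasure p (ZMod p))
      (e : UnifMeasure p ℤ_[p] ≃+* WittVector p (UnifMeasure p (ZMod p)))
      (Tt : ℕ → UnifMeasure p ℤ_[p])
      (ψ : PerfPoly ℤ p →+* UnifMeasure p ℤ_[p]),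
    -- (1) `D_unif(ℚ_p, 𝔽_p)`; its natural topology is the `t`-adic one, `t = δ_1 - δ_0`
    (IsAdic (Ideal.span {UnifMeasure.diracSub p (ZMod p) 0}) ∧
      -- completion of `𝔽_p[ℚ_p]` for the topology given by the powers of `t` in the measures
      Function.Injective (UnifMeasure.ofGroupAlgebra p (ZMod p) (ZMod p)) ∧
      IsRingCompletion
        ((Ideal.span {UnifMeasure.diracSub p (ZMod p) 0}).adicTopology.induced
          (UnifMeasure.ofGroupAlgebra p (ZMod p) (ZMod p)))
        (UnifMeasure.ofGroupAlgebra p (ZMod p) (ZMod p)) ∧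
      -- completion of `𝔽_p[ℤ[1/p]]` in its own `(δ_1 - δ_0)`-adic topology
      Function.Injective (UnifMeasure.ofGroupAlgebraZInv p (ZMod p) (ZMod p)) ∧
      IsRingCompletion
        (Ideal.span {(AddMonoidAlgebra.single (UnifMeasure.zInvOne p) 1 -
          AddMonoidAlgebra.single 0 1 :
            AddMonoidAlgebra (ZMod p) (UnifMeasure.zInv p))}).adicTopology
        (UnifMeasure.ofGroupAlgebraZInv p (ZMod p) (ZMod p)) ∧
      -- completion of `𝔽_p[t^{1/p^∞}]` in its `t`-adic topology
      (∀ n, φ (PerfPoly.root (ZMod p) p n) = UnifMeasure.diracSub p (ZMod p) n) ∧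
      Function.Injective φ ∧
      IsRingCompletion (Ideal.span {PerfPoly.root (ZMod p) p 0}).adicTopology φ ∧
      (∀ x, j (AdicCompletion.of _ _ x) = φ x) ∧
      CharP (UnifMeasure p (ZMod p)) p ∧ PerfectRing (UnifMeasure p (ZMod p)) p) ∧
    -- (2) `D_unif(ℚ_p, ℤ_p)` is a strict `p`-ring with residue ring `D_unif(ℚ_p, 𝔽_p)`
    (IsStrictPRing p (UnifMeasure p ℤ_[p]) ∧
      Function.Surjective (UnifMeasure.reduction p) ∧
      RingHom.ker (UnifMeasure.reduction p) = Ideal.span {(p : UnifMeasure p ℤ_[p])} ∧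
      (∀ μ, (e μ).coeff 0 = UnifMeasure.reduction p μ) ∧
      (∀ e' : UnifMeasure p ℤ_[p] ≃+* WittVector p (UnifMeasure p (ZMod p)),
        (∀ μ, (e' μ).coeff 0 = UnifMeasure.reduction p μ) → e' = e) ∧
      ∃ E : UnifMeasure p ℤ_[p] ≃+* Ainf p, ∀ μ, WittVector.map (j : _ →+* _) (E μ) = e μ) ∧
    -- (3) the natural topology of `D_unif(ℚ_p, ℤ_p)` is the `(p, T)`-adic one, `T = Δ_1 - Δ_0`
    (IsAdic (Ideal.span {(p : UnifMeasure p ℤ_[p]), UnifMeasure.diracSub p ℤ_[p] 0}) ∧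
      -- completion of `ℤ[ℚ_p]` for the topology given by the powers of `(p, T)` in the measures
      Function.Injective (UnifMeasure.ofGroupAlgebra p ℤ ℤ_[p]) ∧
      IsRingCompletion
        ((Ideal.span {(p : UnifMeasure p ℤ_[p]),
            UnifMeasure.diracSub p ℤ_[p] 0}).adicTopology.induced
          (UnifMeasure.ofGroupAlgebra p ℤ ℤ_[p]))
        (UnifMeasure.ofGroupAlgebra p ℤ ℤ_[p]) ∧
      -- completion of `ℤ[ℤ[1/p]]` in its own `(p, Δ_1 - Δ_0)`-adic topology
      Function.Injective (UnifMeasure.ofGroupAlgebraZInv p ℤ ℤ_[p]) ∧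
      IsRingCompletion
        (Ideal.span {(p : AddMonoidAlgebra ℤ (UnifMeasure.zInv p)),
          AddMonoidAlgebra.single (UnifMeasure.zInvOne p) 1 -
            AddMonoidAlgebra.single 0 1}).adicTopology
        (UnifMeasure.ofGroupAlgebraZInv p ℤ ℤ_[p])) ∧
    -- (4) the elements `T̃_n = lim_m (Δ_{1/p^{n+m}} - Δ_0)^{p^m} = [δ_{1/p^n} - δ_0] = [t^{1/p^n}]`
    ((∀ n, Filter.Tendsto (fun m => UnifMeasure.diracSub p ℤ_[p] (n + m) ^ p ^ m) Filter.atTop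
        (@nhds _ (pAdicTopology p (UnifMeasure p ℤ_[p])) (Tt n))) ∧
      (∀ n, e (Tt n) = WittVector.teichmuller p (UnifMeasure.diracSub p (ZMod p) n)) ∧
      (∀ n, UnifMeasure.diracSub p (ZMod p) n ^ p ^ n = UnifMeasure.diracSub p (ZMod p) 0) ∧
      (∀ n, 1 ≤ n → ∀ x : UnifMeasure p ℤ_[p],
        x ^ p ^ n = Tt 0 ↔ x = Tt n ∨ p = 2 ∧ x = -Tt n) ∧
      (∀ n, ψ (PerfPoly.root ℤ p n) = Tt n) ∧
      Function.Injective ψ ∧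
      IsRingCompletion
        (Ideal.span {(p : PerfPoly ℤ p), PerfPoly.root ℤ p 0}).adicTopology ψ ∧
      IsAdic (Ideal.span {(p : UnifMeasure p ℤ_[p]), Tt 0})) ∧
    -- (5) the identification with the Witt vectors is topological in two ways
    -- (a) `p`-adic topologies; equivalently, on Witt vectors, the product of discrete topologies
    (@IsHomeomorph _ _ (pAdicTopology p _) (pAdicTopology p _) e ∧
      @IsHomeomorph _ _ (pAdicTopology p _) (wittProductTopology p ⊥) e ∧
      -- (b) natural topologies; on Witt vectors, the product of the natural topologies
      @IsHomeomorph _ _ inferInstance (wittProductTopology p inferInstance) e) := by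
  obtain ⟨j, hj⟩ := UnifMeasure.exists_completion_ringEquiv (p := p)
  obtain ⟨e, he⟩ := exists_ringEquiv_wittVector (r := UnifMeasure.reduction p)
    UnifMeasure.reduction_surjective UnifMeasure.ker_reduction
    fun _ => UnifMeasure.eq_zero_of_natCast_mul_eq_zero
  refine ⟨(UnifMeasure.ofPerfPoly p : PerfPoly (ZMod p) p →+* UnifMeasure p (ZMod p)), j, e,
    UnifMeasure.teichmullerDirac e,
    (UnifMeasure.ofPerfPolyInt e : PerfPoly ℤ p →+* UnifMeasure p ℤ_[p]), ?_, ?_, ?_, ?_, ?_⟩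
  · exact ⟨UnifMeasure.isAdic_diracSub, UnifMeasure.ofGroupAlgebra_injective,
      UnifMeasure.isRingCompletion_ofGroupAlgebra_zmod, UnifMeasure.ofGroupAlgebraZInv_injective,
      UnifMeasure.isRingCompletion_ofGroupAlgebraZInv_zmod, UnifMeasure.ofPerfPoly_root,
      UnifMeasure.ofPerfPoly_injective, UnifMeasure.isRingCompletion_ofPerfPoly, hj,
      inferInstance, inferInstance⟩
  · refine ⟨isStrictPRing_of_ker_eq UnifMeasure.reduction_surjective UnifMeasure.ker_reduction
      fun _ => UnifMeasure.eq_zero_of_natCast_mul_eq_zero, UnifMeasure.reduction_surjective,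
      UnifMeasure.ker_reduction, he,
      fun e' he' => ringEquiv_wittVector_unique fun μ => (he' μ).trans (he μ).symm,
      e.trans (wittVectorMapEquiv p j).symm, fun μ => ?_⟩
    exact (wittVectorMapEquiv p j).apply_symm_apply (e μ)
  · exact ⟨UnifMeasure.isAdic_span_p_diracSub, UnifMeasure.ofGroupAlgebra_int_injective,
      UnifMeasure.isRingCompletion_ofGroupAlgebra_int,
      UnifMeasure.ofGroupAlgebraZInv_int_injective,
      UnifMeasure.isRingCompletion_ofGroupAlgebraZInv_int⟩
  · exact ⟨UnifMeasure.tendsto_diracSub_pow he, UnifMeasure.apply_teichmullerDirac,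
      UnifMeasure.diracSub_pow_self, UnifMeasure.pow_eq_teichmullerDirac_iff he,
      UnifMeasure.ofPerfPolyInt_root, UnifMeasure.ofPerfPolyInt_injective he,
      UnifMeasure.isRingCompletion_ofPerfPolyInt he,
      UnifMeasure.isAdic_span_p_teichmullerDirac he⟩
  · exact ⟨isHomeomorph_of_eq_induced _ _ e.toEquiv UnifMeasure.pAdicTopology_eq_induced,
      isHomeomorph_of_eq_induced _ _ e.toEquiv
        (WittVector.pAdicTopology_eq_wittProductTopology_bot (p := p)
          (R := UnifMeasure p (ZMod p)) ▸ UnifMeasure.pAdicTopology_eq_induced),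
      isHomeomorph_of_eq_induced _ _ e.toEquiv
        (UnifMeasure.topology_eq_induced_wittProductTopology he)⟩
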